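/- Fix $b_1,\rho\in(0,1)$. For $\varepsilon>0$ put $\tau=\tau_\varepsilon:=e^{-\sqrt\varepsilon}$, $b_2:=b_1\tau$, $$\lambda=\lambda_\varepsilon:=\frac{1-b_2\tau^{-\rho}}{b_1-(b_1+b_2-1)\tau^{-\rho}},\qquad \mu=\mu_\varepsilon:=\frac{\tau^{-\rho}(1-b_1)(1-b_2)}{(b_1-(b_1+b_2-1)\tau^{-\rho})(1-b_2\tau^{-\rho})},$$ and $\Xi(t):=\mathbb{Z}-t\mu_\varepsilon$ for $t\in\mathbb{Z}_{\ge0}$. The two-point semigroup of the Hopf–Cole transformed stochastic six vertex model is, for $y_1<y_2\in\Xi(s)$ and $x_1<x_2\in\Xi(t+s)$, $$\mathcal{U}_\varepsilon\big((y_1,y_2),(x_1,x_2);t\big):=\oint_{\mathcal{C}_r}\oint_{\mathcal{C}_r}\Big(z_1^{x_1-y_1+\delta}z_2^{x_2-y_2+\delta}-\mathfrak{F}(z_1,z_2)\,z_1^{x_2-y_1+\delta}z_2^{x_1-y_2+\delta}\Big)\prod_{i=1}^2\frac{\mathfrak{D}(t,z_i)\,dz_i}{2\pi\mathbf{i}z_i},$$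 where $\delta:=\mu t-\lfloor\mu t\rfloor$ (so all these exponents are integers), $\mathcal{C}_r$ is the counter-clockwise circle centred at $0$ with any radius $r>0$ so large that the integrand has no pole with $|z_1|,|z_2|\ge r$, and $$\mathfrak{F}(z_1,z_2):=\frac{1+\tau^{-1+2\rho}z_1z_2-(1+\tau^{-1})\tau^{\rho}z_2}{1+\tau^{-1+2\rho}z_1z_2-(1+\tau^{-1})\tau^{\rho}z_1},\qquad \mathfrak{D}(t,z):=z^{\lfloor\mu t\rfloor}\Big(\lambda\,\frac{b_1+(1-b_1-b_2)/(\tau^\rho z)}{1-b_2/(\tau^\rho z)}\Big)^{t}.$$ Write $\nabla f(x):=f(x+1)-f(x)$, with a subscript for the variable on which it acts. **Proposition 5.1.** For any $\alpha,T\in(0,\infty)$ there exist constants $C(\alpha,T),C(\alpha)>0$ (which may also depend on $b_1,\rho$, and where $C(\alpha)$ does not depend on $T$) such that $$\big|\mathcal{U}_\varepsilon\big((y_1,y_2),(x_1,x_2);t\big)\big|\le\frac{C(\alpha,T)}{t+1}\exp\Big(-\frac{\alpha(|x_1-y_1|+|x_2-y_2|)}{\sqrt{t+1}+C(\alpha)}\Big),$$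 $$\big|\nabla_{x_j}\mathcal{U}_\varepsilon\big((y_1,y_2),(x_1,x_2);t\big)\big|,\ \big|\nabla_{y_j}\mathcal{U}_\varepsilon\big((y_1,y_2),(x_1,x_2);t\big)\big|\le\frac{C(\alpha,T)}{(t+1)^{3/2}}\exp\Big(-\frac{\alpha(|x_1-y_1|+|x_2-y_2|)}{\sqrt{t+1}+C(\alpha)}\Big)$$ for all $\varepsilon>0$, all integers $s,t\in[0,\varepsilon^{-2}T]$, $j=1,2$, and all $x_1<x_2$ in $\Xi(t+s)$ and $y_1<y_2$ in $\Xi(s)$, where the bound on $\nabla_{x_1}$ is claimed only if moreover $x_1+1<x_2$, and the bound on $\nabla_{y_1}$ only if moreover $y_1+1<y_2$. -/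

import Mathlib

open Complex in
open scoped Real in
/-- `(2πi)⁻¹ ∮ f(z) dz` over the counter-clockwise circle of radius `r` centred at the origin. -/
noncomputable def S6V.contour (r : ℝ) (f : ℂ → ℂ) : ℂ :=
  (2 * π * I)⁻¹ * ∮ z in C(0, r), f z

namespace S6V

/-- `τ = τ_ε = exp(-√ε)` (weak asymmetry scaling). -/
noncomputable def tau (ε : ℝ) : ℝ := Real.exp (-√ε)

/-- `b₂ = b₂^ε = b₁ τ_ε`. -/
noncomputable def b2 (b₁ ε : ℝ) : ℝ := b₁ * tau ε

/-- `λ_ε`. -/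
noncomputable def lam (b₁ ρ ε : ℝ) : ℝ :=
  (1 - b2 b₁ ε * tau ε ^ (-ρ)) / (b₁ - (b₁ + b2 b₁ ε - 1) * tau ε ^ (-ρ))

/-- `μ_ε`. -/
noncomputable def mu (b₁ ρ ε : ℝ) : ℝ :=
  (tau ε ^ (-ρ) * (1 - b₁) * (1 - b2 b₁ ε)) /
    ((b₁ - (b₁ + b2 b₁ ε - 1) * tau ε ^ (-ρ)) * (1 - b2 b₁ ε * tau ε ^ (-ρ)))

/-- The shifted lattice `Ξ(t) = ℤ - t μ_ε`. -/
def Xi (b₁ ρ ε : ℝ) (t : ℕ) : Set ℝ := {x | ∃ n : ℤ, x = n - t * mu b₁ ρ ε}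

/-- The denominator `1 + τ^{-1+2ρ} z₁ z₂ - (1 + τ⁻¹) τ^ρ z₁` of the interaction factor. -/
noncomputable def interDenom (ρ ε : ℝ) (z₁ z₂ : ℂ) : ℂ :=
  1 + (tau ε ^ (-1 + 2 * ρ) : ℝ) * z₁ * z₂ - ((1 + (tau ε)⁻¹) * tau ε ^ ρ : ℝ) * z₁

/-- The interaction factor `𝔉(z₁,z₂)`; its numerator is
`1 + τ^{-1+2ρ} z₁ z₂ - (1 + τ⁻¹) τ^ρ z₂`. -/
noncomputable def inter (ρ ε : ℝ) (z₁ z₂ : ℂ) : ℂ :=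
  interDenom ρ ε z₂ z₁ / interDenom ρ ε z₁ z₂

/-- `𝔇(t,z) = z^{⌊μt⌋} (λ (b₁ + (1-b₁-b₂)/(τ^ρ z)) / (1 - b₂/(τ^ρ z)))^t`. -/
noncomputable def disp (b₁ ρ ε : ℝ) (t : ℕ) (z : ℂ) : ℂ :=
  z ^ ⌊mu b₁ ρ ε * t⌋ *
    ((lam b₁ ρ ε : ℂ) *
      (((b₁ : ℂ) + ((1 - b₁ - b2 b₁ ε : ℝ) : ℂ) / (((tau ε ^ ρ : ℝ) : ℂ) * z)) /
        (1 - (b2 b₁ ε : ℂ) / (((tau ε ^ ρ : ℝ) : ℂ) * z)))) ^ t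

/-- The integrand of the two-point semigroup. The exponents are real numbers which are integers
for the lattice points at which the semigroup is considered. -/
noncomputable def integrand (b₁ ρ ε : ℝ) (y x : ℝ × ℝ) (t : ℕ) (z₁ z₂ : ℂ) : ℂ :=
  let δ : ℝ := mu b₁ ρ ε * t - ⌊mu b₁ ρ ε * t⌋
  (z₁ ^ ((x.1 - y.1 + δ : ℝ) : ℂ) * z₂ ^ ((x.2 - y.2 + δ : ℝ) : ℂ)
      - inter ρ ε z₁ z₂ *
        z₁ ^ ((x.2 - y.1 + δ : ℝ) : ℂ) * z₂ ^ ((x.1 - y.2 + δ : ℝ) : ℂ))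
    * (disp b₁ ρ ε t z₁ / z₁) * (disp b₁ ρ ε t z₂ / z₂)

/-- The two-point semigroup `𝒰_ε((y₁,y₂),(x₁,x₂);t)`, as a double contour integral over circles of
radius `r`. -/
noncomputable def semigroup (b₁ ρ ε r : ℝ) (y x : ℝ × ℝ) (t : ℕ) : ℂ :=
  contour r fun z₁ => contour r fun z₂ => integrand b₁ ρ ε y x t z₁ z₂

/-- The radius `r` is so large that the integrand has no pole with `|z₁|, |z₂| ≥ r`. -/
def EnclosesPoles (b₁ ρ ε r : ℝ) : Prop :=
  0 < r ∧
  (∀ z : ℂ, r ≤ ‖z‖ → 1 - (b2 b₁ ε : ℂ) / (((tau ε ^ ρ : ℝ) : ℂ) * z) ≠ 0) ∧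
  ∀ z₁ z₂ : ℂ, r ≤ ‖z₁‖ → r ≤ ‖z₂‖ → interDenom ρ ε z₁ z₂ ≠ 0

/-- Every large enough radius is admissible. -/
theorem eventually_enclosesPoles (b₁ ρ ε : ℝ) :
    ∀ᶠ r in Filter.atTop, EnclosesPoles b₁ ρ ε r := by
  have hτ : 0 < tau ε := Real.exp_pos _
  set a : ℝ := tau ε ^ (-1 + 2 * ρ) with ha
  set c : ℝ := (1 + (tau ε)⁻¹) * tau ε ^ ρ with hc
  set q : ℝ := tau ε ^ ρ with hq
  have ha0 : 0 < a := Real.rpow_pos_of_pos hτ _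
  have hq0 : 0 < q := Real.rpow_pos_of_pos hτ _
  have hc0 : 0 < c := by positivity
  filter_upwards [Filter.eventually_ge_atTop 1, Filter.eventually_gt_atTop ((1 + c) / a),
    Filter.eventually_gt_atTop (|b2 b₁ ε| / q)] with r h1 h2 h3
  rw [div_lt_iff₀ ha0] at h2
  rw [div_lt_iff₀ hq0] at h3
  refine ⟨by linarith, fun z hz h => ?_, fun z₁ z₂ hz₁ hz₂ h => ?_⟩
  · have hz0 : z ≠ 0 := by
      rintro rfl
      simp at hz
      linarith
    have hqz : (q : ℂ) * z ≠ 0 := mul_ne_zero (by exact_mod_cast hq0.ne') hz0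
    have h' : (b2 b₁ ε : ℂ) = (q : ℂ) * z := by
      rw [sub_eq_zero, eq_comm, div_eq_one_iff_eq hqz] at h
      exact h
    have := congrArg norm h'
    rw [norm_mul, Complex.norm_real, Complex.norm_real, Real.norm_eq_abs, Real.norm_eq_abs,
      abs_of_pos hq0] at this
    nlinarith
  · have h' : (a : ℂ) * z₁ * z₂ = (c : ℂ) * z₁ - 1 := by
      unfold interDenom at h
      linear_combination h
    have hn := congrArg norm h'
    rw [norm_mul, norm_mul, Complex.norm_real, Real.norm_eq_abs, abs_of_pos ha0] at hn
    have hle : ‖(c : ℂ) * z₁ - 1‖ ≤ c * ‖z₁‖ + 1 := by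
      refine (norm_sub_le _ _).trans ?_
      simp [abs_of_pos hc0]
    have h5 : 1 + c < a * ‖z₂‖ := by nlinarith
    have h6 : (1 + c) * ‖z₁‖ < a * ‖z₂‖ * ‖z₁‖ := mul_lt_mul_of_pos_right h5 (by linarith)
    nlinarith

end S6V

/-! ### Contour integrals over circles -/

namespace S6V

open Set Metric Function

/-! Put `u = τ^(-ρ) ≥ 1` and `v = τ^(1-ρ) ≤ 1`. In these variables the semigroup depends only on
integer displacements: it is a product of two one-particle kernels minus a double contour integral
carrying the scattering factor (`semigroup_eq_pairKernel`). The rest is a steepest-descent estimate,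
uniform in the parameters, near `u = v = z = 1`.

One particle: the speed `μ` is minus the logarithmic derivative of the symbol `hop` at `1`, so `r^μ
|hop r|` differs from `1` only to second order in `r - 1` (`rpow_speed_mul_norm_hop_le`). Along
suitable circles through `r` the weight decays exponentially in `1 - cos θ`
(`eventually_norm_hop_le`). With `r = exp(±κ)` and `κ` of order `t^(-1/2)`, the `t`-th power is
Gaussian in the angle rescaled by `√t`. Each contour integral then gives a factor `t^(-1/2)`, each
discrete gradient gives another one through `z - 1`, and the choice of radius gives the exponential
decay in space (`exists_norm_freeKernel_le`).

Two particles: the scattering factor has a pole at `z₂ = poleMap z₁`. It is harmless, polynomial in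
the rescaled angles, while `|z₂|` stays at distance of order `t^(-1/2)` from `|poleMap z₁|`. The
signs of the two displacements prescribe on which side of `1` the radii should lie, and reaching
these radii may cross the pole. In the resulting residue a zero of one symbol cancels a pole of the
other. Since the points are ordered, the exponent of `z` is nonnegative, so the residue is also
regular at `0` and its contour can be moved to a circle with diameter `[±h, r]`, `h` small. In the
limit this is the circle `|2z - 1| = 1`, on which the symbol of the residue decays
(`eventually_norm_hopPair_le`). The factor `(z - u)(z - v)` of the residue supplies the missing
`t^(-1/2)`: `(u - 1)²` and `(1 - v)²` are of order `ε`, which is at most `√T t^(-1/2)` when `t ≤ ε⁻²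
T`. All this is assembled in `exists_norm_scatKernel_le`.

The remaining parameters are softer. At `t = 0` the kernels are explicit. If `ε` is bounded below,
then `t` is bounded in terms of `T` while `v` stays away from `1`, so fixed radii suffice
(`exists_kernelBounds_subcritical`). The regimes are joined in `exists_kernelBounds`. Finally,
exchanging the targets of two ordered particles cannot decrease the total displacement
(`abs_displacement_le`), so the scattering part obeys the same bound as the free part. -/

/-- The pull-back to angles of a function continuous on a product of two circles is continuous. -/
theorem continuous_comp_circleMap₂ {F : ℂ → ℂ → ℂ} {c₁ c₂ : ℂ} {R₁ R₂ : ℝ} (h₁ : 0 ≤ R₁)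
    (h₂ : 0 ≤ R₂) (hF : ContinuousOn (uncurry F) (sphere c₁ R₁ ×ˢ sphere c₂ R₂)) :
    Continuous fun p : ℝ × ℝ => F (circleMap c₁ R₁ p.1) (circleMap c₂ R₂ p.2) := by
  have : Continuous fun p : ℝ × ℝ => (circleMap c₁ R₁ p.1, circleMap c₂ R₂ p.2) := by
    have := continuous_circleMap c₁ R₁
    have := continuous_circleMap c₂ R₂
    fun_prop
  exact hF.comp_continuous this fun p =>
    ⟨circleMap_mem_sphere _ h₁ _, circleMap_mem_sphere _ h₂ _⟩

theorem circleIntegral_swap {F : ℂ → ℂ → ℂ} {c₁ c₂ : ℂ} {R₁ R₂ : ℝ} (h₁ : 0 ≤ R₁)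
    (h₂ : 0 ≤ R₂) (hF : ContinuousOn (uncurry F) (sphere c₁ R₁ ×ˢ sphere c₂ R₂)) :
    (∮ z in C(c₁, R₁), ∮ w in C(c₂, R₂), F z w) = ∮ w in C(c₂, R₂), ∮ z in C(c₁, R₁), F z w := by
  have hc := continuous_comp_circleMap₂ h₁ h₂ hF
  simp only [circleIntegral, deriv_circleMap, smul_eq_mul,
    ← intervalIntegral.integral_const_mul]
  rw [MeasureTheory.intervalIntegral_intervalIntegral_swap]
  · simp only [mul_left_comm]
  · have : Continuous (uncurry fun x y : ℝ => circleMap 0 R₁ x * Complex.I *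
        (circleMap 0 R₂ y * Complex.I * F (circleMap c₁ R₁ x) (circleMap c₂ R₂ y))) := by
      exact (((continuous_circleMap 0 R₁).comp continuous_fst).mul continuous_const).mul
        ((((continuous_circleMap 0 R₂).comp continuous_snd).mul continuous_const).mul hc)
    exact (this.continuousOn.integrableOn_compact
      (isCompact_uIcc.prod isCompact_uIcc)).mono_set
      (prod_mono uIoc_subset_uIcc uIoc_subset_uIcc)

theorem circleIntegrable_circleIntegral {F : ℂ → ℂ → ℂ} {c₁ c₂ : ℂ} {R₁ R₂ : ℝ} (h₁ : 0 ≤ R₁)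
    (h₂ : 0 ≤ R₂) (hF : ContinuousOn (uncurry F) (sphere c₁ R₁ ×ˢ sphere c₂ R₂)) :
    CircleIntegrable (fun z => ∮ w in C(c₂, R₂), F z w) c₁ R₁ := by
  have hc := continuous_comp_circleMap₂ h₁ h₂ hF
  have : Continuous fun x : ℝ => ∮ w in C(c₂, R₂), F (circleMap c₁ R₁ x) w := by
    simp only [circleIntegral, deriv_circleMap, smul_eq_mul]
    refine intervalIntegral.continuous_parametric_intervalIntegral_of_continuous' ?_ _ _
    exact (((continuous_circleMap 0 R₂).comp continuous_snd).mul continuous_const).mul hc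
  exact this.intervalIntegrable _ _

/-- Cauchy's theorem for an annulus, for a function differentiable at every point of it. -/
theorem circleIntegral_eq_of_annulus {f : ℂ → ℂ} {c : ℂ} {r R : ℝ} (hr : 0 < r) (hrR : r ≤ R)
    (hf : ∀ z, r ≤ ‖z - c‖ → ‖z - c‖ ≤ R → DifferentiableAt ℂ f z) :
    (∮ z in C(c, R), f z) = ∮ z in C(c, r), f z := by
  refine Complex.circleIntegral_eq_of_differentiable_on_annulus_off_countable hr hrR
    countable_empty (fun z hz => ?_) fun z hz => ?_
  · simp only [mem_sdiff, mem_closedBall, mem_ball, dist_eq_norm, not_lt] at hz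
    exact (hf z hz.2 hz.1).continuousAt.continuousWithinAt
  · simp only [mem_sdiff, mem_closedBall, mem_ball, dist_eq_norm, not_le] at hz
    exact hf z hz.1.2.le hz.1.1.le

/-- Homotopy by translation. The `s`-derivative of `f (w + s m)` is `m f'(w + s m)`, which has a
primitive in `w` and so integrates to `0` over the circle; Fubini in `(s, θ)` then equates the two
ends. Only the translates of the circle itself need to lie in `U`, not their interiors. -/
theorem circleIntegral_translate {f : ℂ → ℂ} {m : ℂ} {R : ℝ} {U : Set ℂ} (hU : IsOpen U)
    (hR : 0 ≤ R) (hf : DifferentiableOn ℂ f U)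
    (hmem : ∀ s ∈ Icc (0 : ℝ) 1, ∀ w ∈ sphere (0 : ℂ) R, w + s * m ∈ U) :
    (∮ z in C(m, R), f z) = ∮ z in C(0, R), f z := by
  have hd : ∀ z ∈ U, HasDerivAt f (deriv f z) z := fun z hz =>
    (hf.differentiableAt (hU.mem_nhds hz)).hasDerivAt
  have hdc : ContinuousOn (deriv f) U := (hf.deriv hU).continuousOn
  have hmem1 : ∀ s ∈ Icc (0 : ℝ) 1, ∀ θ : ℝ, circleMap 0 R θ + s * m ∈ U := fun s hs θ =>
    hmem s hs _ (circleMap_mem_sphere _ hR _)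
  set G : ℝ → ℝ → ℂ := fun s θ =>
    circleMap 0 R θ * Complex.I * (deriv f (circleMap 0 R θ + s * m) * m) with hG
  have hGc : ContinuousOn (uncurry G) (Icc 0 1 ×ˢ univ) := by
    have h1 : ContinuousOn (fun p : ℝ × ℝ => deriv f (circleMap 0 R p.2 + p.1 * m))
        (Icc 0 1 ×ˢ univ) := by
      refine hdc.comp ?_ fun p hp => hmem1 _ hp.1 _
      have := continuous_circleMap 0 R
      fun_prop
    have := continuous_circleMap 0 R
    simp only [hG, uncurry_def]
    fun_prop
  have hslice : ∀ s ∈ Icc (0 : ℝ) 1, ∫ θ in (0 : ℝ)..2 * Real.pi, G s θ = 0 := by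
    intro s hs
    have h0 : (∮ w in C(0, R), deriv f (w + s * m) * m) = 0 := by
      refine circleIntegral.integral_eq_zero_of_hasDerivWithinAt
        (f := fun w => f (w + s * m) * m) hR fun w hw => ?_
      exact (((hd _ (hmem s hs w hw)).comp_add_const w (s * m)).mul_const m).hasDerivWithinAt
    simpa only [circleIntegral, deriv_circleMap, smul_eq_mul] using h0
  have hline : ∀ θ : ℝ, ∫ s in (0 : ℝ)..1, G s θ =
      circleMap 0 R θ * Complex.I * (f (circleMap m R θ) - f (circleMap 0 R θ)) := by
    intro θ
    simp only [hG, intervalIntegral.integral_const_mul]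
    congr 1
    have : ∀ s ∈ uIcc (0 : ℝ) 1, HasDerivAt (fun s : ℝ => f (circleMap 0 R θ + s * m))
        (deriv f (circleMap 0 R θ + s * m) * m) s := by
      intro s hs
      rw [uIcc_of_le zero_le_one] at hs
      have h1 : HasDerivAt (fun s : ℝ => circleMap 0 R θ + (s : ℂ) * m) m s := by
        simpa using ((Complex.ofRealCLM.hasDerivAt (x := s)).mul_const m).const_add
          (circleMap 0 R θ)
      exact (hd _ (hmem1 s hs θ)).comp s h1
    rw [intervalIntegral.integral_eq_sub_of_hasDerivAt this]
    · simp [circleMap, add_comm]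
    · refine ContinuousOn.intervalIntegrable_of_Icc zero_le_one ?_
      refine ContinuousOn.mul (hdc.comp (by fun_prop) fun s hs => hmem1 s hs θ) continuousOn_const
  have hswap : ∫ s in (0 : ℝ)..1, ∫ θ in (0 : ℝ)..2 * Real.pi, G s θ =
      ∫ θ in (0 : ℝ)..2 * Real.pi, ∫ s in (0 : ℝ)..1, G s θ := by
    refine MeasureTheory.intervalIntegral_intervalIntegral_swap ?_
    refine ((hGc.mono (prod_mono_right (subset_univ (uIcc 0 (2 * Real.pi))))).integrableOn_compact
      (isCompact_Icc.prod isCompact_uIcc)).mono_set ?_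
    refine prod_mono ?_ uIoc_subset_uIcc
    rw [uIoc_of_le zero_le_one]
    exact Ioc_subset_Icc_self
  have hz : ∫ s in (0 : ℝ)..1, ∫ θ in (0 : ℝ)..2 * Real.pi, G s θ = 0 := by
    rw [intervalIntegral.integral_congr (g := fun _ => 0)]
    · simp
    · intro s hs
      rw [uIcc_of_le zero_le_one] at hs
      exact hslice s hs
  rw [hz] at hswap
  simp only [hline, mul_sub] at hswap
  have hc : ∀ c : ℂ, (c = m ∨ c = 0) → Continuous fun θ : ℝ => f (circleMap c R θ) := by
    intro c hc
    refine hf.continuousOn.comp_continuous (continuous_circleMap _ _) fun θ => ?_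
    rcases hc with rfl | rfl
    · simpa [circleMap, add_comm] using hmem1 1 (by simp) θ
    · simpa using hmem1 0 (by simp) θ
  have hi : ∀ c : ℂ, (c = m ∨ c = 0) → IntervalIntegrable
      (fun θ : ℝ => circleMap 0 R θ * Complex.I * f (circleMap c R θ)) MeasureTheory.volume
      0 (2 * Real.pi) := fun c h =>
    (((continuous_circleMap 0 R).mul continuous_const).mul (hc c h)).intervalIntegrable _ _
  rw [intervalIntegral.integral_sub (hi m (Or.inl rfl)) (hi 0 (Or.inr rfl))] at hswap
  simp only [circleIntegral, deriv_circleMap, smul_eq_mul]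
  exact (sub_eq_zero.mp hswap.symm)

/-- Contour deformation from a large circle centred at the origin to a circle inside it, not
necessarily concentric. -/
theorem circleIntegral_eq_of_differentiable_outside {f : ℂ → ℂ} {m : ℂ} {ρ R : ℝ} (hρ : 0 < ρ)
    (hR : ρ + ‖m‖ ≤ R) (hf : ∀ z, ρ ≤ ‖z - m‖ → DifferentiableAt ℂ f z) :
    (∮ z in C(0, R), f z) = ∮ z in C(m, ρ), f z := by
  have hm := norm_nonneg m
  -- Enlarging the radius by one makes the inequality strict, as the translation argument needs all
  -- intermediate circles inside an open set.
  rw [← circleIntegral_eq_of_annulus (R := R + 1) (by linarith) (by linarith) fun z h _ =>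
    hf z (by have := norm_sub_norm_le z m; rw [sub_zero] at h; linarith)]
  replace hR : ρ + ‖m‖ < R + 1 := by linarith
  generalize R + 1 = R at hR
  rw [← circleIntegral_eq_of_annulus (c := m) (R := R) hρ (by linarith) fun z h _ => hf z h]
  refine (circleIntegral_translate (U := {z | ρ < ‖z - m‖})
    (isOpen_lt continuous_const (by fun_prop)) (by linarith)
    (fun z hz => (hf z (le_of_lt hz)).differentiableWithinAt) fun s hs w hw => ?_).symm
  simp only [mem_sphere_iff_norm, sub_zero] at hw
  have h1 : w + s * m - m = w - ((1 - s : ℝ) : ℂ) * m := by push_cast; ring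
  have h2 : ‖((1 - s : ℝ) : ℂ) * m‖ ≤ ‖m‖ := by
    rw [norm_mul, Complex.norm_real, Real.norm_eq_abs, abs_of_nonneg (by linarith [hs.2])]
    nlinarith [hs.1]
  have h3 := norm_sub_norm_le w (((1 - s : ℝ) : ℂ) * m)
  simp only [mem_ofPred_eq, h1]
  linarith

/-- Residue theorem on an annulus for a function with one simple pole, lying in the annulus. -/
theorem circleIntegral_simple_pole {G : ℂ → ℂ} {p : ℂ} {r R : ℝ} (hr : 0 < r) (hp : r < ‖p‖)
    (hpR : ‖p‖ < R) (hG : ∀ z, r ≤ ‖z‖ → DifferentiableAt ℂ G z) :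
    (∮ z in C(0, R), G z / (z - p)) =
      (∮ z in C(0, r), G z / (z - p)) + 2 * Real.pi * Complex.I * G p := by
  -- Split `G z / (z - p)` as `dslope G p z + G p / (z - p)`: the first term is holomorphic on the
  -- whole annulus, `p` included, and the second has known integrals.
  have hd : ∀ z, r ≤ ‖z‖ → DifferentiableAt ℂ (dslope G p) z := by
    intro z hz
    rcases eq_or_ne z p with rfl | hne
    · have hU : {w : ℂ | r < ‖w‖} ∈ nhds z :=
        (isOpen_lt continuous_const continuous_norm).mem_nhds hp
      exact ((Complex.differentiableOn_dslope hU).2 fun w hw =>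
        (hG w (le_of_lt hw)).differentiableWithinAt).differentiableAt hU
    · exact (differentiableAt_dslope_of_ne hne).2 (hG z hz)
  have hann : (∮ z in C(0, R), dslope G p z) = ∮ z in C(0, r), dslope G p z :=
    circleIntegral_eq_of_annulus hr (by linarith) fun z h _ => hd z (by simpa using h)
  have split : ∀ ρ, r ≤ ρ → ‖p‖ ≠ ρ → (∮ z in C(0, ρ), G z / (z - p)) =
      (∮ z in C(0, ρ), dslope G p z) + G p * ∮ z in C(0, ρ), (z - p)⁻¹ := by
    intro ρ hρ hne
    have hnep : ∀ z ∈ sphere (0 : ℂ) ρ, z ≠ p := by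
      rintro z hz rfl
      exact hne (by simpa using hz)
    rw [← circleIntegral.integral_const_mul, ← circleIntegral.integral_add]
    · refine circleIntegral.integral_congr (by linarith) fun z hz => ?_
      have : z - p ≠ 0 := sub_ne_zero.2 (hnep z hz)
      simp only [dslope_of_ne _ (hnep z hz), slope_def_field]
      field_simp
      ring
    · refine ContinuousOn.circleIntegrable (by linarith) fun z hz => ?_
      have : ‖z‖ = ρ := by simpa using hz
      exact (hd z (by linarith)).continuousAt.continuousWithinAt
    · refine ContinuousOn.circleIntegrable (by linarith) ?_
      exact continuousOn_const.mul ((continuousOn_id.sub continuousOn_const).inv₀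
        fun z hz => sub_ne_zero.2 (hnep z hz))
  have hin : (∮ z in C(0, R), (z - p)⁻¹) = 2 * Real.pi * Complex.I :=
    circleIntegral.integral_sub_inv_of_mem_ball (by simpa using hpR)
  have hout : (∮ z in C(0, r), (z - p)⁻¹) = 0 := by
    refine Complex.circleIntegral_eq_zero_of_differentiable_on_off_countable hr.le
      countable_empty ?_ ?_
    · refine (continuousOn_id.sub continuousOn_const).inv₀ fun z hz => sub_ne_zero.2 ?_
      rintro (rfl : z = p)
      simp only [mem_closedBall, dist_zero_right] at hz
      linarith
    · rintro z ⟨hz, -⟩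
      refine (differentiableAt_id.sub_const p).inv (sub_ne_zero.2 ?_)
      rintro (rfl : z = p)
      simp only [mem_ball, dist_zero_right] at hz
      linarith
  rw [split R (by linarith) hpR.ne, split r le_rfl hp.ne', hann, hin, hout]
  ring

theorem norm_circleIntegral_le_integral {f : ℂ → ℂ} {c : ℂ} {R : ℝ} (hR : 0 ≤ R) {g : ℝ → ℝ}
    (hg : Continuous g) (h : ∀ θ, ‖f (circleMap c R θ)‖ ≤ g θ) :
    ‖∮ z in C(c, R), f z‖ ≤ R * ∫ θ in (0 : ℝ)..2 * Real.pi, g θ := by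
  rw [circleIntegral, ← intervalIntegral.integral_const_mul]
  refine intervalIntegral.norm_integral_le_of_norm_le (by positivity)
    (MeasureTheory.ae_of_all _ fun θ _ => ?_) (Continuous.intervalIntegrable (by fun_prop) _ _)
  rw [norm_smul, deriv_circleMap, norm_mul, Complex.norm_I, mul_one, norm_circleMap_zero,
    abs_of_nonneg hR]
  exact mul_le_mul_of_nonneg_left (h θ) hR

end S6V

/-! ### The two-particle kernel in the variables `u = τ^(-ρ)`, `v = τ^(1-ρ)` -/

namespace S6V

open Set Metric Function

/-- The velocity `μ` in the variables `u = τ^(-ρ)`, `v = τ^(1-ρ)`. -/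
noncomputable def speed (b u v : ℝ) : ℝ :=
  (1 - b) * (u - b * v) / ((b + (u - b * u - b * v)) * (1 - b * v))

/-- The normalisation `λ` in the variables `u = τ^(-ρ)`, `v = τ^(1-ρ)`. -/
noncomputable def hopCoef (b u v : ℝ) : ℝ := (1 - b * v) / (b + (u - b * u - b * v))

/-- The one-step symbol, normalised to be `1` at `z = 1`. -/
noncomputable def hop (b u v : ℝ) (z : ℂ) : ℂ :=
  (hopCoef b u v : ℂ) * ((b * z + (u - b * u - b * v : ℝ)) / (z - (b * v : ℝ)))

/-- The position in `z₂` of the pole of the scattering factor, as a function of `z₁`. -/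
noncomputable def poleMap (u v : ℝ) (z : ℂ) : ℂ := u + v - u * v / z

/-- The denominator of the scattering factor. -/
noncomputable def scatDenom (u v : ℝ) (z₁ z₂ : ℂ) : ℂ := u * v + z₁ * z₂ - (u + v) * z₁

/-- The scattering factor. -/
noncomputable def scat (u v : ℝ) (z₁ z₂ : ℂ) : ℂ := scatDenom u v z₂ z₁ / scatDenom u v z₁ z₂

/-- The one-particle integrand at displacement `n` and time `t`, after `j` discrete derivatives. -/
noncomputable def wave (b u v : ℝ) (n : ℤ) (j t : ℕ) (z : ℂ) : ℂ :=
  z ^ (n - 1) * (z - 1) ^ j * hop b u v z ^ t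

/-- The one-particle kernel. -/
noncomputable def freeKernel (b u v r : ℝ) (n : ℤ) (j t : ℕ) : ℂ := contour r (wave b u v n j t)

/-- The part of the two-particle kernel that carries the scattering factor. -/
noncomputable def scatKernel (b u v r : ℝ) (n₁ n₂ : ℤ) (j₁ j₂ t : ℕ) : ℂ :=
  contour r fun z₁ => contour r fun z₂ =>
    scat u v z₁ z₂ * wave b u v n₁ j₁ t z₁ * wave b u v n₂ j₂ t z₂

/-- `EnclosesPoles` in the variables `u = τ^(-ρ)`, `v = τ^(1-ρ)`. -/
def Encloses (b u v r : ℝ) : Prop :=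
  0 < r ∧ (∀ z : ℂ, r ≤ ‖z‖ → z ≠ (b * v : ℝ)) ∧
    ∀ z₁ z₂ : ℂ, r ≤ ‖z₁‖ → r ≤ ‖z₂‖ → scatDenom u v z₁ z₂ ≠ 0

theorem differentiableAt_hop {b u v : ℝ} {z : ℂ} (hz : z ≠ (b * v : ℝ)) :
    DifferentiableAt ℂ (hop b u v) z := by
  have := sub_ne_zero.2 hz
  unfold hop
  fun_prop (disch := assumption)

theorem differentiableAt_wave {b u v : ℝ} {z : ℂ} {n : ℤ} {j t : ℕ} (hz0 : z ≠ 0)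
    (hz : z ≠ (b * v : ℝ)) : DifferentiableAt ℂ (wave b u v n j t) z := by
  have h1 := differentiableAt_hop (u := u) hz
  have h2 : DifferentiableAt ℂ (fun z : ℂ => z ^ (n - 1)) z :=
    differentiableAt_zpow.2 (Or.inl hz0)
  unfold wave
  fun_prop

/-! ### Admissible circles, and discrete gradients as factors `z - 1`. -/

section Circle

variable {b u v r : ℝ}

theorem Encloses.ne_zero (h : Encloses b u v r) {z : ℂ} (hz : r ≤ ‖z‖) : z ≠ 0 := by
  rintro rfl
  rw [norm_zero] at hz
  linarith [h.1]

theorem Encloses.differentiableAt_wave (h : Encloses b u v r) {z : ℂ} (hz : r ≤ ‖z‖) (n : ℤ)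
    (j t : ℕ) : DifferentiableAt ℂ (wave b u v n j t) z :=
  S6V.differentiableAt_wave (h.ne_zero hz) (h.2.1 z hz)

theorem Encloses.continuousOn_wave (h : Encloses b u v r) (n : ℤ) (j t : ℕ) :
    ContinuousOn (wave b u v n j t) (sphere 0 r) := fun z hz =>
  (h.differentiableAt_wave (by simp_all) n j t).continuousAt.continuousWithinAt

theorem continuous_scatDenom (u v : ℝ) : Continuous fun p : ℂ × ℂ => scatDenom u v p.1 p.2 := by
  unfold scatDenom
  fun_prop

theorem continuousOn_scat_mul {f g : ℂ → ℂ} {s₁ s₂ : Set ℂ} (hf : ContinuousOn f s₁)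
    (hg : ContinuousOn g s₂) (h : ∀ z₁ ∈ s₁, ∀ z₂ ∈ s₂, scatDenom u v z₁ z₂ ≠ 0) :
    ContinuousOn (uncurry fun z₁ z₂ => scat u v z₁ z₂ * f z₁ * g z₂) (s₁ ×ˢ s₂) := by
  have h1 := (continuous_scatDenom u v).continuousOn (s := s₁ ×ˢ s₂)
  have h2 := ((continuous_scatDenom u v).comp continuous_swap).continuousOn (s := s₁ ×ˢ s₂)
  have hf' : ContinuousOn (fun p : ℂ × ℂ => f p.1) (s₁ ×ˢ s₂) :=
    hf.comp continuousOn_fst fun p hp => hp.1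
  have hg' : ContinuousOn (fun p : ℂ × ℂ => g p.2) (s₁ ×ˢ s₂) :=
    hg.comp continuousOn_snd fun p hp => hp.2
  exact ((h2.div h1 fun p hp => h _ hp.1 _ hp.2).mul hf').mul hg'

theorem Encloses.continuousOn_scat_wave (h : Encloses b u v r) (n₁ n₂ : ℤ) (j₁ j₂ t : ℕ) :
    ContinuousOn (uncurry fun z₁ z₂ =>
      scat u v z₁ z₂ * wave b u v n₁ j₁ t z₁ * wave b u v n₂ j₂ t z₂)
      (sphere 0 r ×ˢ sphere 0 r) :=
  continuousOn_scat_mul (h.continuousOn_wave _ _ _) (h.continuousOn_wave _ _ _)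
    fun z₁ h₁ z₂ h₂ => h.2.2 z₁ z₂ (by simp_all) (by simp_all)

theorem freeKernel_succ_sub (h : Encloses b u v r) (n : ℤ) (t : ℕ) :
    freeKernel b u v r (n + 1) 0 t - freeKernel b u v r n 0 t = freeKernel b u v r n 1 t := by
  unfold freeKernel contour
  rw [← mul_sub, ← circleIntegral.integral_sub
    ((h.continuousOn_wave _ _ _).circleIntegrable h.1.le)
    ((h.continuousOn_wave _ _ _).circleIntegrable h.1.le)]
  congr 1
  refine circleIntegral.integral_congr h.1.le fun z hz => ?_
  have hz0 : z ≠ 0 := h.ne_zero (by simp_all)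
  simp only [wave]
  rw [show n + 1 - 1 = n - 1 + 1 by ring, zpow_add_one₀ hz0]
  ring

/-- Continuity on the torus allows subtraction under both integral signs, so an algebraic identity
between the integrands is enough. It serves the gradients in both variables. -/
theorem scatKernel_sub_of {n₁ n₂ n₁' n₂' n₁'' n₂'' : ℤ} {j₁ j₂ t : ℕ} (h : Encloses b u v r)
    (heq : ∀ z₁ z₂ : ℂ, z₁ ≠ 0 → z₂ ≠ 0 →
      wave b u v n₁ 0 t z₁ * wave b u v n₂ 0 t z₂ - wave b u v n₁' 0 t z₁ * wave b u v n₂' 0 t z₂ =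
        wave b u v n₁'' j₁ t z₁ * wave b u v n₂'' j₂ t z₂) :
    scatKernel b u v r n₁ n₂ 0 0 t - scatKernel b u v r n₁' n₂' 0 0 t =
      scatKernel b u v r n₁'' n₂'' j₁ j₂ t := by
  have hc := fun m₁ m₂ : ℤ => h.continuousOn_scat_wave m₁ m₂ 0 0 t
  unfold scatKernel contour
  simp only [circleIntegral.integral_const_mul]
  rw [← mul_sub, ← mul_sub, ← circleIntegral.integral_sub
    (circleIntegrable_circleIntegral h.1.le h.1.le (hc _ _))
    (circleIntegrable_circleIntegral h.1.le h.1.le (hc _ _))]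
  congr 2
  refine circleIntegral.integral_congr h.1.le fun z₁ hz₁ => ?_
  have hs : ∀ m₁ m₂ : ℤ, CircleIntegrable (fun z₂ =>
      scat u v z₁ z₂ * wave b u v m₁ 0 t z₁ * wave b u v m₂ 0 t z₂) 0 r := fun m₁ m₂ =>
    ContinuousOn.circleIntegrable h.1.le
      ((hc m₁ m₂).comp (f := fun z₂ => (z₁, z₂)) (by fun_prop) fun z₂ hz₂ => ⟨hz₁, hz₂⟩)
  rw [← circleIntegral.integral_sub (hs _ _) (hs _ _)]
  refine circleIntegral.integral_congr h.1.le fun z₂ hz₂ => ?_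
  have := heq z₁ z₂ (h.ne_zero (by simp_all)) (h.ne_zero (by simp_all))
  simp only [mul_assoc, ← mul_sub, this]

theorem scatKernel_succ_left_sub (h : Encloses b u v r) (n₁ n₂ : ℤ) (t : ℕ) :
    scatKernel b u v r (n₁ + 1) n₂ 0 0 t - scatKernel b u v r n₁ n₂ 0 0 t =
      scatKernel b u v r n₁ n₂ 1 0 t := by
  refine scatKernel_sub_of h fun z₁ z₂ h₁ _ => ?_
  simp only [wave]
  rw [show n₁ + 1 - 1 = n₁ - 1 + 1 by ring, zpow_add_one₀ h₁]
  ring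

theorem scatKernel_succ_right_sub (h : Encloses b u v r) (n₁ n₂ : ℤ) (t : ℕ) :
    scatKernel b u v r n₁ (n₂ + 1) 0 0 t - scatKernel b u v r n₁ n₂ 0 0 t =
      scatKernel b u v r n₁ n₂ 0 1 t := by
  refine scatKernel_sub_of h fun z₁ z₂ _ h₂ => ?_
  simp only [wave]
  rw [show n₂ + 1 - 1 = n₂ - 1 + 1 by ring, zpow_add_one₀ h₂]
  ring

/-- The two-particle kernel on integer displacements. -/
noncomputable def pairKernel (b u v r : ℝ) (Y₁ Y₂ X₁ X₂ : ℤ) (t : ℕ) : ℂ :=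
  freeKernel b u v r (X₁ - Y₁) 0 t * freeKernel b u v r (X₂ - Y₂) 0 t -
    scatKernel b u v r (X₂ - Y₁) (X₁ - Y₂) 0 0 t

end Circle

/-! ### From the parameters of the model to `u`, `v` and integer displacements. -/

section Translation

variable {b₁ ρ ε : ℝ}

theorem tau_pos (ε : ℝ) : 0 < tau ε := Real.exp_pos _

theorem tau_rpow_one_sub (ρ ε : ℝ) : tau ε ^ (1 - ρ) = tau ε * tau ε ^ (-ρ) := by
  rw [sub_eq_add_neg, Real.rpow_add (tau_pos ε), Real.rpow_one]

theorem scatDenom_eq (ρ ε : ℝ) (z₁ z₂ : ℂ) :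
    scatDenom (tau ε ^ (-ρ)) (tau ε ^ (1 - ρ)) z₁ z₂ =
      ((tau ε ^ (-ρ) * tau ε ^ (1 - ρ) : ℝ) : ℂ) * interDenom ρ ε z₁ z₂ := by
  have hτ := tau_pos ε
  have h1 : tau ε ^ (-ρ) * tau ε ^ (1 - ρ) * tau ε ^ (-1 + 2 * ρ) = 1 := by
    rw [← Real.rpow_add hτ, ← Real.rpow_add hτ]
    simp [show -ρ + (1 - ρ) + (-1 + 2 * ρ) = 0 by ring]
  have h2 : tau ε ^ (-ρ) * tau ε ^ ρ = 1 := by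
    rw [← Real.rpow_add hτ]; simp
  have h3 : tau ε ^ (-ρ) * tau ε ^ (1 - ρ) * ((1 + (tau ε)⁻¹) * tau ε ^ ρ) =
      tau ε ^ (-ρ) + tau ε ^ (1 - ρ) := by
    rw [tau_rpow_one_sub]
    field_simp
    linear_combination (tau ε + 1) * h2
  have h1' := congrArg (fun x : ℝ => (x : ℂ)) h1
  have h3' := congrArg (fun x : ℝ => (x : ℂ)) h3
  simp only [Complex.ofReal_mul, Complex.ofReal_one, Complex.ofReal_add] at h1' h3'
  unfold scatDenom interDenom
  push_cast at *
  linear_combination (-z₁ * z₂) * h1' + z₁ * h3'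

theorem scat_eq (ρ ε : ℝ) (z₁ z₂ : ℂ) :
    inter ρ ε z₁ z₂ = scat (tau ε ^ (-ρ)) (tau ε ^ (1 - ρ)) z₁ z₂ := by
  have hτ := tau_pos ε
  have : ((tau ε ^ (-ρ) * tau ε ^ (1 - ρ) : ℝ) : ℂ) ≠ 0 := by
    exact_mod_cast (mul_pos (Real.rpow_pos_of_pos hτ _) (Real.rpow_pos_of_pos hτ _)).ne'
  rw [scat, scatDenom_eq, scatDenom_eq, mul_div_mul_left _ _ this, inter]

theorem lam_eq (b₁ ρ ε : ℝ) :
    lam b₁ ρ ε = hopCoef b₁ (tau ε ^ (-ρ)) (tau ε ^ (1 - ρ)) := by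
  unfold lam hopCoef b2
  rw [tau_rpow_one_sub]
  congr 1 <;> ring

theorem mu_eq (b₁ ρ ε : ℝ) : mu b₁ ρ ε = speed b₁ (tau ε ^ (-ρ)) (tau ε ^ (1 - ρ)) := by
  unfold mu speed b2
  rw [tau_rpow_one_sub]
  congr 1 <;> ring

theorem tau_rpow_neg_mul (ρ ε : ℝ) : tau ε ^ (-ρ) * tau ε ^ ρ = 1 := by
  rw [← Real.rpow_add (tau_pos ε)]; simp

theorem disp_eq (b₁ ρ ε : ℝ) (t : ℕ) {z : ℂ} (hz : z ≠ 0) :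
    disp b₁ ρ ε t z = z ^ ⌊mu b₁ ρ ε * t⌋ *
      hop b₁ (tau ε ^ (-ρ)) (tau ε ^ (1 - ρ)) z ^ t := by
  have h2 : ((tau ε ^ (-ρ) : ℝ) : ℂ) * ((tau ε ^ ρ : ℝ) : ℂ) = 1 := by
    exact_mod_cast tau_rpow_neg_mul ρ ε
  have hq : ((tau ε ^ ρ : ℝ) : ℂ) ≠ 0 := by
    exact_mod_cast (Real.rpow_pos_of_pos (tau_pos ε) ρ).ne'
  have hdiv : ∀ a : ℂ, a / (((tau ε ^ ρ : ℝ) : ℂ) * z) = a * ((tau ε ^ (-ρ) : ℝ) : ℂ) / z := by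
    intro a
    rw [div_eq_div_iff (mul_ne_zero hq hz) hz]
    linear_combination (-a * z) * h2
  unfold disp hop
  rw [lam_eq, hdiv, hdiv, tau_rpow_one_sub]
  congr 3
  unfold b2
  rw [← mul_div_mul_right _ _ hz]
  congr 1
  · rw [add_mul, div_mul_cancel₀ _ hz]
    push_cast
    ring
  · rw [sub_mul, div_mul_cancel₀ _ hz]
    push_cast
    ring

theorem EnclosesPoles.encloses {r : ℝ} (h : EnclosesPoles b₁ ρ ε r) :
    Encloses b₁ (tau ε ^ (-ρ)) (tau ε ^ (1 - ρ)) r := by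
  refine ⟨h.1, fun z hz heq => h.2.1 z hz ?_, fun z₁ z₂ h₁ h₂ => ?_⟩
  · have hz0 : z ≠ 0 := by
      rintro rfl
      rw [norm_zero] at hz
      linarith [h.1]
    have hq : ((tau ε ^ ρ : ℝ) : ℂ) ≠ 0 := by
      exact_mod_cast (Real.rpow_pos_of_pos (tau_pos ε) ρ).ne'
    have h2 : ((tau ε ^ (-ρ) : ℝ) : ℂ) * ((tau ε ^ ρ : ℝ) : ℂ) = 1 := by
      exact_mod_cast tau_rpow_neg_mul ρ ε
    rw [sub_eq_zero, eq_comm, div_eq_one_iff_eq (mul_ne_zero hq hz0), heq, tau_rpow_one_sub, b2]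
    push_cast
    linear_combination (-(b₁ : ℂ) * tau ε) * h2
  · rw [scatDenom_eq]
    refine mul_ne_zero ?_ (h.2.2 z₁ z₂ h₁ h₂)
    have hτ := tau_pos ε
    exact_mod_cast (mul_pos (Real.rpow_pos_of_pos hτ _) (Real.rpow_pos_of_pos hτ _)).ne'

/-- The lattice shift `μ t` in `x - y`, the fractional part of `μ t` and the power `z^⌊μt⌋` in
`disp` cancel exactly, leaving the integer exponents `X - Y`. The first term of the integrand then
separates into a product. -/
theorem semigroup_eq_pairKernel {r : ℝ} (h : EnclosesPoles b₁ ρ ε r) {x₁ x₂ y₁ y₂ : ℝ}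
    {X₁ X₂ Y₁ Y₂ : ℤ} (s t : ℕ) (hx₁ : x₁ = X₁ - ((t : ℝ) + s) * mu b₁ ρ ε)
    (hx₂ : x₂ = X₂ - ((t : ℝ) + s) * mu b₁ ρ ε) (hy₁ : y₁ = Y₁ - s * mu b₁ ρ ε)
    (hy₂ : y₂ = Y₂ - s * mu b₁ ρ ε) :
    semigroup b₁ ρ ε r (y₁, y₂) (x₁, x₂) t =
      pairKernel b₁ (tau ε ^ (-ρ)) (tau ε ^ (1 - ρ)) r Y₁ Y₂ X₁ X₂ t := by
  have hE := h.encloses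
  set u := tau ε ^ (-ρ)
  set v := tau ε ^ (1 - ρ)
  have hr := hE.1.le
  have hpow : ∀ (X Y : ℤ) (x y : ℝ), x = X - ((t : ℝ) + s) * mu b₁ ρ ε →
      y = Y - s * mu b₁ ρ ε → ∀ z : ℂ, z ≠ 0 →
      z ^ ((x - y + (mu b₁ ρ ε * t - ⌊mu b₁ ρ ε * t⌋) : ℝ) : ℂ) * (disp b₁ ρ ε t z / z) =
        wave b₁ u v (X - Y) 0 t z := by
    intro X Y x y hx hy z hz
    have : x - y + (mu b₁ ρ ε * t - ⌊mu b₁ ρ ε * t⌋) = ((X - Y - ⌊mu b₁ ρ ε * t⌋ : ℤ) : ℝ) := by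
      rw [hx, hy]; push_cast; ring
    rw [this, disp_eq _ _ _ _ hz, Complex.ofReal_intCast, Complex.cpow_intCast]
    simp only [wave, pow_zero, mul_one]
    rw [zpow_sub₀ hz (X - Y) ⌊mu b₁ ρ ε * t⌋, zpow_sub_one₀ hz (X - Y)]
    have := zpow_ne_zero ⌊mu b₁ ρ ε * t⌋ hz
    field_simp
    rfl
  have key : ∀ z₁ z₂ : ℂ, z₁ ≠ 0 → z₂ ≠ 0 →
      integrand b₁ ρ ε (y₁, y₂) (x₁, x₂) t z₁ z₂ =
        wave b₁ u v (X₁ - Y₁) 0 t z₁ * wave b₁ u v (X₂ - Y₂) 0 t z₂ -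
          scat u v z₁ z₂ * wave b₁ u v (X₂ - Y₁) 0 t z₁ * wave b₁ u v (X₁ - Y₂) 0 t z₂ := by
    intro z₁ z₂ h₁ h₂
    rw [← hpow X₁ Y₁ x₁ y₁ hx₁ hy₁ z₁ h₁, ← hpow X₂ Y₂ x₂ y₂ hx₂ hy₂ z₂ h₂,
      ← hpow X₂ Y₁ x₂ y₁ hx₂ hy₁ z₁ h₁, ← hpow X₁ Y₂ x₁ y₂ hx₁ hy₂ z₂ h₂]
    simp only [integrand, scat_eq]
    ring
  have hc := hE.continuousOn_scat_wave (X₂ - Y₁) (X₁ - Y₂) 0 0 t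
  have hw := fun n : ℤ => hE.continuousOn_wave n 0 t
  unfold semigroup pairKernel freeKernel scatKernel contour
  simp only [circleIntegral.integral_const_mul]
  have inner : ∀ z₁ ∈ sphere (0 : ℂ) r, (∮ z₂ in C(0, r),
      integrand b₁ ρ ε (y₁, y₂) (x₁, x₂) t z₁ z₂) =
      wave b₁ u v (X₁ - Y₁) 0 t z₁ * (∮ z₂ in C(0, r), wave b₁ u v (X₂ - Y₂) 0 t z₂) -
        ∮ z₂ in C(0, r), scat u v z₁ z₂ * wave b₁ u v (X₂ - Y₁) 0 t z₁ *
          wave b₁ u v (X₁ - Y₂) 0 t z₂ := by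
    intro z₁ hz₁
    rw [← circleIntegral.integral_const_mul, ← circleIntegral.integral_sub]
    · exact circleIntegral.integral_congr hr fun z₂ hz₂ =>
        key z₁ z₂ (hE.ne_zero (by simp_all)) (hE.ne_zero (by simp_all))
    · exact (continuousOn_const.mul (hw _)).circleIntegrable hr
    · exact (hc.comp (f := fun z₂ => (z₁, z₂)) (by fun_prop)
        fun z₂ hz₂ => ⟨hz₁, hz₂⟩).circleIntegrable hr
  have hi : CircleIntegrable (fun z => wave b₁ u v (X₁ - Y₁) 0 t z *
      ∮ z₂ in C(0, r), wave b₁ u v (X₂ - Y₂) 0 t z₂) 0 r :=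
    ((hw _).mul continuousOn_const).circleIntegrable hr
  rw [circleIntegral.integral_congr hr inner, circleIntegral.integral_sub hi
    (circleIntegrable_circleIntegral hr hr hc)]
  have hmul : ∀ (f : ℂ → ℂ) (a : ℂ), (∮ z in C(0, r), f z * a) = (∮ z in C(0, r), f z) * a := by
    intro f a
    simp only [mul_comm _ a, circleIntegral.integral_const_mul]
  rw [hmul]
  ring

end Translation

end S6V

/-! ### Contour deformation and the residue of the scattering factor -/

namespace S6V

open Set Metric Function

variable {b u v : ℝ}

theorem scatDenom_eq_mul (u v : ℝ) {z₁ : ℂ} (h : z₁ ≠ 0) (z₂ : ℂ) :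
    scatDenom u v z₁ z₂ = z₁ * (z₂ - poleMap u v z₁) := by
  unfold scatDenom poleMap
  field_simp
  ring

theorem scatDenom_ne_zero_of_norm_ne {z₁ z₂ : ℂ} (h : z₁ ≠ 0)
    (hne : ‖z₂‖ ≠ ‖poleMap u v z₁‖) : scatDenom u v z₁ z₂ ≠ 0 := by
  rw [scatDenom_eq_mul u v h]
  refine mul_ne_zero h (sub_ne_zero.2 ?_)
  rintro rfl
  exact hne rfl

theorem norm_poleMap_le (hu : 0 ≤ u) (hv : 0 ≤ v) (z : ℂ) :
    ‖poleMap u v z‖ ≤ u + v + u * v / ‖z‖ := by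
  unfold poleMap
  refine (norm_sub_le _ _).trans (add_le_add ((norm_add_le _ _).trans ?_) ?_)
  · simp [abs_of_nonneg hu, abs_of_nonneg hv]
  · simp [abs_of_nonneg hu, abs_of_nonneg hv]

theorem differentiableAt_scat_left {z₁ z₂ : ℂ} (h : scatDenom u v z₁ z₂ ≠ 0) :
    DifferentiableAt ℂ (fun z => scat u v z z₂) z₁ := by
  unfold scat
  refine DifferentiableAt.div ?_ ?_ h <;>
  · unfold scatDenom; fun_prop

theorem differentiableAt_scat_right {z₁ z₂ : ℂ} (h : scatDenom u v z₁ z₂ ≠ 0) :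
    DifferentiableAt ℂ (fun z => scat u v z₁ z) z₂ := by
  unfold scat
  refine DifferentiableAt.div ?_ ?_ h <;>
  · unfold scatDenom; fun_prop

/-- Deforming the two contours of an integral against the scattering factor, no pole being
crossed: the second circle is enlarged first, and the first one is then shrunk. -/
theorem scat_integral_deform {f g : ℂ → ℂ} {r ρ R : ℝ} {m : ℂ} (hr : 0 < r) (hρ : 0 < ρ)
    (hrR : r ≤ R) (henc : ∀ z₁ z₂ : ℂ, r ≤ ‖z₁‖ → r ≤ ‖z₂‖ → scatDenom u v z₁ z₂ ≠ 0)
    (hden : ∀ z₁ z₂ : ℂ, ρ ≤ ‖z₁ - m‖ → ‖z₂‖ = R → scatDenom u v z₁ z₂ ≠ 0)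
    (hf : ∀ z, r ≤ ‖z‖ → DifferentiableAt ℂ f z)
    (hf' : ∀ z, ρ ≤ ‖z - m‖ → DifferentiableAt ℂ f z)
    (hg : ∀ z, r ≤ ‖z‖ → DifferentiableAt ℂ g z) :
    (∮ z₁ in C(0, r), ∮ z₂ in C(0, r), scat u v z₁ z₂ * f z₁ * g z₂) =
      ∮ z₁ in C(m, ρ), ∮ z₂ in C(0, R), scat u v z₁ z₂ * f z₁ * g z₂ := by
  have hR : 0 < R := hr.trans_le hrR
  have hfc : ContinuousOn f (sphere 0 r) := fun z hz =>
    (hf z (by simp_all)).continuousAt.continuousWithinAt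
  have hfc' : ContinuousOn f (sphere m ρ) := fun z hz =>
    (hf' z (by simp_all)).continuousAt.continuousWithinAt
  have hgc : ContinuousOn g (sphere 0 R) := fun z hz =>
    (hg z (by simp_all)).continuousAt.continuousWithinAt
  have step1 : (∮ z₁ in C(0, r), ∮ z₂ in C(0, r), scat u v z₁ z₂ * f z₁ * g z₂) =
      ∮ z₁ in C(0, r), ∮ z₂ in C(0, R), scat u v z₁ z₂ * f z₁ * g z₂ := by
    refine circleIntegral.integral_congr hr.le fun z₁ hz₁ => ?_
    refine (circleIntegral_eq_of_annulus hr hrR fun z₂ h _ => ?_).symm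
    rw [sub_zero] at h
    exact ((differentiableAt_scat_right (henc z₁ z₂ (by simp_all) h)).mul_const _).mul (hg z₂ h)
  have step3 : ∀ z₂ ∈ sphere (0 : ℂ) R, (∮ z₁ in C(0, r), scat u v z₁ z₂ * f z₁ * g z₂) =
      ∮ z₁ in C(m, ρ), scat u v z₁ z₂ * f z₁ * g z₂ := by
    intro z₂ hz₂
    have hz₂' : ‖z₂‖ = R := by simpa using hz₂
    rw [← circleIntegral_eq_of_annulus (R := max r (ρ + ‖m‖)) hr (le_max_left _ _)
      fun z₁ h _ => ?_]
    · refine circleIntegral_eq_of_differentiable_outside hρ (le_max_right _ _) fun z₁ h => ?_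
      exact ((differentiableAt_scat_left (hden z₁ z₂ h hz₂')).mul (hf' z₁ h)).mul_const _
    · rw [sub_zero] at h
      exact ((differentiableAt_scat_left (henc z₁ z₂ h (by linarith))).mul (hf z₁ h)).mul_const _
  rw [step1, circleIntegral_swap hr.le hR.le (continuousOn_scat_mul hfc hgc
    fun z₁ h₁ z₂ h₂ => henc z₁ z₂ (by simp_all) (by simp_all)),
    circleIntegral.integral_congr hR.le step3,
    circleIntegral_swap hρ.le hR.le (continuousOn_scat_mul hfc' hgc
    fun z₁ h₁ z₂ h₂ => hden z₁ z₂ (by simp_all) (by simp_all))]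

/-- The residue at `z₂ = poleMap z₁` of the scattering factor times `f z₁ * g z₂`. -/
noncomputable def scatResidue (u v : ℝ) (f g : ℂ → ℂ) (z : ℂ) : ℂ :=
  (u + v) * (z - poleMap u v z) / z * f z * g (poleMap u v z)

/-- The pole lies inside both circles, so nothing is crossed. -/
theorem scat_inner_eq_of_norm_lt {f g : ℂ → ℂ} {r R : ℝ} {z₁ : ℂ} (hz : z₁ ≠ 0) (hr : 0 < r)
    (hrR : r ≤ R) (hp : ‖poleMap u v z₁‖ < r) (hg : ∀ z, r ≤ ‖z‖ → DifferentiableAt ℂ g z) :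
    (∮ z₂ in C(0, R), scat u v z₁ z₂ * f z₁ * g z₂) =
      ∮ z₂ in C(0, r), scat u v z₁ z₂ * f z₁ * g z₂ := by
  refine circleIntegral_eq_of_annulus hr hrR fun z₂ h _ => ?_
  rw [sub_zero] at h
  exact ((differentiableAt_scat_right (scatDenom_ne_zero_of_norm_ne hz
    (by linarith : ‖poleMap u v z₁‖ < ‖z₂‖).ne')).mul_const _).mul (hg z₂ h)

theorem scat_inner_eq_add_residue {f g : ℂ → ℂ} {r R : ℝ} {z₁ : ℂ} (hz : z₁ ≠ 0) (hr : 0 < r)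
    (hp : r < ‖poleMap u v z₁‖) (hpR : ‖poleMap u v z₁‖ < R)
    (hg : ∀ z, r ≤ ‖z‖ → DifferentiableAt ℂ g z) :
    (∮ z₂ in C(0, R), scat u v z₁ z₂ * f z₁ * g z₂) =
      (∮ z₂ in C(0, r), scat u v z₁ z₂ * f z₁ * g z₂) +
        2 * Real.pi * Complex.I * scatResidue u v f g z₁ := by
  have key := circleIntegral_simple_pole (G := fun z₂ => scatDenom u v z₂ z₁ / z₁ * f z₁ * g z₂)
    hr hp hpR fun z h => by
      refine DifferentiableAt.mul ?_ (hg z h)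
      unfold scatDenom
      fun_prop
  have hG : ∀ z₂, scatDenom u v z₂ z₁ / z₁ * f z₁ * g z₂ / (z₂ - poleMap u v z₁) =
      scat u v z₁ z₂ * f z₁ * g z₂ := by
    intro z₂
    rw [scat, scatDenom_eq_mul u v hz, ← div_div]
    ring
  simp only [hG] at key
  rw [key]
  congr 2
  unfold scatResidue scatDenom
  congr 3
  -- By this relation the numerator of the scattering factor at the pole `p` collapses to `(u +
  -- v)(z₁ - p)`.
  have : poleMap u v z₁ * z₁ = (u + v) * z₁ - u * v := by
    unfold poleMap
    field_simp
  linear_combination this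

theorem continuousOn_poleMap {s : Set ℂ} (hs : ∀ z ∈ s, z ≠ 0) :
    ContinuousOn (poleMap u v) s := by
  unfold poleMap
  fun_prop (disch := assumption)

/-- Concentric contours: shrinking the second circle across the pole. -/
theorem scat_integral_eq_add_residue {f g : ℂ → ℂ} {r₁ r R : ℝ} (hr₁ : 0 < r₁) (hr : 0 < r)
    (hp : ∀ z : ℂ, ‖z‖ = r₁ → r < ‖poleMap u v z‖ ∧ ‖poleMap u v z‖ < R)
    (hf : ContinuousOn f (sphere 0 r₁)) (hg : ∀ z, r ≤ ‖z‖ → DifferentiableAt ℂ g z) :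
    (∮ z₁ in C(0, r₁), ∮ z₂ in C(0, R), scat u v z₁ z₂ * f z₁ * g z₂) =
      (∮ z₁ in C(0, r₁), ∮ z₂ in C(0, r), scat u v z₁ z₂ * f z₁ * g z₂) +
        2 * Real.pi * Complex.I * ∮ z in C(0, r₁), scatResidue u v f g z := by
  have h0 : ∀ z ∈ sphere (0 : ℂ) r₁, z ≠ 0 := by
    rintro z hz rfl
    simp only [mem_sphere_iff_norm, sub_self, norm_zero] at hz
    linarith
  rw [← circleIntegral.integral_const_mul, ← circleIntegral.integral_add]
  · refine circleIntegral.integral_congr hr₁.le fun z₁ hz₁ => ?_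
    have := hp z₁ (by simpa using hz₁)
    exact scat_inner_eq_add_residue (h0 z₁ hz₁) hr this.1 this.2 hg
  · refine circleIntegrable_circleIntegral hr₁.le hr.le (continuousOn_scat_mul hf ?_ ?_)
    · exact fun z hz => (hg z (by simp_all)).continuousAt.continuousWithinAt
    · intro z₁ h₁ z₂ h₂
      refine scatDenom_ne_zero_of_norm_ne (h0 z₁ h₁) ?_
      have := (hp z₁ (by simpa using h₁)).1
      have h₂' : ‖z₂‖ = r := by simpa using h₂
      exact (h₂' ▸ this).ne
  · refine ContinuousOn.circleIntegrable hr₁.le (continuousOn_const.mul ?_)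
    have hpc := continuousOn_poleMap (u := u) (v := v) h0
    have hgc : ContinuousOn (fun z => g (poleMap u v z)) (sphere 0 r₁) := fun z hz =>
      (hg _ (hp z (by simpa using hz)).1.le).continuousAt.comp_continuousWithinAt (hpc z hz)
    exact (((continuousOn_const.mul (continuousOn_id.sub hpc)).div continuousOn_id h0).mul
      hf).mul hgc

theorem sub_poleMap {z : ℂ} (hz : z ≠ 0) : z - poleMap u v z = (z - u) * (z - v) / z := by
  unfold poleMap
  field_simp
  ring

/-- The numerator of `poleMap`. -/
noncomputable def poleNum (u v : ℝ) (z : ℂ) : ℂ := (u + v) * z - u * v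

theorem poleMap_eq_div {z : ℂ} (hz : z ≠ 0) : poleMap u v z = poleNum u v z / z := by
  unfold poleMap poleNum
  field_simp

/-- The product of the symbols at `z` and at `poleMap z`, where a zero and a pole cancel. -/
noncomputable def hopPair (b u v : ℝ) (z : ℂ) : ℂ :=
  (hopCoef b u v : ℂ) ^ 2 * u *
    ((b * z + (u - b * u - b * v : ℝ)) / ((u + v - b * v : ℝ) * z - (u * v : ℝ)))

/-- The numerator of `hop` at `poleMap z` is `u (z - b v) / z`, which cancels the pole of `hop` at
`b v`. The only pole left is `u v / (u + v - b v)`. -/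
theorem hop_mul_hop_poleMap {z : ℂ} (hz : z ≠ 0) (hz' : z ≠ (b * v : ℝ)) :
    hop b u v z * hop b u v (poleMap u v z) = hopPair b u v z := by
  have h1 : (b : ℂ) * poleMap u v z + (u - b * u - b * v : ℝ) = u * (z - (b * v : ℝ)) / z := by
    unfold poleMap
    push_cast
    field_simp
    ring
  have h2 : poleMap u v z - (b * v : ℝ) =
      ((u + v - b * v : ℝ) * z - (u * v : ℝ)) / z := by
    unfold poleMap
    push_cast
    field_simp
    ring
  have h3 := sub_ne_zero.2 hz'
  unfold hop hopPair
  rw [h1, h2, div_div_div_cancel_right₀ hz]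
  rw [mul_mul_mul_comm, ← sq, div_mul_div_comm, mul_assoc]
  congr 1
  rw [mul_div_assoc', mul_comm (z - ((b * v : ℝ) : ℂ)),
    show ((b : ℂ) * z + (u - b * u - b * v : ℝ)) * (u * (z - (b * v : ℝ))) =
      u * (b * z + (u - b * u - b * v : ℝ)) * (z - (b * v : ℝ)) by ring,
    mul_div_mul_right _ _ h3]

/-- The residue of the two-particle integrand, with its removable singularities removed. -/
noncomputable def residueWave (b u v : ℝ) (n₁ n₂ : ℤ) (j₁ j₂ t : ℕ) (z : ℂ) : ℂ :=
  (u + v) * ((z - u) * (z - v)) * (z - 1) ^ j₁ * (poleNum u v z - z) ^ j₂ *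
    z ^ (n₁ - n₂ - 2 - j₂) * poleNum u v z ^ (n₂ - 1) * hopPair b u v z ^ t

theorem scatResidue_wave {z : ℂ} (hz : z ≠ 0) (hz' : z ≠ (b * v : ℝ)) (n₁ n₂ : ℤ)
    (j₁ j₂ t : ℕ) :
    scatResidue u v (wave b u v n₁ j₁ t) (wave b u v n₂ j₂ t) z =
      residueWave b u v n₁ n₂ j₁ j₂ t z := by
  unfold scatResidue residueWave wave
  rw [sub_poleMap hz, ← hop_mul_hop_poleMap hz hz', mul_pow, poleMap_eq_div hz, div_zpow,
    div_sub_one hz, div_pow]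
  have h1 : z ^ (n₁ - n₂ - 2 - j₂) =
      z ^ (n₁ - 1) / (z ^ (n₂ - 1) * z ^ j₂ * (z * z)) := by
    rw [eq_div_iff (by positivity), ← zpow_natCast z j₂, ← sq, ← zpow_natCast z 2,
      ← zpow_add₀ hz, ← zpow_add₀ hz, ← zpow_add₀ hz]
    congr 1
    push_cast
    ring
  rw [h1]
  have h2 := zpow_ne_zero (n₂ - 1) hz
  field_simp

/-- The possible singularities are `0`, the zero `u v / (u + v)` of `poleNum`, and the pole of
`hopPair`. The first two disappear when their exponents are nonnegative; the second alternative in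
`hN` is what permits a tiny contour around the last pole in the subcritical regime. -/
theorem differentiableAt_residueWave {z : ℂ} {n₁ n₂ : ℤ} {j₁ j₂ t : ℕ}
    (h0 : z ≠ 0 ∨ (j₂ : ℤ) + 2 ≤ n₁ - n₂) (hN : poleNum u v z ≠ 0 ∨ 1 ≤ n₂)
    (hd : ((u + v - b * v : ℝ) : ℂ) * z - (u * v : ℝ) ≠ 0) :
    DifferentiableAt ℂ (residueWave b u v n₁ n₂ j₁ j₂ t) z := by
  have hp : DifferentiableAt ℂ (poleNum u v) z := by unfold poleNum; fun_prop
  have h1 : DifferentiableAt ℂ (fun z : ℂ => z ^ (n₁ - n₂ - 2 - j₂)) z :=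
    differentiableAt_zpow.2 (h0.imp id fun h => by linarith)
  have h2 : DifferentiableAt ℂ (fun z : ℂ => poleNum u v z ^ (n₂ - 1)) z :=
    hp.zpow (hN.imp id fun h => by linarith)
  have h3 : DifferentiableAt ℂ (hopPair b u v) z := by
    unfold hopPair
    fun_prop (disch := assumption)
  unfold residueWave
  fun_prop

theorem integral_scatResidue_eq {r ρ : ℝ} {m : ℂ} {n₁ n₂ : ℤ} {j₁ j₂ t : ℕ} (hr : 0 < r)
    (hρ : 0 < ρ) (hm : ρ + ‖m‖ ≤ r) (hbv : |b * v| < r)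
    (hd : ∀ z, ρ ≤ ‖z - m‖ → DifferentiableAt ℂ (residueWave b u v n₁ n₂ j₁ j₂ t) z) :
    (∮ z in C(0, r), scatResidue u v (wave b u v n₁ j₁ t) (wave b u v n₂ j₂ t) z) =
      ∮ z in C(m, ρ), residueWave b u v n₁ n₂ j₁ j₂ t z := by
  rw [← circleIntegral_eq_of_differentiable_outside hρ hm hd]
  refine circleIntegral.integral_congr hr.le fun z hz => scatResidue_wave ?_ ?_ _ _ _ _ _
  · rintro rfl
    simp only [mem_sphere_iff_norm, sub_self, norm_zero] at hz
    linarith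
  · rintro rfl
    simp only [mem_sphere_iff_norm, sub_zero, Complex.norm_real, Real.norm_eq_abs] at hz
    linarith

end S6V

/-! ### Decay of the one-particle symbol along circles -/

namespace S6V

open Set Metric Function Filter Topology

/-- On a circle with real centre the squared modulus of a real affine function is affine in `1 - cos
θ`. Decay of the symbols along such circles thus becomes an inequality between rational functions,
up to a real power, on `[0, 2]`. -/
theorem norm_sq_affine_circleMap (α β m ρ θ : ℝ) :
    ‖(α : ℂ) * circleMap m ρ θ + β‖ ^ 2 =
      (α * (m + ρ) + β) ^ 2 - 2 * (α * m + β) * (α * ρ) * (1 - Real.cos θ) := by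
  have h : (α : ℂ) * circleMap m ρ θ + β =
      ((α * m + β + α * ρ * Real.cos θ : ℝ) : ℂ) + ((α * ρ * Real.sin θ : ℝ) : ℂ) * Complex.I := by
    rw [circleMap, Complex.exp_mul_I]
    push_cast
    ring
  rw [h, ← Complex.normSq_eq_norm_sq, Complex.normSq_add_mul_I]
  linear_combination (α * ρ) ^ 2 * Real.sin_sq_add_cos_sq θ

theorem norm_circleMap_sub_right_end (m ρ θ : ℝ) :
    ‖circleMap m ρ θ - (m + ρ : ℝ)‖ ^ 2 = 2 * ρ ^ 2 * (1 - Real.cos θ) := by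
  have := norm_sq_affine_circleMap 1 (-(m + ρ)) m ρ θ
  push_cast at this ⊢
  rw [one_mul, ← sub_eq_add_neg] at this
  rw [this]
  ring

theorem one_sub_mul_rpow_le {k x μ : ℝ} (hμ : 0 ≤ μ) (hkx0 : 0 ≤ k * x) (hkx : k * x ≤ 1) :
    (1 - k * x) ^ μ ≤ 1 - min μ 1 * (k * x) := by
  rcases le_total μ 1 with h | h
  · rw [min_eq_left h]
    have := rpow_one_add_le_one_add_mul_self (s := -(k * x)) (by linarith) hμ h
    calc (1 - k * x) ^ μ = (1 + -(k * x)) ^ μ := by ring_nf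
      _ ≤ _ := this
      _ = _ := by ring
  · rw [min_eq_right h, one_mul]
    calc (1 - k * x) ^ μ ≤ (1 - k * x) ^ (1 : ℝ) :=
          Real.rpow_le_rpow_of_exponent_ge' (by linarith) (by linarith) zero_le_one h
      _ = _ := Real.rpow_one _

/-- A product of powers of affine functions is dominated by an exponential as soon as it is so
to first order at `0` and at the right end of the interval. -/
theorem rpow_mul_div_le_exp {k₀ k₁ k₂ μ c x : ℝ} (hx0 : 0 ≤ x) (hx2 : x ≤ 2) (hμ : 0 ≤ μ)
    (hk0 : 0 ≤ k₀) (hk0' : k₀ ≤ 1 / 2) (hk1 : 0 ≤ 1 + k₁ * x) (hk2 : 0 < 1 + 2 * k₂)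
    (h0 : 0 ≤ k₂ - k₁ + min μ 1 * k₀ - c)
    (h2 : 0 ≤ k₂ - k₁ + min μ 1 * k₀ - c + 2 * (min μ 1 * k₀ * k₁ - c * k₂)) :
    (1 - k₀ * x) ^ μ * ((1 + k₁ * x) / (1 + k₂ * x)) ≤ Real.exp (-(c * x)) := by
  have hk2x : 0 < 1 + k₂ * x := by
    rcases hx2.lt_or_eq with h | rfl
    · nlinarith [mul_nonneg hx0 hk2.le]
    · linarith
  have h1 := one_sub_mul_rpow_le (k := k₀) (x := x) hμ (by positivity) (by nlinarith)
  -- The difference of the two sides is `x` times an affine function of `x`, whose values at `0` and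
  -- `2` are the quantities in `h0` and `h2`.
  have h3 : (1 - min μ 1 * (k₀ * x)) * (1 + k₁ * x) ≤ (1 - c * x) * (1 + k₂ * x) := by
    nlinarith [mul_nonneg (mul_nonneg hx0 (by linarith : (0 : ℝ) ≤ 2 - x)) h0,
      mul_nonneg (mul_nonneg hx0 hx0) h2]
  calc (1 - k₀ * x) ^ μ * ((1 + k₁ * x) / (1 + k₂ * x))
      ≤ (1 - min μ 1 * (k₀ * x)) * ((1 + k₁ * x) / (1 + k₂ * x)) := by gcongr
    _ ≤ 1 - c * x := by rw [mul_div_assoc', div_le_iff₀ hk2x]; exact h3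
    _ ≤ Real.exp (-(c * x)) := by linarith [Real.add_one_le_exp (-(c * x))]

variable {b : ℝ}

/-- The circle with diameter `[h, r]`, parametrised so that `θ = 0` is the point `r`. -/
noncomputable def diamCircle (h r θ : ℝ) : ℂ := circleMap ((r + h) / 2 : ℝ) ((r - h) / 2) θ

theorem norm_sq_affine_diamCircle (α β h r θ : ℝ) :
    ‖(α : ℂ) * diamCircle h r θ + β‖ ^ 2 =
      (α * r + β) ^ 2 - (α * (r + h) + 2 * β) * (α * (r - h)) / 2 * (1 - Real.cos θ) := by
  rw [diamCircle, norm_sq_affine_circleMap]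
  ring

theorem norm_sq_diamCircle (h r θ : ℝ) :
    ‖diamCircle h r θ‖ ^ 2 = r ^ 2 - (r + h) * (r - h) / 2 * (1 - Real.cos θ) := by
  have := norm_sq_affine_diamCircle 1 0 h r θ
  simpa using this

theorem norm_sq_affine_diamCircle_eq_mul {α β h r : ℝ} (hne : α * r + β ≠ 0) (θ : ℝ) :
    ‖(α : ℂ) * diamCircle h r θ + β‖ ^ 2 = (α * r + β) ^ 2 *
      (1 + -((α * (r + h) + 2 * β) * (α * (r - h)) / (2 * (α * r + β) ^ 2)) *
        (1 - Real.cos θ)) := by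
  rw [norm_sq_affine_diamCircle]
  field_simp
  ring

theorem one_sub_cos_mem (θ : ℝ) : 0 ≤ 1 - Real.cos θ ∧ 1 - Real.cos θ ≤ 2 :=
  ⟨by linarith [Real.cos_le_one θ], by linarith [Real.neg_one_le_cos θ]⟩

theorem norm_hop_sq (b u v : ℝ) (z : ℂ) :
    ‖hop b u v z‖ ^ 2 = hopCoef b u v ^ 2 *
      (‖(b : ℂ) * z + (u - b * u - b * v : ℝ)‖ ^ 2 / ‖((1 : ℝ) : ℂ) * z + (-(b * v) : ℝ)‖ ^ 2) := by
  unfold hop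
  rw [norm_mul, norm_div, mul_pow, div_pow, Complex.norm_real, Real.norm_eq_abs, sq_abs]
  congr 4
  push_cast
  ring

theorem le_mul_exp_of_sq_le {a B c x : ℝ} (hB : 0 ≤ B)
    (h : a ^ 2 ≤ B ^ 2 * Real.exp (-(2 * c * x))) : a ≤ B * Real.exp (-(c * x)) := by
  refine le_of_sq_le_sq ?_ (by positivity)
  rw [mul_pow, ← Real.exp_nat_mul]
  refine h.trans (le_of_eq ?_)
  congr 2
  push_cast
  ring

set_option maxHeartbeats 1000000 in
/-- Near the degenerate point `u = v = r = 1`, on circles with diameter `[h, r]`, the one-particle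
symbol decays away from the point `r`; here `h` is near `0` or near `-1`. -/
theorem eventually_norm_hop_le (hb : b ∈ Ioo (0 : ℝ) 1) {h₀ : ℝ} (hh₀ : h₀ = 0 ∨ h₀ = -1) :
    ∃ c > 0, ∀ᶠ p : ℝ × ℝ × ℝ × ℝ in 𝓝 (1, 1, 1, h₀), |p.2.2.2| ≤ p.2.2.1 → ∀ θ,
      ‖diamCircle p.2.2.2 p.2.2.1 θ‖ ^ speed b p.1 p.2.1 *
          ‖hop b p.1 p.2.1 (diamCircle p.2.2.2 p.2.2.1 θ)‖ ≤
        p.2.2.1 ^ speed b p.1 p.2.1 * ‖hop b p.1 p.2.1 p.2.2.1‖ *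
          Real.exp (-(c * (1 - Real.cos θ))) := by
  obtain ⟨hb0, hb1⟩ := hb
  set p₀ : ℝ × ℝ × ℝ × ℝ := (1, 1, 1, h₀) with hp₀
  -- Relative slopes in `1 - cos θ` of the squared moduli of `z` (with the opposite sign), of the
  -- numerator of the symbol and of its denominator. They are continuous in the parameters, so
  -- strict inequalities at the limit point persist nearby.
  set k₀ : ℝ × ℝ × ℝ × ℝ → ℝ := fun p =>
    (p.2.2.1 + p.2.2.2) * (p.2.2.1 - p.2.2.2) / (2 * p.2.2.1 ^ 2) with hk₀
  set k₁ : ℝ × ℝ × ℝ × ℝ → ℝ := fun p =>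
    -((b * (p.2.2.1 + p.2.2.2) + 2 * (p.1 - b * p.1 - b * p.2.1)) * (b * (p.2.2.1 - p.2.2.2)) /
      (2 * (b * p.2.2.1 + (p.1 - b * p.1 - b * p.2.1)) ^ 2)) with hk₁
  set k₂ : ℝ × ℝ × ℝ × ℝ → ℝ := fun p =>
    -((1 * (p.2.2.1 + p.2.2.2) + 2 * -(b * p.2.1)) * (1 * (p.2.2.1 - p.2.2.2)) /
      (2 * (1 * p.2.2.1 + -(b * p.2.1)) ^ 2)) with hk₂
  set μ : ℝ × ℝ × ℝ × ℝ → ℝ := fun p => speed b p.1 p.2.1 with hμ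
  have hb' : 1 - b ≠ 0 := by linarith
  have e0 : k₀ p₀ = (1 - h₀ ^ 2) / 2 := by simp only [hk₀, hp₀]; ring
  have e1 : k₁ p₀ = -((b * (1 + h₀) + 2 * (1 - b - b)) * (b * (1 - h₀)) / (2 * (1 - b) ^ 2)) := by
    simp only [hk₁, hp₀]; ring_nf
  have e2 : k₂ p₀ = -((1 + h₀ - 2 * b) * (1 - h₀) / (2 * (1 - b) ^ 2)) := by
    simp only [hk₂, hp₀]; ring_nf
  have e3 : μ p₀ = 1 := by
    simp only [hμ, hp₀, speed]
    rw [show (b + (1 - b * 1 - b * 1)) * (1 - b * 1) = (1 - b) * (1 - b * 1) by ring]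
    exact div_self (by rw [mul_one]; positivity)
  have n1 : 2 * p₀.2.2.1 ^ 2 ≠ 0 := by simp [hp₀]
  have n2 : 2 * (b * p₀.2.2.1 + (p₀.1 - b * p₀.1 - b * p₀.2.1)) ^ 2 ≠ 0 := by
    have : (b * p₀.2.2.1 + (p₀.1 - b * p₀.1 - b * p₀.2.1)) = 1 - b := by simp only [hp₀]; ring
    rw [this]
    positivity
  have n3 : 2 * (1 * p₀.2.2.1 + -(b * p₀.2.1)) ^ 2 ≠ 0 := by
    have : (1 * p₀.2.2.1 + -(b * p₀.2.1)) = 1 - b := by simp only [hp₀]; ring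
    rw [this]
    positivity
  have n4 : (b + (p₀.1 - b * p₀.1 - b * p₀.2.1)) * (1 - b * p₀.2.1) ≠ 0 := by
    have : (b + (p₀.1 - b * p₀.1 - b * p₀.2.1)) * (1 - b * p₀.2.1) = (1 - b) ^ 2 := by
      simp only [hp₀]; ring
    rw [this]
    positivity
  have c0 : ContinuousAt k₀ p₀ := by simp only [hk₀]; fun_prop (disch := assumption)
  have c1 : ContinuousAt k₁ p₀ := by simp only [hk₁]; fun_prop (disch := assumption)
  have c2 : ContinuousAt k₂ p₀ := by simp only [hk₂]; fun_prop (disch := assumption)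
  have c3 : ContinuousAt μ p₀ := by
    simp only [hμ, speed]
    fun_prop (disch := assumption)
  have c4 : ContinuousAt (fun p => min (μ p) 1) p₀ := c3.min continuousAt_const
  have hs : 0 < (1 - b) ^ 2 := by positivity
  -- positivity at the limit point
  have L0 : 0 < k₂ p₀ - k₁ p₀ + min (μ p₀) 1 * k₀ p₀ := by
    rw [e0, e1, e2, e3, min_self]
    have : -((1 + h₀ - 2 * b) * (1 - h₀) / (2 * (1 - b) ^ 2)) -
        -((b * (1 + h₀) + 2 * (1 - b - b)) * (b * (1 - h₀)) / (2 * (1 - b) ^ 2)) +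
        1 * ((1 - h₀ ^ 2) / 2) = b * (1 - h₀) ^ 2 / (1 - b) := by
      field_simp
      ring
    rw [this]
    have : 0 < 1 - b := by linarith
    rcases hh₀ with rfl | rfl <;> positivity
  have L2 : 0 < k₂ p₀ - k₁ p₀ + min (μ p₀) 1 * k₀ p₀ + 2 * (min (μ p₀) 1 * k₀ p₀ * k₁ p₀) := by
    rcases hh₀ with rfl | rfl
    · rw [e0, e1, e2, e3, min_self]
      have : -((1 + 0 - 2 * b) * (1 - 0) / (2 * (1 - b) ^ 2)) -
        -((b * (1 + 0) + 2 * (1 - b - b)) * (b * (1 - 0)) / (2 * (1 - b) ^ 2)) +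
        1 * ((1 - 0 ^ 2) / 2) + 2 * (1 * ((1 - 0 ^ 2) / 2) *
          -((b * (1 + 0) + 2 * (1 - b - b)) * (b * (1 - 0)) / (2 * (1 - b) ^ 2))) =
          b ^ 2 / (2 * (1 - b) ^ 2) := by
        field_simp
        ring
      rw [this]
      positivity
    · have : k₀ p₀ = 0 := by rw [e0]; norm_num
      rw [this] at L0 ⊢
      linarith
  have L3 : 0 < 1 + 2 * k₂ p₀ := by
    rw [e2]
    rcases hh₀ with rfl | rfl
    · have : 1 + 2 * -((1 + 0 - 2 * b) * (1 - 0) / (2 * (1 - b) ^ 2)) = b ^ 2 / (1 - b) ^ 2 := by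
        field_simp
        ring
      rw [this]; positivity
    · have : 1 + 2 * -((1 + -1 - 2 * b) * (1 - -1) / (2 * (1 - b) ^ 2)) =
          (1 + b) ^ 2 / (1 - b) ^ 2 := by
        field_simp
        ring
      rw [this]; positivity
  -- choose the rate
  have hlim : Tendsto (fun c : ℝ => k₂ p₀ - k₁ p₀ + min (μ p₀) 1 * k₀ p₀ - c +
      2 * (min (μ p₀) 1 * k₀ p₀ * k₁ p₀ - c * k₂ p₀)) (𝓝[>] 0)
      (𝓝 (k₂ p₀ - k₁ p₀ + min (μ p₀) 1 * k₀ p₀ - 0 +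
      2 * (min (μ p₀) 1 * k₀ p₀ * k₁ p₀ - 0 * k₂ p₀))) :=
    (Continuous.tendsto (by fun_prop) 0).mono_left nhdsWithin_le_nhds
  have hlim0 : ∀ᶠ c : ℝ in 𝓝[>] 0, c < k₂ p₀ - k₁ p₀ + min (μ p₀) 1 * k₀ p₀ :=
    (eventually_lt_nhds L0).filter_mono nhdsWithin_le_nhds
  have hpos : ∀ᶠ c : ℝ in 𝓝[>] 0, 0 < c := self_mem_nhdsWithin
  obtain ⟨c, hc, hc1, hc2⟩ := (hpos.and (hlim0.and (hlim.eventually (lt_mem_nhds (by linarith : (0 : ℝ) < _))))).exists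
  -- The rate `c` belongs to squared norms, hence the half.
  refine ⟨c / 2, half_pos hc, ?_⟩
  have ev0 : ∀ᶠ p in 𝓝 p₀, c < k₂ p - k₁ p + min (μ p) 1 * k₀ p :=
    ((c2.sub c1).add (c4.mul c0)).eventually (lt_mem_nhds hc1)
  have ev2 : ∀ᶠ p in 𝓝 p₀, 0 < k₂ p - k₁ p + min (μ p) 1 * k₀ p - c +
      2 * (min (μ p) 1 * k₀ p * k₁ p - c * k₂ p) :=
    ((((c2.sub c1).add (c4.mul c0)).sub continuousAt_const).add
      (continuousAt_const.mul (((c4.mul c0).mul c1).sub (continuousAt_const.mul c2)))).eventually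
      (lt_mem_nhds hc2)
  have ev3 : ∀ᶠ p in 𝓝 p₀, 0 < 1 + 2 * k₂ p :=
    (continuousAt_const.add (continuousAt_const.mul c2)).eventually (lt_mem_nhds L3)
  have ev4 : ∀ᶠ p in 𝓝 p₀, 0 < μ p := c3.eventually (lt_mem_nhds (by rw [e3]; norm_num))
  have ev5 : ∀ᶠ p : ℝ × ℝ × ℝ × ℝ in 𝓝 p₀, 0 < p.2.2.1 :=
    continuousAt_const.eventually_lt (by fun_prop) (by simp [hp₀])
  have ev6 : ∀ᶠ p : ℝ × ℝ × ℝ × ℝ in 𝓝 p₀, 0 < b * p.2.2.1 + (p.1 - b * p.1 - b * p.2.1) :=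
    continuousAt_const.eventually_lt (by fun_prop) (by simp only [hp₀]; linarith)
  have ev7 : ∀ᶠ p : ℝ × ℝ × ℝ × ℝ in 𝓝 p₀, 0 < 1 * p.2.2.1 + -(b * p.2.1) :=
    continuousAt_const.eventually_lt (by fun_prop) (by simp only [hp₀]; linarith)
  filter_upwards [ev0, ev2, ev3, ev4, ev5, ev6, ev7] with p h0 h2 h3 h4 h5 h6 h7 hh θ
  obtain ⟨hx0, hx2⟩ := one_sub_cos_mem θ
  obtain ⟨u, v, r, h⟩ := p
  simp only at h5 h6 h7 hh ⊢
  obtain ⟨hh1, hh2⟩ := abs_le.1 hh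
  set x := 1 - Real.cos θ
  set z := diamCircle h r θ with hz
  have f1 : _ = _ * (1 + k₁ (u, v, r, h) * x) := norm_sq_affine_diamCircle_eq_mul h6.ne' θ
  have f2 : _ = _ * (1 + k₂ (u, v, r, h) * x) := norm_sq_affine_diamCircle_eq_mul h7.ne' θ
  rw [← hz] at f1 f2
  have f0 : ‖z‖ ^ 2 = r ^ 2 * (1 - k₀ (u, v, r, h) * x) := by
    rw [hz, norm_sq_diamCircle]
    simp only [hk₀]
    field_simp
    ring
  have hk0 : 0 ≤ k₀ (u, v, r, h) :=
    div_nonneg (mul_nonneg (by simp only; linarith) (by simp only; linarith)) (by positivity)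
  have hk0' : k₀ (u, v, r, h) ≤ 1 / 2 := by
    rw [div_le_div_iff₀ (by positivity) two_pos]
    simp only
    linarith [sq_nonneg h]
  clear_value k₀ k₁ k₂ z x
  have hk1 : 0 ≤ 1 + k₁ (u, v, r, h) * x := by
    refine nonneg_of_mul_nonneg_right (f1 ▸ sq_nonneg _) (by positivity)
  have main := rpow_mul_div_le_exp (c := c) hx0 hx2 h4.le hk0 hk0' hk1 h3 (by linarith) h2.le
  refine le_mul_exp_of_sq_le (by positivity) ?_
  have hr : ((b * r + (u - b * u - b * v)) ^ 2 / (1 * r + -(b * v)) ^ 2) =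
      ‖(b : ℂ) * r + (u - b * u - b * v : ℝ)‖ ^ 2 /
        ‖((1 : ℝ) : ℂ) * r + (-(b * v) : ℝ)‖ ^ 2 := by
    simp only [← Complex.ofReal_mul, ← Complex.ofReal_add, Complex.norm_real, Real.norm_eq_abs,
      sq_abs]
  rw [mul_pow, mul_pow, norm_hop_sq, norm_hop_sq, ← hr, f1, f2, ← Real.rpow_mul_natCast
    (norm_nonneg _), ← Real.rpow_mul_natCast h5.le, mul_comm (speed b u v), Real.rpow_natCast_mul
    (norm_nonneg _), Real.rpow_natCast_mul h5.le, f0, Real.mul_rpow (sq_nonneg _)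
    (by linarith [mul_le_mul hk0' hx2 hx0 (by norm_num)])]
  calc _ = (r ^ 2) ^ speed b u v * (hopCoef b u v ^ 2 *
      ((b * r + (u - b * u - b * v)) ^ 2 / (1 * r + -(b * v)) ^ 2)) *
      ((1 - k₀ (u, v, r, h) * x) ^ speed b u v *
        ((1 + k₁ (u, v, r, h) * x) / (1 + k₂ (u, v, r, h) * x))) := by
        rw [mul_div_mul_comm]
        ring
    _ ≤ _ := by
      refine mul_le_mul_of_nonneg_left ?_ (by positivity)
      rw [show 2 * (c / 2) * x = c * x by ring]
      exact main

end S6V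

/-! ### Decay of the product of the symbols at a pole -/

namespace S6V

open Set Metric Function Filter Topology

variable {b : ℝ}

theorem poleNum_eq_affine (u v : ℝ) (z : ℂ) :
    poleNum u v z = ((u + v : ℝ) : ℂ) * z + (-(u * v) : ℝ) := by
  unfold poleNum
  push_cast
  ring

theorem norm_hopPair_sq (b u v : ℝ) (z : ℂ) :
    ‖hopPair b u v z‖ ^ 2 = (hopCoef b u v ^ 2 * u) ^ 2 *
      (‖(b : ℂ) * z + (u - b * u - b * v : ℝ)‖ ^ 2 /
        ‖((u + v - b * v : ℝ) : ℂ) * z + (-(u * v) : ℝ)‖ ^ 2) := by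
  unfold hopPair
  rw [norm_mul, norm_div, mul_pow, div_pow]
  congr 1
  · rw [← Complex.ofReal_pow, ← Complex.ofReal_mul, Complex.norm_real, Real.norm_eq_abs, sq_abs]
  · congr 3
    push_cast
    ring

set_option maxHeartbeats 1000000 in
/-- Near the degenerate point `u = v = r = 1`, on circles with diameter `[h, r]` with `h` near `0`,
the symbol of the residue decays away from the point `r`. -/
theorem eventually_norm_hopPair_le (hb : b ∈ Ioo (0 : ℝ) 1) :
    ∃ c > 0, ∀ᶠ p : ℝ × ℝ × ℝ × ℝ in 𝓝 (1, 1, 1, 0), ∀ θ,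
      ‖poleNum p.1 p.2.1 (diamCircle p.2.2.2 p.2.2.1 θ)‖ ^ speed b p.1 p.2.1 *
          ‖hopPair b p.1 p.2.1 (diamCircle p.2.2.2 p.2.2.1 θ)‖ ≤
        ‖poleNum p.1 p.2.1 p.2.2.1‖ ^ speed b p.1 p.2.1 * ‖hopPair b p.1 p.2.1 p.2.2.1‖ *
          Real.exp (-(c * (1 - Real.cos θ))) := by
  obtain ⟨hb0, hb1⟩ := hb
  set p₀ : ℝ × ℝ × ℝ × ℝ := (1, 1, 1, 0) with hp₀
  set kN : ℝ × ℝ × ℝ × ℝ → ℝ := fun p =>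
    -(((p.1 + p.2.1) * (p.2.2.1 + p.2.2.2) + 2 * -(p.1 * p.2.1)) *
      ((p.1 + p.2.1) * (p.2.2.1 - p.2.2.2)) /
      (2 * ((p.1 + p.2.1) * p.2.2.1 + -(p.1 * p.2.1)) ^ 2)) with hkN
  set k₁ : ℝ × ℝ × ℝ × ℝ → ℝ := fun p =>
    -((b * (p.2.2.1 + p.2.2.2) + 2 * (p.1 - b * p.1 - b * p.2.1)) * (b * (p.2.2.1 - p.2.2.2)) /
      (2 * (b * p.2.2.1 + (p.1 - b * p.1 - b * p.2.1)) ^ 2)) with hk₁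
  set k₂ : ℝ × ℝ × ℝ × ℝ → ℝ := fun p =>
    -(((p.1 + p.2.1 - b * p.2.1) * (p.2.2.1 + p.2.2.2) + 2 * -(p.1 * p.2.1)) *
      ((p.1 + p.2.1 - b * p.2.1) * (p.2.2.1 - p.2.2.2)) /
      (2 * ((p.1 + p.2.1 - b * p.2.1) * p.2.2.1 + -(p.1 * p.2.1)) ^ 2)) with hk₂
  set μ : ℝ × ℝ × ℝ × ℝ → ℝ := fun p => speed b p.1 p.2.1 with hμ
  have hb' : 1 - b ≠ 0 := by linarith
  have hs : 0 < (1 - b) ^ 2 := by positivity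
  -- At `u = v = 1` one has `poleNum z = 2z - 1`, of constant modulus on the circle with diameter
  -- `[0, 1]`. The decay must come from `hopPair` alone, and the power of `poleNum` is only a small
  -- perturbation.
  have eN : kN p₀ = 0 := by simp only [hkN, hp₀]; norm_num
  have e1 : k₁ p₀ = -((b + 2 * (1 - b - b)) * b / (2 * (1 - b) ^ 2)) := by
    simp only [hk₁, hp₀]; ring_nf
  have e2 : k₂ p₀ = b * (2 - b) / (2 * (1 - b) ^ 2) := by
    simp only [hk₂, hp₀]; ring_nf
  have e3 : μ p₀ = 1 := by
    simp only [hμ, hp₀, speed]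
    rw [show (b + (1 - b * 1 - b * 1)) * (1 - b * 1) = (1 - b) * (1 - b * 1) by ring]
    exact div_self (by rw [mul_one]; positivity)
  have n1 : 2 * ((p₀.1 + p₀.2.1) * p₀.2.2.1 + -(p₀.1 * p₀.2.1)) ^ 2 ≠ 0 := by
    simp only [hp₀]; norm_num
  have n2 : 2 * (b * p₀.2.2.1 + (p₀.1 - b * p₀.1 - b * p₀.2.1)) ^ 2 ≠ 0 := by
    have : (b * p₀.2.2.1 + (p₀.1 - b * p₀.1 - b * p₀.2.1)) = 1 - b := by simp only [hp₀]; ring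
    rw [this]
    positivity
  have n3 : 2 * ((p₀.1 + p₀.2.1 - b * p₀.2.1) * p₀.2.2.1 + -(p₀.1 * p₀.2.1)) ^ 2 ≠ 0 := by
    have : ((p₀.1 + p₀.2.1 - b * p₀.2.1) * p₀.2.2.1 + -(p₀.1 * p₀.2.1)) = 1 - b := by simp only [hp₀]; ring
    rw [this]
    positivity
  have n4 : (b + (p₀.1 - b * p₀.1 - b * p₀.2.1)) * (1 - b * p₀.2.1) ≠ 0 := by
    have : (b + (p₀.1 - b * p₀.1 - b * p₀.2.1)) * (1 - b * p₀.2.1) = (1 - b) ^ 2 := by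
      simp only [hp₀]; ring
    rw [this]
    positivity
  have cN : ContinuousAt kN p₀ := by simp only [hkN]; fun_prop (disch := assumption)
  have c1 : ContinuousAt k₁ p₀ := by simp only [hk₁]; fun_prop (disch := assumption)
  have c2 : ContinuousAt k₂ p₀ := by simp only [hk₂]; fun_prop (disch := assumption)
  have c3 : ContinuousAt μ p₀ := by
    simp only [hμ, speed]
    fun_prop (disch := assumption)
  have L0 : 0 < k₂ p₀ - k₁ p₀ := by
    have : k₂ p₀ - k₁ p₀ = 2 * b / (1 - b) := by
      rw [e1, e2]
      field_simp
      ring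
    rw [this]
    have : 0 < 1 - b := by linarith
    positivity
  have L3 : 0 < 1 + 2 * k₂ p₀ := by
    rw [e2]
    have : 0 < 2 - b := by linarith
    positivity
  have hlim : Tendsto (fun c : ℝ => k₂ p₀ - k₁ p₀ - c - 2 * (c * k₂ p₀)) (𝓝[>] 0)
      (𝓝 (k₂ p₀ - k₁ p₀ - 0 - 2 * (0 * k₂ p₀))) :=
    (Continuous.tendsto (by fun_prop) 0).mono_left nhdsWithin_le_nhds
  have hlim0 : ∀ᶠ c : ℝ in 𝓝[>] 0, c < k₂ p₀ - k₁ p₀ :=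
    (eventually_lt_nhds L0).filter_mono nhdsWithin_le_nhds
  have hpos : ∀ᶠ c : ℝ in 𝓝[>] 0, 0 < c := self_mem_nhdsWithin
  obtain ⟨c, hc, hc1, hc2⟩ := (hpos.and (hlim0.and
    (hlim.eventually (lt_mem_nhds (by linarith : (0 : ℝ) < _))))).exists
  -- Half of the rate `c` for the squared `hopPair` is spent on the power of `poleNum`, through `kN
  -- < c / 4` and `μ < 2`; the square root halves what remains.
  refine ⟨c / 4, by positivity, ?_⟩
  have ev0 : ∀ᶠ p in 𝓝 p₀, c < k₂ p - k₁ p :=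
    continuousAt_const.eventually_lt (c2.sub c1) hc1
  have ev2 : ∀ᶠ p in 𝓝 p₀, 0 < k₂ p - k₁ p - c - 2 * (c * k₂ p) :=
    continuousAt_const.eventually_lt (((c2.sub c1).sub continuousAt_const).sub
      (continuousAt_const.mul (continuousAt_const.mul c2))) (by simpa using hc2)
  have ev3 : ∀ᶠ p in 𝓝 p₀, 0 < 1 + 2 * k₂ p :=
    continuousAt_const.eventually_lt (continuousAt_const.add (continuousAt_const.mul c2)) L3
  have ev4 : ∀ᶠ p in 𝓝 p₀, 0 < μ p :=
    continuousAt_const.eventually_lt c3 (by rw [e3]; norm_num)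
  have ev4' : ∀ᶠ p in 𝓝 p₀, μ p < 2 :=
    c3.eventually_lt continuousAt_const (by rw [e3]; norm_num)
  have evN : ∀ᶠ p in 𝓝 p₀, kN p < c / 4 :=
    cN.eventually_lt continuousAt_const (by rw [eN]; positivity)
  have ev5 : ∀ᶠ p : ℝ × ℝ × ℝ × ℝ in 𝓝 p₀,
      0 < (p.1 + p.2.1) * p.2.2.1 + -(p.1 * p.2.1) :=
    continuousAt_const.eventually_lt (by fun_prop) (by simp only [hp₀]; norm_num)
  have ev6 : ∀ᶠ p : ℝ × ℝ × ℝ × ℝ in 𝓝 p₀, 0 < b * p.2.2.1 + (p.1 - b * p.1 - b * p.2.1) :=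
    continuousAt_const.eventually_lt (by fun_prop) (by simp only [hp₀]; linarith)
  have ev7 : ∀ᶠ p : ℝ × ℝ × ℝ × ℝ in 𝓝 p₀,
      0 < (p.1 + p.2.1 - b * p.2.1) * p.2.2.1 + -(p.1 * p.2.1) :=
    continuousAt_const.eventually_lt (by fun_prop) (by simp only [hp₀]; linarith)
  filter_upwards [ev0, ev2, ev3, ev4, ev4', evN, ev5, ev6, ev7] with
    p h0 h2 h3 h4 h4' hN h5 h6 h7 θ
  obtain ⟨hx0, hx2⟩ := one_sub_cos_mem θ
  obtain ⟨u, v, r, h⟩ := p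
  simp only at h5 h6 h7 ⊢
  set x := 1 - Real.cos θ
  set z := diamCircle h r θ with hz
  have f0 : _ = _ * (1 + kN (u, v, r, h) * x) := norm_sq_affine_diamCircle_eq_mul h5.ne' θ
  have f1 : _ = _ * (1 + k₁ (u, v, r, h) * x) := norm_sq_affine_diamCircle_eq_mul h6.ne' θ
  have f2 : _ = _ * (1 + k₂ (u, v, r, h) * x) := norm_sq_affine_diamCircle_eq_mul h7.ne' θ
  rw [← hz] at f0 f1 f2
  clear_value kN k₁ k₂ z x
  have hkN0 : 0 ≤ 1 + kN (u, v, r, h) * x :=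
    nonneg_of_mul_nonneg_right (f0 ▸ sq_nonneg _) (by positivity)
  have hk1 : 0 ≤ 1 + k₁ (u, v, r, h) * x :=
    nonneg_of_mul_nonneg_right (f1 ▸ sq_nonneg _) (by positivity)
  have main := rpow_mul_div_le_exp (c := c) (k₀ := 0) hx0 hx2 h4.le le_rfl (by norm_num) hk1 h3
    (by linarith) (by linarith)
  rw [zero_mul, sub_zero, Real.one_rpow, one_mul] at main
  have mainN : (1 + kN (u, v, r, h) * x) ^ μ (u, v, r, h) ≤ Real.exp (c / 2 * x) := by
    calc (1 + kN (u, v, r, h) * x) ^ μ (u, v, r, h)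
        ≤ Real.exp (c / 4 * x) ^ μ (u, v, r, h) := by
          refine Real.rpow_le_rpow hkN0 ?_ h4.le
          linarith [Real.add_one_le_exp (c / 4 * x), mul_le_mul_of_nonneg_right hN.le hx0]
      _ = Real.exp (c / 4 * x * μ (u, v, r, h)) := by rw [← Real.exp_mul]
      _ ≤ _ := by
          refine Real.exp_le_exp.2 ?_
          linarith [mul_le_mul_of_nonneg_left h4'.le (by positivity : 0 ≤ c / 4 * x)]
  refine le_mul_exp_of_sq_le (by positivity) ?_
  have hr : ((b * r + (u - b * u - b * v)) ^ 2 / ((u + v - b * v) * r + -(u * v)) ^ 2) =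
      ‖(b : ℂ) * r + (u - b * u - b * v : ℝ)‖ ^ 2 /
        ‖((u + v - b * v : ℝ) : ℂ) * r + (-(u * v) : ℝ)‖ ^ 2 := by
    simp only [← Complex.ofReal_mul, ← Complex.ofReal_add, Complex.norm_real, Real.norm_eq_abs,
      sq_abs]
  have hNr : ‖poleNum u v r‖ = (u + v) * r + -(u * v) := by
    rw [poleNum_eq_affine, ← Complex.ofReal_mul, ← Complex.ofReal_add, Complex.norm_real,
      Real.norm_eq_abs, abs_of_pos h5]
  rw [mul_pow, mul_pow, norm_hopPair_sq, norm_hopPair_sq, ← hr, f1, f2, hNr,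
    ← Real.rpow_mul_natCast (norm_nonneg _), ← Real.rpow_mul_natCast h5.le,
    mul_comm (speed b u v), Real.rpow_natCast_mul
    (norm_nonneg _), Real.rpow_natCast_mul h5.le, poleNum_eq_affine, f0,
    Real.mul_rpow (sq_nonneg _) hkN0]
  calc _ = (((u + v) * r + -(u * v)) ^ 2) ^ speed b u v * ((hopCoef b u v ^ 2 * u) ^ 2 *
      ((b * r + (u - b * u - b * v)) ^ 2 / ((u + v - b * v) * r + -(u * v)) ^ 2)) *
      ((1 + kN (u, v, r, h) * x) ^ speed b u v *
        ((1 + k₁ (u, v, r, h) * x) / (1 + k₂ (u, v, r, h) * x))) := by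
        rw [mul_div_mul_comm]
        ring
    _ ≤ (((u + v) * r + -(u * v)) ^ 2) ^ speed b u v * ((hopCoef b u v ^ 2 * u) ^ 2 *
      ((b * r + (u - b * u - b * v)) ^ 2 / ((u + v - b * v) * r + -(u * v)) ^ 2)) *
      (Real.exp (c / 2 * x) * Real.exp (-(c * x))) := by
      refine mul_le_mul_of_nonneg_left ?_ (by positivity)
      refine mul_le_mul mainN main (div_nonneg hk1 ?_) (Real.exp_pos _).le
      rcases hx2.lt_or_eq with h | h
      · linarith [mul_nonneg hx0 h3.le]
      · rw [h]; linarith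
    _ = _ := by
      rw [← Real.exp_add]
      ring_nf

/-- On the real axis near `1` the normalised symbol is quadratically close to `1`. -/
theorem rpow_speed_mul_norm_hop_le (hb : b ∈ Ioo (0 : ℝ) 1) {u v r : ℝ} (hu : 1 ≤ u)
    (hv : v ≤ 1) (hr : |r - 1| ≤ (1 - b) / 2) :
    r ^ speed b u v * ‖hop b u v r‖ ≤ Real.exp (2 / (1 - b) ^ 2 * (r - 1) ^ 2) := by
  obtain ⟨hb0, hb1⟩ := hb
  have hb' : 0 < 1 - b := by linarith
  obtain ⟨hr1, hr2⟩ := abs_le.1 hr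
  have hr0 : 0 < r := by linarith
  have hbv : 1 - b ≤ 1 - b * v := by nlinarith
  have hbv0 : 0 < 1 - b * v := by linarith
  set D := b + (u - b * u - b * v) with hD
  have hD1 : 1 - b ≤ D := by nlinarith
  have hD0 : 0 < D := by linarith
  set y := r - 1 with hy
  set l := 1 / (1 - b * v) with hl
  set k := b / D with hk
  have hl0 : 0 < l := by positivity
  have hl1 : l ≤ 1 / (1 - b) := one_div_le_one_div_of_le hb' hbv
  have hk0 : 0 ≤ k := by positivity
  have hk1 : k ≤ 1 / (1 - b) := by
    rw [hk, div_le_div_iff₀ hD0 hb']; nlinarith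
  -- The speed is minus the logarithmic derivative at `1` of `(1 + k y) / (1 + l y)`. The linear
  -- terms in the exponent therefore cancel, and `2 l² y²` is left.
  have hμ : speed b u v = l - k := by
    unfold speed
    rw [hl, hk, div_sub_div _ _ hbv0.ne' hD0.ne', ← hD, mul_comm D]
    congr 1
    rw [hD]
    ring
  have hμ0 : 0 ≤ speed b u v := by
    unfold speed
    exact div_nonneg (mul_nonneg hb'.le (by nlinarith)) (mul_nonneg hD0.le hbv0.le)
  have hly : |l * y| ≤ 1 / 2 := by
    rw [abs_mul, abs_of_pos hl0]
    calc l * |y| ≤ 1 / (1 - b) * ((1 - b) / 2) := by gcongr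
      _ = 1 / 2 := by field_simp
  have hky : |k * y| ≤ 1 / 2 := by
    rw [abs_mul, abs_of_nonneg hk0]
    calc k * |y| ≤ 1 / (1 - b) * ((1 - b) / 2) := by gcongr
      _ = 1 / 2 := by field_simp
  obtain ⟨hly1, hly2⟩ := abs_le.1 hly
  obtain ⟨hky1, hky2⟩ := abs_le.1 hky
  have hhop : hop b u v r = (((1 + k * y) / (1 + l * y) : ℝ) : ℂ) := by
    have e1 : b * r + (u - b * u - b * v) = D * (1 + k * y) := by
      rw [hk, hy]; field_simp; rw [hD]; ring
    have e2 : r - b * v = (1 - b * v) * (1 + l * y) := by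
      rw [hl, hy]; field_simp; ring
    unfold hop hopCoef
    rw [← Complex.ofReal_mul, ← Complex.ofReal_add, ← Complex.ofReal_sub, ← Complex.ofReal_div,
      ← Complex.ofReal_mul, e1, e2, ← hD]
    congr 1
    have : 1 + l * y ≠ 0 := by linarith
    field_simp
  rw [hhop, Complex.norm_real, Real.norm_eq_abs, abs_of_nonneg (div_nonneg (by linarith)
    (by linarith))]
  have h1 : r ^ speed b u v ≤ Real.exp (y * speed b u v) := by
    rw [Real.exp_mul]
    refine Real.rpow_le_rpow hr0.le ?_ hμ0
    have := Real.add_one_le_exp y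
    linarith
  have h2 : 1 + k * y ≤ Real.exp (k * y) := by linarith [Real.add_one_le_exp (k * y)]
  have h3 : (1 + l * y)⁻¹ ≤ Real.exp (-(l * y) + 2 * (l * y) ^ 2) := by
    refine le_trans ?_ (Real.add_one_le_exp _)
    rw [inv_le_iff_one_le_mul₀ (by linarith)]
    nlinarith [sq_nonneg (l * y)]
  calc r ^ speed b u v * ((1 + k * y) / (1 + l * y))
      ≤ Real.exp (y * speed b u v) * (Real.exp (k * y) *
        Real.exp (-(l * y) + 2 * (l * y) ^ 2)) := by
        rw [div_eq_mul_inv]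
        have : 0 ≤ (1 + l * y)⁻¹ := inv_nonneg.2 (by linarith)
        exact mul_le_mul h1 (mul_le_mul h2 h3 this (Real.exp_pos _).le)
          (mul_nonneg (by linarith) this) (Real.exp_pos _).le
    _ = Real.exp (2 * l ^ 2 * y ^ 2) := by
        rw [← Real.exp_add, ← Real.exp_add, hμ]
        ring_nf
    _ ≤ _ := by
        refine Real.exp_le_exp.2 ?_
        gcongr
        calc 2 * l ^ 2 ≤ 2 * (1 / (1 - b)) ^ 2 := by gcongr
          _ = 2 / (1 - b) ^ 2 := by field_simp

end S6V

/-! ### Contours near the degenerate point -/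

namespace S6V

open Set Metric Function Filter Topology

variable {b : ℝ}

/-- The estimates on the contours used near the degenerate point `u = v = r = 1`: the symbols decay
away from the right end `r`, and the circles with diameters `[±h, r]` separate the poles. -/
structure ContourBounds (b c h u v r : ℝ) : Prop where
  hop_concentric : ∀ θ, ‖diamCircle (-r) r θ‖ ^ speed b u v * ‖hop b u v (diamCircle (-r) r θ)‖ ≤
    r ^ speed b u v * ‖hop b u v r‖ * Real.exp (-(c * (1 - Real.cos θ)))
  hop_diam : ∀ θ, ‖diamCircle (-h) r θ‖ ^ speed b u v * ‖hop b u v (diamCircle (-h) r θ)‖ ≤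
    r ^ speed b u v * ‖hop b u v r‖ * Real.exp (-(c * (1 - Real.cos θ)))
  pair_diam : ∀ h', h' = h ∨ h' = -h → ∀ θ,
    ‖poleNum u v (diamCircle h' r θ)‖ ^ speed b u v * ‖hopPair b u v (diamCircle h' r θ)‖ ≤
      ‖poleNum u v r‖ ^ speed b u v * ‖hopPair b u v r‖ * Real.exp (-(c * (1 - Real.cos θ)))
  poleMap_diam : ∀ h', h' = h ∨ h' = -h →
    ((u + v) * (r + h') - 2 * (u * v)) * (u + v) ≤ (u + v - u * v / r) ^ 2 * (r + h')
  poleNum_pos : 0 ≤ (u + v) * (r + h) - 2 * (u * v)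
  poleNum_neg : (u + v) * (r + -h) - 2 * (u * v) ≤ 0
  hop_pole : h < b * v ∧ b * v < r
  num_zero : h * (u + v) < u * v ∧ u * v < (u + v) * r
  pair_pole : h * (u + v - b * v) < u * v ∧ u * v < (u + v - b * v) * r
  h_lt : h < r

/-- All geometric conditions are strict inequalities at `u = v = r = 1` for a fixed small `h > 0`,
hence stable. The order of choices matters: `h` first, inside the neighbourhood where the diameter
circles work for both `h` and `-h`, then `δ`. -/
theorem exists_contourBounds (hb : b ∈ Ioo (0 : ℝ) 1) :
    ∃ c > 0, ∃ h > 0, ∃ δ > 0, ∀ u v r : ℝ, |u - 1| < δ → |v - 1| < δ → |r - 1| < δ →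
      ContourBounds b c h u v r := by
  obtain ⟨c₁, hc₁, H₁⟩ := eventually_norm_hop_le hb (h₀ := -1) (Or.inr rfl)
  obtain ⟨c₂, hc₂, H₂⟩ := eventually_norm_hop_le hb (h₀ := 0) (Or.inl rfl)
  obtain ⟨c₃, hc₃, H₃⟩ := eventually_norm_hopPair_le hb
  obtain ⟨hb0, hb1⟩ := hb
  obtain ⟨δ₁, hδ₁, H₁⟩ := Metric.eventually_nhds_iff.1 H₁
  obtain ⟨δ₂, hδ₂, H₂⟩ := Metric.eventually_nhds_iff.1 (H₂.and H₃)
  -- `h < b` keeps the pole `b v` inside the diameter, and `h < 1/3` is what the comparison of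
  -- slopes for `poleMap` requires in the limit.
  set h := min (δ₂ / 2) (min (b / 4) (1 / 4)) with hh
  have hh0 : 0 < h := by positivity
  have hhδ : h < δ₂ := (min_le_left _ _).trans_lt (by linarith)
  have hhb : h ≤ b / 4 := (min_le_right _ _).trans (min_le_left _ _)
  have hh4 : h ≤ 1 / 4 := (min_le_right _ _).trans (min_le_right _ _)
  have E : ∀ᶠ p : ℝ × ℝ × ℝ in 𝓝 (1, 1, 1), h < p.2.2 ∧ (h < b * p.2.1 ∧ b * p.2.1 < p.2.2) ∧
      (h * (p.1 + p.2.1) < p.1 * p.2.1 ∧ p.1 * p.2.1 < (p.1 + p.2.1) * p.2.2) ∧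
      (h * (p.1 + p.2.1 - b * p.2.1) < p.1 * p.2.1 ∧
        p.1 * p.2.1 < (p.1 + p.2.1 - b * p.2.1) * p.2.2) ∧
      (0 < (p.1 + p.2.1) * (p.2.2 + h) - 2 * (p.1 * p.2.1) ∧
        (p.1 + p.2.1) * (p.2.2 + -h) - 2 * (p.1 * p.2.1) < 0) ∧
      (((p.1 + p.2.1) * (p.2.2 + h) - 2 * (p.1 * p.2.1)) * (p.1 + p.2.1) <
        (p.1 + p.2.1 - p.1 * p.2.1 / p.2.2) ^ 2 * (p.2.2 + h)) ∧
      (((p.1 + p.2.1) * (p.2.2 + -h) - 2 * (p.1 * p.2.1)) * (p.1 + p.2.1) <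
        (p.1 + p.2.1 - p.1 * p.2.1 / p.2.2) ^ 2 * (p.2.2 + -h)) := by
    set p₀ : ℝ × ℝ × ℝ := (1, 1, 1) with hp₀
    have h2b : h * (2 - b) < 1 := by nlinarith
    have hne : p₀.2.2 ≠ 0 := by simp [hp₀]
    refine .and ?_ (.and (.and ?_ ?_) (.and (.and ?_ ?_) (.and (.and ?_ ?_)
      (.and (.and ?_ ?_) (.and ?_ ?_))))) <;>
    refine ContinuousAt.eventually_lt (by fun_prop (disch := assumption))
      (by fun_prop (disch := assumption)) ?_ <;>
    simp only [hp₀] <;> norm_num <;> linarith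
  obtain ⟨δ₃, hδ₃, H₃⟩ := Metric.eventually_nhds_iff.1 E
  refine ⟨min c₁ (min c₂ c₃), by positivity, h, hh0, min δ₁ (min δ₂ δ₃), by positivity,
    fun u v r hu hv hr => ?_⟩
  have le₁ : min δ₁ (min δ₂ δ₃) ≤ δ₁ := min_le_left _ _
  have le₂ : min δ₁ (min δ₂ δ₃) ≤ δ₂ := (min_le_right _ _).trans (min_le_left _ _)
  have le₃ : min δ₁ (min δ₂ δ₃) ≤ δ₃ := (min_le_right _ _).trans (min_le_right _ _)
  have cexp : ∀ c', min c₁ (min c₂ c₃) ≤ c' → ∀ θ : ℝ, Real.exp (-(c' * (1 - Real.cos θ))) ≤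
      Real.exp (-(min c₁ (min c₂ c₃) * (1 - Real.cos θ))) := by
    intro c' hc' θ
    have := (one_sub_cos_mem θ).1
    gcongr
  obtain ⟨hr', hp, hn, hq, hs, ha, ha'⟩ := @H₃ (u, v, r) (by
    simp only [Prod.dist_eq, Real.dist_eq, max_lt_iff]
    exact ⟨by linarith, by linarith, by linarith⟩)
  have G₁ := @H₁ (u, v, r, -r) (by
    simp only [Prod.dist_eq, Real.dist_eq, max_lt_iff]
    refine ⟨by linarith, by linarith, by linarith, ?_⟩
    rw [show -r - -1 = -(r - 1) by ring, abs_neg]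
    linarith)
  have dist₂ : ∀ h', h' = h ∨ h' = -h → dist (u, v, r, h') (1, 1, 1, (0 : ℝ)) < δ₂ := by
    intro h' hh'
    simp only [Prod.dist_eq, Real.dist_eq, max_lt_iff]
    refine ⟨by linarith, by linarith, by linarith, ?_⟩
    rw [sub_zero]
    rcases hh' with rfl | rfl
    · rw [abs_of_pos hh0]; exact hhδ
    · rw [abs_neg, abs_of_pos hh0]; exact hhδ
  simp only at hr' hp hn hq hs ha ha'
  have hr0 : 0 < r := hh0.trans hr'
  refine ⟨fun θ => ?_, fun θ => ?_, fun h' hh' θ => ?_, ?_, hs.1.le, hs.2.le, hp, hn, hq, hr'⟩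
  · refine (G₁ (by simp [abs_of_pos hr0]) θ).trans ?_
    exact mul_le_mul_of_nonneg_left (cexp c₁ (min_le_left _ _) θ) (by simp only; positivity)
  · refine ((H₂ (dist₂ (-h) (Or.inr rfl))).1 ?_ θ).trans ?_
    · simp only [abs_neg, abs_of_pos hh0]; exact hr'.le
    · exact mul_le_mul_of_nonneg_left (cexp c₂ ((min_le_right _ _).trans (min_le_left _ _)) θ)
        (by simp only; positivity)
  · refine ((H₂ (dist₂ h' hh')).2 θ).trans ?_
    exact mul_le_mul_of_nonneg_left (cexp c₃ ((min_le_right _ _).trans (min_le_right _ _)) θ)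
      (by simp only; positivity)
  · rintro h' (rfl | rfl)
    exacts [ha.le, ha'.le]

/-! ### Extremal moduli on the circles with diameters `[±h, r]`. -/

section Geometry

variable {c h u v r : ℝ}

theorem norm_diamCircle_le {h' : ℝ} (hr : |h'| ≤ r) (θ : ℝ) : ‖diamCircle h' r θ‖ ≤ r := by
  obtain ⟨h1, h2⟩ := abs_le.1 hr
  refine le_of_sq_le_sq ?_ ((abs_nonneg _).trans hr)
  rw [norm_sq_diamCircle]
  have := mul_nonneg (mul_nonneg (by linarith : 0 ≤ r + h') (by linarith : 0 ≤ r - h'))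
    (one_sub_cos_mem θ).1
  linarith

theorem le_norm_diamCircle {h' : ℝ} (hr : |h'| ≤ r) (θ : ℝ) : |h'| ≤ ‖diamCircle h' r θ‖ := by
  obtain ⟨h1, h2⟩ := abs_le.1 hr
  refine le_of_sq_le_sq ?_ (norm_nonneg _)
  rw [norm_sq_diamCircle, sq_abs]
  have := mul_nonneg (mul_nonneg (by linarith : 0 ≤ r + h') (by linarith : 0 ≤ r - h'))
    (by linarith [(one_sub_cos_mem θ).2] : 0 ≤ 2 - (1 - Real.cos θ))
  linarith

theorem norm_diamCircle_neg (hr : 0 ≤ r) (θ : ℝ) : ‖diamCircle (-r) r θ‖ = r := by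
  have habs : |-r| ≤ r := by rw [abs_neg, abs_of_nonneg hr]
  refine le_antisymm (norm_diamCircle_le habs θ) ?_
  have := le_norm_diamCircle habs θ
  rwa [abs_neg, abs_of_nonneg hr] at this

theorem diamCircle_neg (r θ : ℝ) : diamCircle (-r) r θ = circleMap 0 r θ := by
  unfold diamCircle
  congr 1
  · simp
  · ring

theorem norm_diamCircle_sub {h' : ℝ} (hr : |h'| ≤ r) (θ : ℝ) :
    ‖diamCircle h' r θ - r‖ ≤ r * √(2 * (1 - Real.cos θ)) := by
  obtain ⟨h1, h2⟩ := abs_le.1 hr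
  have h3 := norm_circleMap_sub_right_end ((r + h') / 2) ((r - h') / 2) θ
  have h0 := (one_sub_cos_mem θ).1
  rw [show (r + h') / 2 + (r - h') / 2 = r by ring] at h3
  refine le_of_sq_le_sq ?_ (by have := (abs_nonneg _).trans hr; positivity)
  rw [diamCircle, h3, mul_pow, Real.sq_sqrt (by positivity)]
  nlinarith [mul_nonneg (mul_nonneg (by linarith : 0 ≤ r + h')
    (by linarith : 0 ≤ 3 * r - h')) h0]

/-- The squared moduli of `poleNum z` and `z` are affine in `1 - cos θ`, and `poleMap_diam` compares
their slopes, so the modulus of the quotient is smallest at the right end. -/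
theorem ContourBounds.le_norm_poleMap (H : ContourBounds b c h u v r) (h0 : 0 < h) {h' : ℝ}
    (hh' : h' = h ∨ h' = -h) (θ : ℝ) :
    u + v - u * v / r ≤ ‖poleMap u v (diamCircle h' r θ)‖ := by
  have hr0 : 0 < r := h0.trans H.h_lt
  have habs : |h'| = h := by rcases hh' with rfl | rfl <;> simp [abs_of_pos h0]
  have hlt := H.h_lt
  obtain ⟨h1, h2⟩ := abs_le.1 (habs.trans_le hlt.le)
  set z := diamCircle h' r θ with hz
  have hz0 : 0 < ‖z‖ := h0.trans_le (habs ▸ le_norm_diamCircle (habs.trans_le hlt.le) θ)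
  have hN : ‖poleNum u v z‖ ^ 2 = ((u + v) * r + -(u * v)) ^ 2 -
      ((u + v) * (r + h') + 2 * -(u * v)) * ((u + v) * (r - h')) / 2 * (1 - Real.cos θ) := by
    rw [poleNum_eq_affine, hz, norm_sq_affine_diamCircle]
  refine le_of_sq_le_sq ?_ (norm_nonneg _)
  rw [poleMap_eq_div (norm_pos_iff.1 hz0), norm_div, div_pow, le_div_iff₀ (by positivity), hN, hz,
    norm_sq_diamCircle]
  have e : (u + v) * r + -(u * v) = (u + v - u * v / r) * r := by field_simp; ring
  rw [e]
  have := mul_le_mul_of_nonneg_right (H.poleMap_diam h' hh')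
    (mul_nonneg (by linarith : 0 ≤ r - h') (one_sub_cos_mem θ).1)
  linarith

theorem norm_poleNum_ofReal (hr : 0 < r) (h : u * v < (u + v) * r) :
    ‖poleNum u v r‖ = r * (u + v - u * v / r) := by
  rw [poleNum_eq_affine, ← Complex.ofReal_mul, ← Complex.ofReal_add, Complex.norm_real,
    Real.norm_eq_abs, abs_of_pos (by linarith)]
  field_simp
  ring

/-- The sign of the slope decides: with left end `h` the modulus of `poleNum` is largest at `r`,
with left end `-h` it is smallest there. The first controls nonnegative powers of `poleNum`, the
second nonpositive ones. -/
theorem ContourBounds.norm_poleNum_le (H : ContourBounds b c h u v r) (h0 : 0 < h)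
    (huv : 0 ≤ u + v) (θ : ℝ) :
    ‖poleNum u v (diamCircle h r θ)‖ ≤ r * (u + v - u * v / r) := by
  have hr0 : 0 < r := h0.trans H.h_lt
  have hlt := H.h_lt
  refine le_of_sq_le_sq ?_ ?_
  · rw [poleNum_eq_affine, norm_sq_affine_diamCircle]
    have e : (u + v) * r + -(u * v) = r * (u + v - u * v / r) := by field_simp; ring
    rw [e]
    have := mul_nonneg (mul_nonneg H.poleNum_pos (mul_nonneg huv (by linarith : 0 ≤ r - h)))
      (one_sub_cos_mem θ).1
    linarith
  · rw [← norm_poleNum_ofReal hr0 H.num_zero.2]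
    positivity

theorem ContourBounds.le_norm_poleNum (H : ContourBounds b c h u v r) (h0 : 0 < h)
    (huv : 0 ≤ u + v) (θ : ℝ) :
    r * (u + v - u * v / r) ≤ ‖poleNum u v (diamCircle (-h) r θ)‖ := by
  have hr0 : 0 < r := h0.trans H.h_lt
  have hlt := H.h_lt
  refine le_of_sq_le_sq ?_ (norm_nonneg _)
  rw [poleNum_eq_affine, norm_sq_affine_diamCircle]
  have e : (u + v) * r + -(u * v) = r * (u + v - u * v / r) := by field_simp; ring
  rw [e]
  have := mul_nonneg (mul_nonneg (neg_nonneg.2 H.poleNum_neg)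
    (mul_nonneg huv (by linarith : 0 ≤ r - -h))) (one_sub_cos_mem θ).1
  linarith

/-- A real point inside the diameter is not outside the disc. -/
theorem ne_ofReal_of_le_norm_sub {h' y : ℝ} {z : ℂ} (h1 : h' < y) (h2 : y < r)
    (hz : (r - h') / 2 ≤ ‖z - ((r + h') / 2 : ℝ)‖) : z ≠ y := by
  rintro rfl
  rw [← Complex.ofReal_sub, Complex.norm_real, Real.norm_eq_abs] at hz
  have : |y - (r + h') / 2| < (r - h') / 2 := abs_lt.2 ⟨by linarith, by linarith⟩
  linarith

/-- Both `u v / (u + v)` and `u v / (u + v - b v)` lie inside the diameter. The origin may lie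
outside, so regularity there must come from the gap `n₁ - n₂`. -/
theorem ContourBounds.differentiableAt_residueWave (H : ContourBounds b c h u v r) (h0 : 0 < h)
    (huv : 0 < u + v) (hub : 0 < u + v - b * v) {h' : ℝ}
    (hh' : h' = h ∨ h' = -h) {n₁ n₂ : ℤ} {j₁ j₂ t : ℕ} (hn : (j₂ : ℤ) + 2 ≤ n₁ - n₂) {z : ℂ}
    (hz : (r - h') / 2 ≤ ‖z - ((r + h') / 2 : ℝ)‖) :
    DifferentiableAt ℂ (residueWave b u v n₁ n₂ j₁ j₂ t) z := by
  have hle : h' ≤ h := by rcases hh' with rfl | rfl <;> linarith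
  refine S6V.differentiableAt_residueWave (Or.inr hn) (Or.inl ?_) ?_
  · have h1 : h' < u * v / (u + v) :=
      hle.trans_lt ((lt_div_iff₀ huv).2 H.num_zero.1)
    have h2 : u * v / (u + v) < r := (div_lt_iff₀ huv).2 (by linarith [H.num_zero.2])
    have := ne_ofReal_of_le_norm_sub h1 h2 hz
    intro h3
    apply this
    have huv' : (u : ℂ) + v ≠ 0 := by exact_mod_cast huv.ne'
    push_cast
    rw [eq_div_iff huv']
    unfold poleNum at h3
    linear_combination h3
  · have h1 : h' < u * v / (u + v - b * v) :=
      hle.trans_lt ((lt_div_iff₀ hub).2 H.pair_pole.1)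
    have h2 : u * v / (u + v - b * v) < r := (div_lt_iff₀ hub).2 (by linarith [H.pair_pole.2])
    have := ne_ofReal_of_le_norm_sub h1 h2 hz
    intro h3
    apply this
    have hub' : ((u + v - b * v : ℝ) : ℂ) ≠ 0 := by exact_mod_cast hub.ne'
    rw [Complex.ofReal_div, eq_div_iff hub']
    linear_combination h3

end Geometry

end S6V

/-! ### Gaussian bounds on the contours -/

namespace S6V

open Set Metric Function Filter Topology

variable {b : ℝ}

/-- On `[-π, π]` one has `1 - cos θ ≥ 2 θ² / π²`, so a Gaussian integral dominates; its constant
`√(π³ / 2)` is below `4`. -/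
theorem integral_exp_cos_le {a : ℝ} (ha : 0 < a) :
    ∫ θ in (0 : ℝ)..2 * Real.pi, Real.exp (-(a * (1 - Real.cos θ))) ≤ 4 / √a := by
  have hper : Function.Periodic (fun θ : ℝ => Real.exp (-(a * (1 - Real.cos θ))))
      (2 * Real.pi) := fun θ => by simp only [Real.cos_add_two_pi]
  have hπ := Real.pi_pos
  have h1 := hper.intervalIntegral_add_eq 0 (-Real.pi)
  rw [zero_add, show -Real.pi + 2 * Real.pi = Real.pi by ring] at h1
  have hg := integrable_exp_neg_mul_sq (b := a * (2 / Real.pi ^ 2)) (by positivity)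
  have hle : -Real.pi ≤ Real.pi := by linarith
  rw [h1, intervalIntegral.integral_of_le hle]
  calc ∫ θ in Ioc (-Real.pi) Real.pi, Real.exp (-(a * (1 - Real.cos θ)))
      ≤ ∫ θ in Ioc (-Real.pi) Real.pi, Real.exp (-(a * (2 / Real.pi ^ 2)) * θ ^ 2) := by
        refine MeasureTheory.setIntegral_mono_on ?_ hg.integrableOn measurableSet_Ioc
          fun θ hθ => Real.exp_le_exp.2 ?_
        · exact ((Continuous.integrableOn_Icc (by fun_prop)).mono_set Ioc_subset_Icc_self)
        · have := Real.cos_le_one_sub_mul_cos_sq (abs_le.2 ⟨hθ.1.le, hθ.2⟩)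
          nlinarith
    _ ≤ ∫ θ, Real.exp (-(a * (2 / Real.pi ^ 2)) * θ ^ 2) :=
        MeasureTheory.setIntegral_le_integral hg
          (Filter.Eventually.of_forall fun θ => (Real.exp_pos _).le)
    _ = √(Real.pi / (a * (2 / Real.pi ^ 2))) := integral_gaussian _
    _ = √(Real.pi ^ 3 / 2) / √a := by
        rw [← Real.sqrt_div (by positivity)]
        congr 1
        field_simp
    _ ≤ 4 / √a := by
        gcongr
        rw [Real.sqrt_le_left (by norm_num)]
        have h3 : Real.pi ≤ 3.1416 := Real.pi_lt_d4.le
        have : Real.pi ^ 3 ≤ 3.1416 ^ 3 := by gcongr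
        norm_num at this ⊢
        linarith

/-- The rescaled angle `√(t (1 - cos θ))`. -/
noncomputable def ang (t : ℕ) (θ : ℝ) : ℝ := √(t * (1 - Real.cos θ))

theorem ang_nonneg (t : ℕ) (θ : ℝ) : 0 ≤ ang t θ := Real.sqrt_nonneg _

theorem ang_sq (t : ℕ) (θ : ℝ) : ang t θ ^ 2 = t * (1 - Real.cos θ) :=
  Real.sq_sqrt (mul_nonneg t.cast_nonneg (one_sub_cos_mem θ).1)

theorem sqrt_one_sub_cos {t : ℕ} (ht : 1 ≤ t) (θ : ℝ) :
    √(1 - Real.cos θ) = ang t θ * (√(t : ℝ))⁻¹ := by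
  have : 0 < √(t : ℝ) := Real.sqrt_pos.2 (by exact_mod_cast ht)
  rw [ang, Real.sqrt_mul t.cast_nonneg]
  field_simp

theorem pow_mul_exp_neg_sq_le {c s : ℝ} (hc : 0 < c) (hs : 0 ≤ s) (k : ℕ) :
    (1 + s) ^ k * Real.exp (-(c * s ^ 2)) ≤
      Real.exp ((k : ℝ) ^ 2 / (2 * c)) * Real.exp (-(c / 2 * s ^ 2)) := by
  have h1 : (1 + s) ^ k ≤ Real.exp (k * s) := by
    rw [Real.exp_nat_mul]
    gcongr
    linarith [Real.add_one_le_exp s]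
  calc (1 + s) ^ k * Real.exp (-(c * s ^ 2)) ≤ Real.exp (k * s) * Real.exp (-(c * s ^ 2)) := by
        gcongr
    _ = Real.exp (k * s + -(c * s ^ 2)) := (Real.exp_add _ _).symm
    _ ≤ Real.exp ((k : ℝ) ^ 2 / (2 * c) + -(c / 2 * s ^ 2)) := by
        refine Real.exp_le_exp.2 ?_
        have : (k : ℝ) * s ≤ (k : ℝ) ^ 2 / (2 * c) + c / 2 * s ^ 2 := by
          rw [div_add' _ _ _ (by positivity), le_div_iff₀ (by positivity)]
          nlinarith [sq_nonneg ((k : ℝ) - c * s)]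
        linarith
    _ = _ := Real.exp_add _ _

/-- The constant in `norm_circleIntegral_le_gauss`. -/
noncomputable def gaussConst (c : ℝ) (k : ℕ) : ℝ :=
  2 * (Real.exp ((k : ℝ) ^ 2 / (2 * c)) * (4 / √(c / 2)))

theorem gaussConst_pos {c : ℝ} (hc : 0 < c) (k : ℕ) : 0 < gaussConst c k := by
  unfold gaussConst
  positivity

/-- The source of one factor `t^(-1/2)` per integration. Half of the Gaussian absorbs the polynomial
in the rescaled angle, and the other half is integrated. -/
theorem norm_circleIntegral_le_gauss {f : ℂ → ℂ} {m : ℂ} {ρ c K : ℝ} {t k : ℕ} (hρ : 0 ≤ ρ)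
    (hρ2 : ρ ≤ 2) (hc : 0 < c) (ht : 1 ≤ t) (hK : 0 ≤ K)
    (h : ∀ θ, ‖f (circleMap m ρ θ)‖ ≤ K * (1 + ang t θ) ^ k * Real.exp (-(c * ang t θ ^ 2))) :
    ‖∮ z in C(m, ρ), f z‖ ≤ gaussConst c k * K * (√(t : ℝ))⁻¹ := by
  have ht0 : (0 : ℝ) < t := by exact_mod_cast ht
  have hb : ∀ θ, ‖f (circleMap m ρ θ)‖ ≤ K * Real.exp ((k : ℝ) ^ 2 / (2 * c)) *
      Real.exp (-(c / 2 * t * (1 - Real.cos θ))) := by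
    intro θ
    refine (h θ).trans ?_
    have := mul_le_mul_of_nonneg_left (pow_mul_exp_neg_sq_le hc (ang_nonneg t θ) k) hK
    rwa [← mul_assoc, ← mul_assoc, ang_sq t θ, ← mul_assoc (c / 2), ← ang_sq t θ] at this
  refine (norm_circleIntegral_le_integral hρ (by fun_prop) hb).trans ?_
  rw [intervalIntegral.integral_const_mul]
  have hi := integral_exp_cos_le (a := c / 2 * t) (by positivity)
  have hi0 : 0 ≤ ∫ θ in (0 : ℝ)..2 * Real.pi, Real.exp (-(c / 2 * t * (1 - Real.cos θ))) :=
    intervalIntegral.integral_nonneg (by positivity) fun θ _ => (Real.exp_pos _).le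
  calc ρ * (K * Real.exp ((k : ℝ) ^ 2 / (2 * c)) *
        ∫ θ in (0 : ℝ)..2 * Real.pi, Real.exp (-(c / 2 * t * (1 - Real.cos θ))))
      ≤ 2 * (K * Real.exp ((k : ℝ) ^ 2 / (2 * c)) * (4 / √(c / 2 * t))) := by gcongr
    _ = _ := by
      rw [Real.sqrt_mul (by positivity), gaussConst]
      field_simp

/-- Pointwise control of the one-particle symbol at a point of a contour with rescaled angle `s`. -/
structure PointBound (b u v c Q E η : ℝ) (t : ℕ) (z : ℂ) (s : ℝ) : Prop where
  le_norm : η ≤ ‖z‖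
  dist : ‖z - 1‖ ≤ Q * (1 + s) * (√(t : ℝ))⁻¹
  symbol : (‖z‖ ^ speed b u v * ‖hop b u v z‖) ^ t ≤ E * Real.exp (-(c * s ^ 2))

/-- Splits off the drift: `(z^μ)^t` is to be joined with the `t`-th power of the symbol, while `z^(n
- μ t)` carries the decay in space. -/
theorem norm_zpow_eq {z : ℝ} (hz : 0 < z) (n : ℤ) (k : ℕ) (μ : ℝ) (t : ℕ) :
    z ^ (n - k) = z⁻¹ ^ k * (z ^ ((n : ℝ) - μ * t) * (z ^ μ) ^ t) := by
  rw [← Real.rpow_natCast (z ^ μ), ← Real.rpow_mul hz.le, ← Real.rpow_add hz, sub_add_cancel,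
    Real.rpow_intCast, zpow_sub₀ hz.ne', zpow_natCast, inv_pow]
  field_simp

theorem PointBound.norm_wave_le {u v c Q E η : ℝ} {t : ℕ} {z : ℂ} {s : ℝ}
    (h : PointBound b u v c Q E η t z s) (hη : 0 < η) (n : ℤ) (j : ℕ) :
    ‖wave b u v n j t z‖ ≤ η⁻¹ * ‖z‖ ^ ((n : ℝ) - speed b u v * t) *
      (Q * (1 + s) * (√(t : ℝ))⁻¹) ^ j * (E * Real.exp (-(c * s ^ 2))) := by
  have hz : 0 < ‖z‖ := hη.trans_le h.le_norm
  unfold wave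
  rw [norm_mul, norm_mul, norm_zpow, norm_pow, norm_pow,
    show n - 1 = n - ((1 : ℕ) : ℤ) by simp, norm_zpow_eq hz n 1 (speed b u v) t, pow_one]
  calc ‖z‖⁻¹ * (‖z‖ ^ ((n : ℝ) - speed b u v * t) * (‖z‖ ^ speed b u v) ^ t) * ‖z - 1‖ ^ j *
        ‖hop b u v z‖ ^ t
      = ‖z‖⁻¹ * ‖z‖ ^ ((n : ℝ) - speed b u v * t) * ‖z - 1‖ ^ j *
        (‖z‖ ^ speed b u v * ‖hop b u v z‖) ^ t := by rw [mul_pow]; ring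
    _ ≤ _ := by
      have h1 := h.le_norm
      have h2 := h.dist
      have h3 := h.symbol
      have h4 := (norm_nonneg _).trans h2
      have h5 : 0 ≤ η⁻¹ * ‖z‖ ^ ((n : ℝ) - speed b u v * t) := by positivity
      have h6 := mul_nonneg h5 (pow_nonneg h4 j)
      gcongr

theorem norm_diamCircle_sub_one_le {h' r Q₀ : ℝ} {t : ℕ} (ht : 1 ≤ t) (hr : |h'| ≤ r)
    (hr2 : r ≤ 2) (hQ : |r - 1| ≤ Q₀ * (√(t : ℝ))⁻¹) (θ : ℝ) :
    ‖diamCircle h' r θ - r‖ ≤ 2 * r * (1 + ang t θ) * (√(t : ℝ))⁻¹ ∧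
    ‖diamCircle h' r θ - 1‖ ≤ (Q₀ + 4) * (1 + ang t θ) * (√(t : ℝ))⁻¹ := by
  set w := (√(t : ℝ))⁻¹ with hw
  have hw0 : 0 ≤ w := by positivity
  have hr0 : 0 ≤ r := (abs_nonneg _).trans hr
  have hs := ang_nonneg t θ
  have h1 := norm_diamCircle_sub hr θ
  have h2 : √(2 : ℝ) ≤ 2 := by rw [Real.sqrt_le_left] <;> norm_num
  have h3 : ‖diamCircle h' r θ - r‖ ≤ 2 * r * (1 + ang t θ) * w := by
    rw [Real.sqrt_mul zero_le_two, sqrt_one_sub_cos ht] at h1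
    calc _ ≤ _ := h1
      _ ≤ r * (2 * ((1 + ang t θ) * w)) := by gcongr; linarith
      _ = _ := by ring
  refine ⟨h3, ?_⟩
  have hQ0 : 0 ≤ Q₀ * w := (abs_nonneg _).trans hQ
  have h4 : ‖diamCircle h' r θ - 1‖ ≤ ‖diamCircle h' r θ - r‖ + |r - 1| := by
    have : ‖(r : ℂ) - 1‖ = |r - 1| := by
      rw [← Complex.ofReal_one, ← Complex.ofReal_sub, Complex.norm_real, Real.norm_eq_abs]
    rw [← this]
    exact norm_sub_le_norm_sub_add_norm_sub _ _ _
  have h5 : 2 * r * (1 + ang t θ) * w ≤ 2 * 2 * (1 + ang t θ) * w := by gcongr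
  have h6 : Q₀ * w ≤ Q₀ * w * (1 + ang t θ) := le_mul_of_one_le_right hQ0 (by linarith)
  linarith

theorem exp_quadratic_pow_le {C y Q₀ : ℝ} {t : ℕ} (ht : 1 ≤ t) (hC : 0 ≤ C)
    (hQ : |y| ≤ Q₀ * (√(t : ℝ))⁻¹) : Real.exp (C * y ^ 2) ^ t ≤ Real.exp (C * Q₀ ^ 2) := by
  have ht0 : (0 : ℝ) < t := by exact_mod_cast ht
  rw [← Real.exp_nat_mul]
  refine Real.exp_le_exp.2 ?_
  have h1 : y ^ 2 ≤ (Q₀ * (√(t : ℝ))⁻¹) ^ 2 := by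
    rw [← sq_abs y]
    gcongr
  rw [mul_pow, inv_pow, Real.sq_sqrt ht0.le] at h1
  calc (t : ℝ) * (C * y ^ 2) ≤ t * (C * (Q₀ ^ 2 * (t : ℝ)⁻¹)) := by gcongr
    _ = C * Q₀ ^ 2 := by field_simp

/-- At the right end the `t`-th power of the weight is bounded, because its logarithm is at most a
constant times `t (r - 1)²`. Moving along the circle multiplies it by the Gaussian. -/
theorem pointBound_diamCircle (hb : b ∈ Ioo (0 : ℝ) 1) {u v c r h' Q₀ η : ℝ} {t : ℕ} {θ : ℝ}
    (ht : 1 ≤ t) (hu : 1 ≤ u) (hv : v ≤ 1) (hr : |h'| ≤ r) (hr1 : |r - 1| ≤ (1 - b) / 2)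
    (hQ : |r - 1| ≤ Q₀ * (√(t : ℝ))⁻¹) (hη : η ≤ ‖diamCircle h' r θ‖)
    (hop_le : ‖diamCircle h' r θ‖ ^ speed b u v * ‖hop b u v (diamCircle h' r θ)‖ ≤
      r ^ speed b u v * ‖hop b u v r‖ * Real.exp (-(c * (1 - Real.cos θ)))) :
    PointBound b u v c (Q₀ + 4) (Real.exp (2 / (1 - b) ^ 2 * Q₀ ^ 2)) η t
      (diamCircle h' r θ) (ang t θ) := by
  obtain ⟨hb0, hb1⟩ := hb
  refine ⟨hη, (norm_diamCircle_sub_one_le ht hr (by linarith [(abs_le.1 hr1).2]) hQ θ).2, ?_⟩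
  have h1 := rpow_speed_mul_norm_hop_le ⟨hb0, hb1⟩ hu hv hr1
  calc _ ≤ (Real.exp (2 / (1 - b) ^ 2 * (r - 1) ^ 2) *
        Real.exp (-(c * (1 - Real.cos θ)))) ^ t := by
        exact pow_le_pow_left₀ (by positivity)
          (hop_le.trans (mul_le_mul_of_nonneg_right h1 (Real.exp_pos _).le)) t
    _ = Real.exp (2 / (1 - b) ^ 2 * (r - 1) ^ 2) ^ t *
        Real.exp (-(c * (1 - Real.cos θ))) ^ t := mul_pow _ _ _
    _ ≤ _ := by
        rw [← Real.exp_nat_mul (-(c * (1 - Real.cos θ))) t, ang_sq,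
          show (t : ℝ) * -(c * (1 - Real.cos θ)) = -(c * (t * (1 - Real.cos θ))) by ring]
        gcongr
        exact exp_quadratic_pow_le ht (by positivity) hQ

/-- Near `1` the numerator `z₁ - z₂` is of order `t^(-1/2)`, as is the smallest admitted distance to
the pole, so the quotient is bounded up to powers of the rescaled angles. -/
theorem scat_eq_one_add {u v : ℝ} {z₁ z₂ : ℂ} (hz : z₁ ≠ 0) (h : z₂ ≠ poleMap u v z₁) :
    scat u v z₁ z₂ = 1 + (u + v) * (z₁ - z₂) / (z₁ * (z₂ - poleMap u v z₁)) := by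
  rw [scat, scatDenom_eq_mul u v hz, eq_comm, ← eq_sub_iff_add_eq', div_eq_iff
    (mul_ne_zero hz (sub_ne_zero.2 h)), sub_mul, div_mul_cancel₀ _
    (mul_ne_zero hz (sub_ne_zero.2 h)), one_mul]
  unfold scatDenom poleMap
  field_simp
  ring

/-- The inner contour integral against the scattering factor, over a circle staying at distance
of order `t^(-1/2)` from the pole. -/
theorem exists_norm_scat_inner_le {c Q E η k : ℝ} (hc : 0 < c) (hQ : 0 < Q) (hE : 0 < E)
    (hη : 0 < η) (hk : 0 < k) (j : ℕ) : ∃ K > 0, ∀ (u v r : ℝ) (t : ℕ) (z₁ : ℂ) (s₁ : ℝ)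
      (f : ℂ → ℂ) (n : ℤ), 1 ≤ t → 1 ≤ u → u ≤ 2 → 0 ≤ v → v ≤ 1 → 1 / 2 ≤ r → r ≤ 2 → 0 ≤ s₁ →
      η ≤ ‖z₁‖ → ‖z₁ - 1‖ ≤ Q * (1 + s₁) * (√(t : ℝ))⁻¹ →
      k * (√(t : ℝ))⁻¹ ≤ |‖poleMap u v z₁‖ - r| →
      (∀ θ, PointBound b u v c Q E (1 / 2) t (circleMap 0 r θ) (ang t θ)) →
      ‖∮ z₂ in C(0, r), scat u v z₁ z₂ * f z₁ * wave b u v n j t z₂‖ ≤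
        K * (‖f z₁‖ * (1 + s₁) * r ^ ((n : ℝ) - speed b u v * t)) *
          (√(t : ℝ))⁻¹ ^ (1 + j) := by
  set K₁ := 1 + 6 * Q / (η * k) with hK₁
  have hK₁0 : 0 < K₁ := by positivity
  refine ⟨gaussConst c (1 + j) * (K₁ * 2 * Q ^ j * E), by
    have := gaussConst_pos hc (1 + j); positivity, ?_⟩
  intro u v r t z₁ s₁ f n ht hu hu2 hv0 hv hr1 hr2 hs₁ hz₁ hd₁ hgap hP
  have ht0 : (0 : ℝ) < t := by exact_mod_cast ht
  set w := (√(t : ℝ))⁻¹ with hw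
  have hw0 : 0 < w := by positivity
  have hz0 : z₁ ≠ 0 := norm_pos_iff.1 (hη.trans_le hz₁)
  have hscat : ∀ θ, ‖scat u v z₁ (circleMap 0 r θ)‖ ≤ K₁ * ((1 + s₁) * (1 + ang t θ)) := by
    intro θ
    set z₂ := circleMap 0 r θ with hz₂
    have hs₂ := ang_nonneg t θ
    have hn₂ : ‖z₂‖ = r := by rw [hz₂, norm_circleMap_zero, abs_of_nonneg (by linarith)]
    have hd₂ := (hP θ).dist
    rw [← hz₂, ← hw] at hd₂
    have hg : k * w ≤ ‖z₂ - poleMap u v z₁‖ := by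
      refine hgap.trans ?_
      rw [← hn₂, abs_sub_comm]
      exact abs_norm_sub_norm_le _ _
    have hne : z₂ ≠ poleMap u v z₁ := by
      intro h
      rw [h, sub_self, norm_zero] at hg
      have : 0 < k * w := by positivity
      linarith
    have h12 : ‖z₁ - z₂‖ ≤ Q * (1 + s₁) * w + Q * (1 + ang t θ) * w := by
      calc ‖z₁ - z₂‖ ≤ ‖z₁ - 1‖ + ‖1 - z₂‖ := norm_sub_le_norm_sub_add_norm_sub _ _ _
        _ ≤ _ := by rw [norm_sub_rev 1]; linarith
    have huv : ‖(u : ℂ) + v‖ ≤ 3 := by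
      rw [← Complex.ofReal_add, Complex.norm_real, Real.norm_eq_abs, abs_of_nonneg (by linarith)]
      linarith
    rw [scat_eq_one_add hz0 hne]
    calc ‖1 + (u + v) * (z₁ - z₂) / (z₁ * (z₂ - poleMap u v z₁))‖
        ≤ 1 + ‖(u : ℂ) + v‖ * ‖z₁ - z₂‖ / (‖z₁‖ * ‖z₂ - poleMap u v z₁‖) := by
          refine (norm_add_le _ _).trans ?_
          rw [norm_one, norm_div, norm_mul, norm_mul]
      _ ≤ 1 + 3 * (Q * (1 + s₁) * w + Q * (1 + ang t θ) * w) / (η * (k * w)) := by gcongr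
      _ = 1 + 3 * Q / (η * k) * ((1 + s₁) + (1 + ang t θ)) := by
          field_simp
      _ ≤ (1 + s₁) * (1 + ang t θ) + 3 * Q / (η * k) * (2 * ((1 + s₁) * (1 + ang t θ))) := by
          gcongr <;> nlinarith [mul_nonneg hs₁ hs₂]
      _ = _ := by rw [hK₁]; ring
  have hbound : ∀ θ, ‖scat u v z₁ (circleMap 0 r θ) * f z₁ * wave b u v n j t (circleMap 0 r θ)‖ ≤
      (K₁ * 2 * Q ^ j * E * (‖f z₁‖ * (1 + s₁) * r ^ ((n : ℝ) - speed b u v * t)) * w ^ j) *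
        (1 + ang t θ) ^ (1 + j) * Real.exp (-(c * ang t θ ^ 2)) := by
    intro θ
    have h1 := (hP θ).norm_wave_le (by norm_num) n j
    rw [norm_circleMap_zero, abs_of_nonneg (by linarith : 0 ≤ r), ← hw] at h1
    have hs₂ := ang_nonneg t θ
    rw [norm_mul, norm_mul]
    calc _ ≤ K₁ * ((1 + s₁) * (1 + ang t θ)) * ‖f z₁‖ *
          ((1 / 2)⁻¹ * r ^ ((n : ℝ) - speed b u v * t) * (Q * (1 + ang t θ) * w) ^ j *
            (E * Real.exp (-(c * ang t θ ^ 2)))) := by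
          gcongr
          exact hscat θ
      _ = _ := by
          rw [mul_pow, mul_pow, pow_add]
          ring
  refine (norm_circleIntegral_le_gauss (by linarith) hr2 hc ht ?_ hbound).trans (le_of_eq ?_)
  · positivity
  · rw [← hw, pow_add]
    ring

/-- The difference `poleMap z - poleMap r` equals `u v (z - r) / (r z)`, so the pole stays near `1`
at the same scale as `z`. -/
theorem norm_poleMap_sub_one_le {u v r h Q₀ S w : ℝ} {z : ℂ} (hr : 0 < r) (hh : 0 < h)
    (hu : 0 ≤ u) (hu2 : u ≤ 2) (hv0 : 0 ≤ v) (hv : v ≤ 1) (hS : 1 ≤ S) (hw : 0 ≤ w)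
    (hz : h ≤ ‖z‖) (hzr : ‖z - r‖ ≤ 2 * r * S * w) (hQ : |u + v - u * v / r - 1| ≤ Q₀ * w) :
    ‖poleMap u v z - 1‖ ≤ (Q₀ + 4 / h) * S * w := by
  have hz0 : 0 < ‖z‖ := hh.trans_le hz
  have hz0' : z ≠ 0 := norm_pos_iff.1 hz0
  set rs := u + v - u * v / r with hrs
  have e : poleMap u v z - 1 = (u * v : ℝ) * (z - r) / (r * z) + ((rs - 1 : ℝ) : ℂ) := by
    have : (r : ℂ) ≠ 0 := by exact_mod_cast hr.ne'
    rw [hrs, poleMap]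
    push_cast
    field_simp
    ring
  have h1 : u * v ≤ 2 := by nlinarith
  have h2 : Q₀ * w ≤ Q₀ * w * S := le_mul_of_one_le_right ((abs_nonneg _).trans hQ) hS
  have h3 : (u * v) * ‖z - r‖ / (r * ‖z‖) ≤ 2 * (2 * r * S * w) / (r * h) := by gcongr
  have h4 : 2 * (2 * r * S * w) / (r * h) = 4 / h * S * w := by field_simp; ring
  have h5 : ‖poleMap u v z - 1‖ ≤ (u * v) * ‖z - r‖ / (r * ‖z‖) + |rs - 1| := by
    rw [e]
    refine (norm_add_le _ _).trans ?_
    rw [norm_div, norm_mul, norm_mul, Complex.norm_real, Complex.norm_real,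
      Complex.norm_real, Real.norm_eq_abs, Real.norm_eq_abs, Real.norm_eq_abs,
      abs_of_pos hr, abs_of_nonneg (by positivity : 0 ≤ u * v)]
  linarith

/-- The hypotheses only make `u - 1` and `1 - v` of order `w^(1/2)`, so the product is of order `w`,
not `w²`. This one power makes the single integral of the residue comparable to the double integral.
-/
theorem norm_sub_mul_norm_sub_le {u v Q Q₀ S w : ℝ} {z : ℂ} (hQ₀ : 0 ≤ Q₀)
    (hS : 1 ≤ S) (hw : 0 ≤ w) (hw1 : w ≤ 1) (hz : ‖z - 1‖ ≤ Q * S * w)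
    (hu : (u - 1) ^ 2 ≤ Q₀ * w) (hv : (1 - v) ^ 2 ≤ Q₀ * w) :
    ‖z - u‖ * ‖z - v‖ ≤ (2 * Q ^ 2 + 2 * Q₀) * S ^ 2 * w := by
  have a0 : ∀ y : ℝ, ‖z - y‖ ≤ ‖z - 1‖ + |y - 1| := by
    intro y
    have : ‖(1 : ℂ) - y‖ = |y - 1| := by
      rw [← Complex.ofReal_one, ← Complex.ofReal_sub, Complex.norm_real, Real.norm_eq_abs,
        abs_sub_comm]
    rw [← this]
    exact norm_sub_le_norm_sub_add_norm_sub _ _ _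
  have a3 : ‖z - 1‖ ^ 2 ≤ Q ^ 2 * S ^ 2 * w := by
    calc ‖z - 1‖ ^ 2 ≤ (Q * S * w) ^ 2 := by gcongr
      _ = Q ^ 2 * S ^ 2 * (w * w) := by ring
      _ ≤ Q ^ 2 * S ^ 2 * (w * 1) := by gcongr
      _ = _ := by ring
  have a4 : Q₀ * w ≤ Q₀ * w * S ^ 2 :=
    le_mul_of_one_le_right (by positivity) (one_le_pow₀ hS)
  have a5 := mul_le_mul (a0 u) (a0 v) (norm_nonneg _) (by positivity)
  have a6 : (1 - v) ^ 2 = |v - 1| ^ 2 := by rw [sq_abs]; ring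
  rw [← sq_abs (u - 1)] at hu
  rw [a6] at hv
  linarith [sq_nonneg (‖z - 1‖ - |u - 1|), sq_nonneg (‖z - 1‖ - |v - 1|),
    sq_nonneg (|u - 1| - |v - 1|)]

/-- At the real point `r` the symbol of the residue factors into the one-particle weights at `r` and
at `poleMap r`, both close to `1`, and the quadratic bound applies to each. -/
theorem ContourBounds.pair_symbol_le (hb : b ∈ Ioo (0 : ℝ) 1) {c h u v r Q₀ h' : ℝ} {t : ℕ}
    (H : ContourBounds b c h u v r) (hh : 0 < h) (hh' : h' = h ∨ h' = -h) (ht : 1 ≤ t)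
    (hu : 1 ≤ u) (hv : v ≤ 1) (hr : |r - 1| ≤ (1 - b) / 2)
    (hrs : |u + v - u * v / r - 1| ≤ (1 - b) / 2) (hrQ : |r - 1| ≤ Q₀ * (√(t : ℝ))⁻¹)
    (hrsQ : |u + v - u * v / r - 1| ≤ Q₀ * (√(t : ℝ))⁻¹) (θ : ℝ) :
    (‖poleNum u v (diamCircle h' r θ)‖ ^ speed b u v *
      ‖hopPair b u v (diamCircle h' r θ)‖) ^ t ≤
      Real.exp (2 / (1 - b) ^ 2 * Q₀ ^ 2) ^ 2 * Real.exp (-(c * ang t θ ^ 2)) := by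
  set E := Real.exp (2 / (1 - b) ^ 2 * Q₀ ^ 2) with hE
  set rs := u + v - u * v / r with hrs_def
  have hr0 : 0 < r := hh.trans H.h_lt
  have hrs0 : 1 / 2 ≤ rs := by have := (abs_le.1 hrs).1; have := hb.1; linarith
  have hrne : (r : ℂ) ≠ 0 := by exact_mod_cast hr0.ne'
  have h1 := rpow_speed_mul_norm_hop_le hb hu hv hr
  have h2 := rpow_speed_mul_norm_hop_le hb hu hv hrs
  have h3 : ‖poleNum u v r‖ ^ speed b u v * ‖hopPair b u v r‖ =
      (r ^ speed b u v * ‖hop b u v r‖) * (rs ^ speed b u v * ‖hop b u v rs‖) := by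
    have e : poleMap u v r = (rs : ℂ) := by
      rw [hrs_def, poleMap]; push_cast; ring
    rw [norm_poleNum_ofReal hr0 H.num_zero.2, ← hop_mul_hop_poleMap hrne
      (by exact_mod_cast H.hop_pole.2.ne'), e, norm_mul, Real.mul_rpow hr0.le (by linarith)]
    ring
  have h4 := H.pair_diam h' hh' θ
  rw [h3] at h4
  have hC : 0 ≤ 2 / (1 - b) ^ 2 := by positivity
  have hrsQ' := exp_quadratic_pow_le ht hC hrsQ
  have hrQ' := exp_quadratic_pow_le ht hC hrQ
  have h5 : (r ^ speed b u v * ‖hop b u v r‖) * (rs ^ speed b u v * ‖hop b u v rs‖) ≤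
      Real.exp (2 / (1 - b) ^ 2 * (r - 1) ^ 2) * Real.exp (2 / (1 - b) ^ 2 * (rs - 1) ^ 2) :=
    mul_le_mul h1 h2 (by positivity) (Real.exp_pos _).le
  have h6 := pow_le_pow_left₀ (by positivity)
    (h4.trans (mul_le_mul_of_nonneg_right h5 (Real.exp_pos _).le)) t
  refine h6.trans ?_
  rw [mul_pow, mul_pow, ← Real.exp_nat_mul (-(c * (1 - Real.cos θ))) t, ang_sq,
    show (t : ℝ) * -(c * (1 - Real.cos θ)) = -(c * (t * (1 - Real.cos θ))) by ring, sq E]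
  exact mul_le_mul_of_nonneg_right (mul_le_mul hrQ' hrsQ' (by positivity) (Real.exp_pos _).le)
    (Real.exp_pos _).le

/-- The identity `poleNum z = z * poleMap z` restores one drift-corrected power for each particle
and groups what is raised to the power `t`. -/
theorem norm_residueWave_eq {u v : ℝ} {z : ℂ} (hz : z ≠ 0) (hp : poleMap u v z ≠ 0) (n₁ n₂ : ℤ)
    (j₁ j₂ t : ℕ) :
    ‖residueWave b u v n₁ n₂ j₁ j₂ t z‖ = ‖(u : ℂ) + v‖ * (‖z - u‖ * ‖z - v‖) *
      ‖z - 1‖ ^ j₁ * ‖poleMap u v z - 1‖ ^ j₂ * ‖z‖⁻¹ ^ 3 * ‖poleMap u v z‖⁻¹ *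
      (‖z‖ ^ ((n₁ : ℝ) - speed b u v * t) * ‖poleMap u v z‖ ^ ((n₂ : ℝ) - speed b u v * t)) *
      (‖poleNum u v z‖ ^ speed b u v * ‖hopPair b u v z‖) ^ t := by
  have hz0 := norm_pos_iff.2 hz
  have hp0 := norm_pos_iff.2 hp
  have hN : poleNum u v z = z * poleMap u v z := by
    rw [poleMap_eq_div hz]
    field_simp
  set p := poleMap u v z with hpdef
  have hNz : poleNum u v z - z = z * (p - 1) := by rw [hN]; ring
  have e1 := norm_zpow_eq hz0 n₁ 3 (speed b u v) t
  have e2 := norm_zpow_eq hp0 n₂ 1 (speed b u v) t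
  have e3 : ‖z‖ ^ (n₁ - (3 : ℕ)) = ‖z‖ ^ j₂ * ‖z‖ ^ (n₁ - n₂ - 2 - j₂) * ‖z‖ ^ (n₂ - 1) := by
    rw [← zpow_natCast ‖z‖ j₂, ← zpow_add₀ hz0.ne', ← zpow_add₀ hz0.ne']
    congr 1
    push_cast
    ring
  unfold residueWave
  rw [hNz, hN]
  simp only [norm_mul, norm_pow, norm_zpow]
  rw [Real.mul_rpow (norm_nonneg _) (norm_nonneg _), mul_zpow, mul_pow, mul_pow, mul_pow]
  have e4 : ‖p‖ ^ (n₂ - 1) = ‖p‖⁻¹ * (‖p‖ ^ ((n₂ : ℝ) - speed b u v * t) *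
      (‖p‖ ^ speed b u v) ^ t) := by simpa using e2
  rw [e4]
  linear_combination (‖(u : ℂ) + v‖ * (‖z - u‖ * ‖z - v‖) *
    ‖z - 1‖ ^ j₁ * ‖p - 1‖ ^ j₂ * ‖p‖⁻¹ * ‖p‖ ^ ((n₂ : ℝ) - speed b u v * t) *
      (‖p‖ ^ speed b u v) ^ t * ‖hopPair b u v z‖ ^ t) * (e1 - e3)

/-- The residue on the circles with diameters `[±h, r]`. -/
theorem exists_norm_residueWave_le (hb : b ∈ Ioo (0 : ℝ) 1) {c h Q₀ : ℝ} (hh : 0 < h)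
    (hQ₀ : 0 < Q₀) (j₁ j₂ : ℕ) : ∃ K > 0, ∀ (u v r h' : ℝ) (t : ℕ) (n₁ n₂ : ℤ) (θ : ℝ),
      1 ≤ t → 1 ≤ u → u ≤ 2 → 0 < v → v ≤ 1 → ContourBounds b c h u v r →
      (h' = h ∨ h' = -h) → |r - 1| ≤ (1 - b) / 2 → |u + v - u * v / r - 1| ≤ (1 - b) / 2 →
      |r - 1| ≤ Q₀ * (√(t : ℝ))⁻¹ → |u + v - u * v / r - 1| ≤ Q₀ * (√(t : ℝ))⁻¹ →
      (u - 1) ^ 2 ≤ Q₀ * (√(t : ℝ))⁻¹ → (1 - v) ^ 2 ≤ Q₀ * (√(t : ℝ))⁻¹ →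
      ‖residueWave b u v n₁ n₂ j₁ j₂ t (diamCircle h' r θ)‖ ≤
        K * (‖diamCircle h' r θ‖ ^ ((n₁ : ℝ) - speed b u v * t) *
          ‖poleMap u v (diamCircle h' r θ)‖ ^ ((n₂ : ℝ) - speed b u v * t)) *
          (√(t : ℝ))⁻¹ ^ (1 + j₁ + j₂) * (1 + ang t θ) ^ (2 + j₁ + j₂) *
          Real.exp (-(c * ang t θ ^ 2)) := by
  set Q := Q₀ + 4 with hQ
  set Q' := Q₀ + 4 / h with hQ'
  refine ⟨3 * (2 * Q ^ 2 + 2 * Q₀) * Q ^ j₁ * Q' ^ j₂ * h⁻¹ ^ 3 * 2 *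
    Real.exp (2 / (1 - b) ^ 2 * Q₀ ^ 2) ^ 2, by positivity, ?_⟩
  intro u v r h' t n₁ n₂ θ ht hu hu2 hv0 hv H hh' hr hrs hrQ hrsQ huQ hvQ
  have ht0 : (0 : ℝ) < t := by exact_mod_cast ht
  have ht1 : (1 : ℝ) ≤ √(t : ℝ) := by rw [Real.one_le_sqrt]; exact_mod_cast ht
  have hpair := H.pair_symbol_le hb hh hh' ht hu hv hr hrs hrQ hrsQ θ
  have hr0 : 0 < r := hh.trans H.h_lt
  have habs : |h'| = h := by rcases hh' with rfl | rfl <;> simp [abs_of_pos hh]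
  have hs := ang_nonneg t θ
  have hzh : h ≤ ‖diamCircle h' r θ‖ := habs ▸ le_norm_diamCircle (habs.trans_le H.h_lt.le) θ
  have hz0 : 0 < ‖diamCircle h' r θ‖ := hh.trans_le hzh
  have hpl := H.le_norm_poleMap hh hh' θ
  have hp2 : 1 / 2 ≤ ‖poleMap u v (diamCircle h' r θ)‖ := by
    have := (abs_le.1 hrs).1; have := hb.1; linarith
  have hp0 : 0 < ‖poleMap u v (diamCircle h' r θ)‖ := by linarith
  have hr2 : r ≤ 2 := by have := (abs_le.1 hr).2; have := hb.1; linarith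
  obtain ⟨hzr, hz1⟩ := norm_diamCircle_sub_one_le ht (habs.trans_le H.h_lt.le) hr2 hrQ θ
  rw [norm_residueWave_eq (norm_pos_iff.1 hz0) (norm_pos_iff.1 hp0)]
  generalize hs_def : ang t θ = s at *
  generalize hw : (√(t : ℝ))⁻¹ = w at *
  have hw0 : 0 < w := by rw [← hw]; positivity
  have hw1 : w ≤ 1 := by rw [← hw]; exact inv_le_one_of_one_le₀ ht1
  generalize hz : diamCircle h' r θ = z at *
  have hS : 1 ≤ 1 + s := by linarith
  have hp1 : ‖poleMap u v z - 1‖ ≤ Q' * (1 + s) * w :=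
    norm_poleMap_sub_one_le hr0 hh (by linarith) hu2 hv0.le hv hS hw0.le hzh hzr hrsQ
  have huv : ‖z - u‖ * ‖z - v‖ ≤ (2 * Q ^ 2 + 2 * Q₀) * (1 + s) ^ 2 * w :=
    norm_sub_mul_norm_sub_le hQ₀.le hS hw0.le hw1 hz1 huQ hvQ
  generalize poleMap u v z = p at *
  have huv3 : ‖(u : ℂ) + v‖ ≤ 3 := by
    rw [← Complex.ofReal_add, Complex.norm_real, Real.norm_eq_abs, abs_of_nonneg (by linarith)]
    linarith
  have hpi : ‖p‖⁻¹ ≤ 2 := by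
    rw [inv_le_comm₀ hp0 two_pos]
    linarith
  have hzi : ‖z‖⁻¹ ≤ h⁻¹ := inv_anti₀ hh hzh
  have hP0 : 0 ≤ (‖poleNum u v z‖ ^ speed b u v * ‖hopPair b u v z‖) ^ t := by positivity
  generalize (‖poleNum u v z‖ ^ speed b u v * ‖hopPair b u v z‖) ^ t = P at *
  generalize Real.exp (2 / (1 - b) ^ 2 * Q₀ ^ 2) = E at *
  have hn := norm_nonneg (z - u)
  have hn' := norm_nonneg (z - v)
  have hQpos : 0 ≤ Q := by positivity
  have hQpos' : 0 ≤ Q' := by positivity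
  calc _ ≤ 3 * ((2 * Q ^ 2 + 2 * Q₀) * (1 + s) ^ 2 * w) * (Q * (1 + s) * w) ^ j₁ *
        (Q' * (1 + s) * w) ^ j₂ * h⁻¹ ^ 3 * 2 *
        (‖z‖ ^ ((n₁ : ℝ) - speed b u v * t) * ‖p‖ ^ ((n₂ : ℝ) - speed b u v * t)) *
        (E ^ 2 * Real.exp (-(c * s ^ 2))) := by
          refine mul_le_mul (mul_le_mul_of_nonneg_right ?_ (by positivity)) hpair ?_ (by positivity)
          · gcongr
          · exact hP0
    _ = _ := by
        simp only [mul_pow, pow_add]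
        ring

end S6V

/-! ### The diffusive regime -/

namespace S6V

open Set Metric Function Filter Topology

variable {b : ℝ}

/-- The parameter regime of the diffusive estimate: `κ` is comparable to `t^(-1/2)`, and `u`, `v`
are so close to `1` that their distance to `1` is controlled by `κ`. -/
structure NearCritical (b c h k K u v κ : ℝ) (t : ℕ) : Prop where
  b_mem : b ∈ Ioo (0 : ℝ) 1
  h_pos : 0 < h
  k_pos : 0 < k
  one_le_t : 1 ≤ t
  one_le_u : 1 ≤ u
  u_le : u ≤ 17 / 16
  le_v : 15 / 16 ≤ v
  v_le : v ≤ 1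
  lower : k * (√(t : ℝ))⁻¹ ≤ κ
  upper : κ ≤ K * (√(t : ℝ))⁻¹
  small : κ ≤ (1 - b) / 20
  u_sq : (u - 1) ^ 2 ≤ κ
  v_sq : (1 - v) ^ 2 ≤ κ
  uv : (u - 1) * (1 - v) ≤ κ / 2
  bounds : ∀ x, |x| ≤ 3 * κ → ContourBounds b c h u v (Real.exp x)

/-! ### Radii `exp x` with `|x| ≤ 3κ`, and the position of the pole relative to them. -/

namespace NearCritical

variable {c h k K u v κ x : ℝ} {t : ℕ}

theorem kappa_pos (N : NearCritical b c h k K u v κ t) : 0 < κ := by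
  have : (0 : ℝ) < t := by exact_mod_cast N.one_le_t
  have := N.k_pos
  exact lt_of_lt_of_le (by positivity) N.lower

theorem kappa_le (N : NearCritical b c h k K u v κ t) : κ ≤ 1 / 20 := by
  linarith [N.small, N.b_mem.1]

theorem abs_exp_sub_one_le (N : NearCritical b c h k K u v κ t) (hx : |x| ≤ 3 * κ) :
    |Real.exp x - 1| ≤ 6 * κ := by
  have := N.kappa_le
  linarith [Real.abs_exp_sub_one_le (x := x) (by linarith)]

theorem abs_exp_sub_one_le' (N : NearCritical b c h k K u v κ t) (hx : |x| ≤ 3 * κ) :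
    |Real.exp x - 1| ≤ 6 * K * (√(t : ℝ))⁻¹ := by
  linarith [N.abs_exp_sub_one_le hx, N.upper]

theorem abs_exp_sub_one_le_half (N : NearCritical b c h k K u v κ t) (hx : |x| ≤ 3 * κ) :
    |Real.exp x - 1| ≤ (1 - b) / 2 := by
  linarith [N.abs_exp_sub_one_le hx, N.small, N.b_mem.2]

theorem half_le_exp (N : NearCritical b c h k K u v κ t) (hx : |x| ≤ 3 * κ) :
    1 / 2 ≤ Real.exp x ∧ Real.exp x ≤ 2 := by
  obtain ⟨h1, h2⟩ := abs_le.1 (N.abs_exp_sub_one_le hx)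
  have := N.kappa_le
  exact ⟨by linarith, by linarith⟩

theorem uv_mem (N : NearCritical b c h k K u v κ t) : 15 / 16 ≤ u * v ∧ u * v ≤ 17 / 16 := by
  have h1 := N.one_le_u
  have h2 := N.u_le
  have h3 := N.le_v
  have h4 := N.v_le
  exact ⟨by nlinarith, by nlinarith⟩

theorem poleMap_exp_sub_one (u v x : ℝ) :
    u + v - u * v / Real.exp x - 1 = (u - 1) * (1 - v) + u * v * (1 - Real.exp (-x)) := by
  rw [Real.exp_neg]
  ring

theorem abs_poleMap_sub_one_le (N : NearCritical b c h k K u v κ t) (hx : |x| ≤ 2 * κ) :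
    |u + v - u * v / Real.exp x - 1| ≤ 6 * κ := by
  have h0 := N.kappa_le
  have h1 := Real.abs_exp_sub_one_le (x := -x) (by rw [abs_neg]; linarith)
  obtain ⟨h4, h5⟩ := N.uv_mem
  have h6 : 0 ≤ (u - 1) * (1 - v) :=
    mul_nonneg (by linarith [N.one_le_u]) (by linarith [N.v_le])
  rw [abs_neg] at h1
  rw [poleMap_exp_sub_one]
  refine (abs_add_le _ _).trans ?_
  rw [abs_of_nonneg h6, abs_mul, abs_of_nonneg (by linarith : 0 ≤ u * v), abs_sub_comm]
  have h7 : u * v * |Real.exp (-x) - 1| ≤ 17 / 16 * (4 * κ) :=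
    mul_le_mul h5 (by linarith) (abs_nonneg _) (by norm_num)
  linarith [N.uv, N.kappa_pos]

theorem exp_le (N : NearCritical b c h k K u v κ t) {y : ℝ} (hy : |y| ≤ 2 * κ) :
    Real.exp y ≤ 1 + y + |y| / 10 := by
  have h0 := N.kappa_le
  have h1 := abs_le.1 (Real.abs_exp_sub_one_sub_id_le (x := y) (by linarith))
  have h2 : y ^ 2 ≤ |y| * (1 / 10) := by
    rw [← sq_abs, sq]
    exact mul_le_mul_of_nonneg_left (by linarith) (abs_nonneg _)
  linarith [h1.2]

/-- To first order `poleMap (exp (-κ))` is `1 - κ` plus the nonnegative shift `(u - 1)(1 - v)`. The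
bound `κ / 2` on this shift keeps the pole at or below `1`, and `u v` being within `1/16` of `1`
leaves a gap of `κ / 2` above `exp (-2κ)`. -/
theorem poleMap_exp_neg (N : NearCritical b c h k K u v κ t) :
    Real.exp (-(2 * κ)) + κ / 2 ≤ u + v - u * v / Real.exp (-κ) ∧
      u + v - u * v / Real.exp (-κ) ≤ 1 := by
  have h0 := N.kappa_pos
  have e := poleMap_exp_sub_one u v (-κ)
  rw [neg_neg] at e
  have h1 := N.exp_le (y := κ) (by rw [abs_of_pos h0]; linarith)
  have h2 := N.exp_le (y := -(2 * κ)) (by rw [abs_neg, abs_of_pos (by linarith)])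
  have h3 := Real.add_one_le_exp κ
  rw [abs_of_pos h0] at h1
  rw [abs_neg, abs_of_pos (by linarith)] at h2
  obtain ⟨h4, h5⟩ := N.uv_mem
  have h6 : 0 ≤ (u - 1) * (1 - v) :=
    mul_nonneg (by linarith [N.one_le_u]) (by linarith [N.v_le])
  have h7 := N.uv
  constructor <;> nlinarith

theorem poleMap_exp_two (N : NearCritical b c h k K u v κ t) :
    Real.exp κ + κ / 2 ≤ u + v - u * v / Real.exp (2 * κ) := by
  have h0 := N.kappa_pos
  have e := poleMap_exp_sub_one u v (2 * κ)
  have h1 := N.exp_le (y := κ) (by rw [abs_of_pos h0]; linarith)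
  have h2 := N.exp_le (y := -(2 * κ)) (by rw [abs_neg, abs_of_pos (by linarith)])
  rw [abs_of_pos h0] at h1
  rw [abs_neg, abs_of_pos (by linarith)] at h2
  obtain ⟨h4, h5⟩ := N.uv_mem
  have h6 : 0 ≤ (u - 1) * (1 - v) :=
    mul_nonneg (by linarith [N.one_le_u]) (by linarith [N.v_le])
  nlinarith

theorem pointBound_circle (N : NearCritical b c h k K u v κ t) (hx : |x| ≤ 3 * κ) {η : ℝ}
    (hη : η ≤ Real.exp x) (θ : ℝ) :
    PointBound b u v c (6 * K + 4) (Real.exp (2 / (1 - b) ^ 2 * (6 * K) ^ 2)) η t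
      (circleMap 0 (Real.exp x) θ) (ang t θ) := by
  have hp := Real.exp_pos x
  rw [← diamCircle_neg]
  refine pointBound_diamCircle N.b_mem N.one_le_t N.one_le_u N.v_le ?_
    (N.abs_exp_sub_one_le_half hx) (N.abs_exp_sub_one_le' hx) ?_ ((N.bounds x hx).hop_concentric θ)
  · rw [abs_neg, abs_of_pos hp]
  · rwa [norm_diamCircle_neg hp.le]

theorem pointBound_diam (N : NearCritical b c h k K u v κ t) (hx : |x| ≤ 3 * κ) (θ : ℝ) :
    PointBound b u v c (6 * K + 4) (Real.exp (2 / (1 - b) ^ 2 * (6 * K) ^ 2)) h t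
      (diamCircle (-h) (Real.exp x) θ) (ang t θ) := by
  have H := N.bounds x hx
  have habs : |-h| = h := by rw [abs_neg, abs_of_pos N.h_pos]
  refine pointBound_diamCircle N.b_mem N.one_le_t N.one_le_u N.v_le (habs.trans_le H.h_lt.le)
    (N.abs_exp_sub_one_le_half hx) (N.abs_exp_sub_one_le' hx) ?_ (H.hop_diam θ)
  have := le_norm_diamCircle (habs.trans_le H.h_lt.le) θ
  rwa [habs] at this

theorem differentiableAt_wave (N : NearCritical b c h k K u v κ t) (hx : |x| ≤ 3 * κ) {n : ℤ}
    {j : ℕ} {z : ℂ} (hz : Real.exp x ≤ ‖z‖) : DifferentiableAt ℂ (wave b u v n j t) z := by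
  have H := (N.bounds x hx).hop_pole
  refine S6V.differentiableAt_wave ?_ ?_
  · rintro rfl
    rw [norm_zero] at hz
    linarith [Real.exp_pos x]
  · rintro rfl
    rw [Complex.norm_real, Real.norm_eq_abs, abs_of_pos (N.h_pos.trans H.1)] at hz
    linarith

theorem differentiableAt_wave_diam (N : NearCritical b c h k K u v κ t) (hx : |x| ≤ 3 * κ)
    {n : ℤ} {j : ℕ} {z : ℂ}
    (hz : (Real.exp x - -h) / 2 ≤ ‖z - ((Real.exp x + -h) / 2 : ℝ)‖) :
    DifferentiableAt ℂ (wave b u v n j t) z := by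
  have H := (N.bounds x hx).hop_pole
  have h0 := N.h_pos
  refine S6V.differentiableAt_wave ?_ (ne_ofReal_of_le_norm_sub (by linarith) H.2 hz)
  have := ne_ofReal_of_le_norm_sub (y := 0) (by linarith : -h < 0) (Real.exp_pos x) hz
  simpa using this

theorem le_norm_of_outside_diam (N : NearCritical b c h k K u v κ t) (hx : |x| ≤ 3 * κ) {z : ℂ}
    (hz : (Real.exp x - -h) / 2 ≤ ‖z - ((Real.exp x + -h) / 2 : ℝ)‖) : h ≤ ‖z‖ := by
  have H := (N.bounds x hx).h_lt
  have h1 := norm_sub_le z ((Real.exp x + -h) / 2 : ℝ)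
  rw [Complex.norm_real, Real.norm_eq_abs, abs_of_nonneg (by linarith)] at h1
  linarith

theorem scatDenom_ne_zero (N : NearCritical b c h k K u v κ t) {R : ℝ}
    (hR : u + v + u * v / h < R) {z₁ z₂ : ℂ} (h₁ : h ≤ ‖z₁‖) (h₂ : ‖z₂‖ = R) :
    scatDenom u v z₁ z₂ ≠ 0 := by
  have hh := N.h_pos
  have hu := N.one_le_u
  have hv := N.le_v
  have hz : 0 < ‖z₁‖ := hh.trans_le h₁
  refine scatDenom_ne_zero_of_norm_ne (norm_pos_iff.1 hz) (ne_of_gt ?_)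
  have h3 := norm_poleMap_le (by linarith : 0 ≤ u) (by linarith : 0 ≤ v) z₁
  have h4 : u * v / ‖z₁‖ ≤ u * v / h := by
    have : 0 ≤ u * v := by linarith [N.uv_mem.1]
    gcongr
  linarith

end NearCritical

/-- The scattering factor costs one power of `1 + s` at the outer point, and the inner integration
gains one `t^(-1/2)`. The outer Gaussian is kept for the second integration. -/
theorem exists_norm_wave_inner_le {c h k K : ℝ} (hc : 0 < c) (hh : 0 < h)
    (hk : 0 < k) (hK : 0 < K) (j₁ j₂ : ℕ) : ∃ K' > 0, ∀ (u v κ : ℝ) (t : ℕ),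
      NearCritical b c h k K u v κ t → ∀ (x s M : ℝ) (z : ℂ) (n₁ n₂ : ℤ), |x| ≤ 3 * κ → 0 ≤ s →
      PointBound b u v c (6 * K + 4) (Real.exp (2 / (1 - b) ^ 2 * (6 * K) ^ 2)) h t z s →
      κ / 2 ≤ |‖poleMap u v z‖ - Real.exp x| →
      ‖z‖ ^ ((n₁ : ℝ) - speed b u v * t) * Real.exp x ^ ((n₂ : ℝ) - speed b u v * t) ≤ M →
      ‖∮ z₂ in C(0, Real.exp x), scat u v z z₂ * wave b u v n₁ j₁ t z * wave b u v n₂ j₂ t z₂‖ ≤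
        K' * M * (√(t : ℝ))⁻¹ ^ (1 + j₁ + j₂) * (1 + s) ^ (2 + j₁ + j₂) *
          Real.exp (-(c * s ^ 2)) := by
  obtain ⟨K₁, hK₁, H⟩ := exists_norm_scat_inner_le (c := c) (Q := 6 * K + 4)
    (E := Real.exp (2 / (1 - b) ^ 2 * (6 * K) ^ 2)) (η := h) (k := k / 2) hc (by positivity)
    (Real.exp_pos _) hh (by positivity) j₂
  refine ⟨K₁ * (h⁻¹ * (6 * K + 4) ^ j₁ * Real.exp (2 / (1 - b) ^ 2 * (6 * K) ^ 2)),
    by positivity, ?_⟩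
  intro u v κ t N x s M z n₁ n₂ hx hs P hgap hM
  have h1 := H u v (Real.exp x) t z s (wave b u v n₁ j₁ t) n₂ N.one_le_t N.one_le_u
    (by linarith [N.u_le]) (by linarith [N.le_v]) N.v_le (N.half_le_exp hx).1 (N.half_le_exp hx).2
    hs P.le_norm P.dist (by linarith [N.lower]) (N.pointBound_circle hx (N.half_le_exp hx).1)
  refine h1.trans ?_
  have h2 := P.norm_wave_le hh n₁ j₁
  have ht0 : (0 : ℝ) < t := by exact_mod_cast N.one_le_t
  have hw0 : 0 < (√(t : ℝ))⁻¹ := by positivity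
  generalize (√(t : ℝ))⁻¹ = w at *
  generalize Real.exp (2 / (1 - b) ^ 2 * (6 * K) ^ 2) = E at *
  have hE : 0 ≤ E * Real.exp (-(c * s ^ 2)) :=
    (by positivity : 0 ≤ (‖z‖ ^ speed b u v * ‖hop b u v z‖) ^ t).trans P.symbol
  have hM0 : 0 ≤ M := le_trans (by positivity) hM
  have hrp : 0 ≤ Real.exp x ^ ((n₂ : ℝ) - speed b u v * t) := by positivity
  calc _ ≤ K₁ * (h⁻¹ * ‖z‖ ^ ((n₁ : ℝ) - speed b u v * t) * ((6 * K + 4) * (1 + s) * w) ^ j₁ *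
          (E * Real.exp (-(c * s ^ 2))) * (1 + s) *
          Real.exp x ^ ((n₂ : ℝ) - speed b u v * t)) * w ^ (1 + j₂) := by gcongr
    _ = K₁ * (h⁻¹ * (6 * K + 4) ^ j₁) * (‖z‖ ^ ((n₁ : ℝ) - speed b u v * t) *
          Real.exp x ^ ((n₂ : ℝ) - speed b u v * t)) * (E * Real.exp (-(c * s ^ 2))) *
          w ^ (1 + j₁ + j₂) * (1 + s) ^ (1 + j₁) := by
        simp only [mul_pow, pow_add]
        ring
    _ ≤ K₁ * (h⁻¹ * (6 * K + 4) ^ j₁) * M * (E * Real.exp (-(c * s ^ 2))) *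
          w ^ (1 + j₁ + j₂) * (1 + s) ^ (2 + j₁ + j₂) := by
        have h5 : (1 + s) ^ (1 + j₁) ≤ (1 + s) ^ (2 + j₁ + j₂) :=
          pow_le_pow_right₀ (by linarith) (by omega)
        refine mul_le_mul ?_ h5 (by positivity) (by positivity)
        gcongr
    _ = _ := by ring

theorem exists_norm_residue_le (hb : b ∈ Ioo (0 : ℝ) 1) {c h k K : ℝ} (hh : 0 < h)
    (hK : 0 < K) (j₁ j₂ : ℕ) : ∃ K' > 0, ∀ (u v κ : ℝ) (t : ℕ),
      NearCritical b c h k K u v κ t → ∀ (x h' M θ : ℝ) (n₁ n₂ : ℤ), |x| ≤ 2 * κ →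
      (h' = h ∨ h' = -h) →
      ‖diamCircle h' (Real.exp x) θ‖ ^ ((n₁ : ℝ) - speed b u v * t) *
        ‖poleMap u v (diamCircle h' (Real.exp x) θ)‖ ^ ((n₂ : ℝ) - speed b u v * t) ≤ M →
      ‖residueWave b u v n₁ n₂ j₁ j₂ t (diamCircle h' (Real.exp x) θ)‖ ≤
        K' * M * (√(t : ℝ))⁻¹ ^ (1 + j₁ + j₂) * (1 + ang t θ) ^ (2 + j₁ + j₂) *
          Real.exp (-(c * ang t θ ^ 2)) := by
  obtain ⟨K', hK', H⟩ := exists_norm_residueWave_le hb (c := c) hh (Q₀ := 6 * K) (by positivity)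
    j₁ j₂
  refine ⟨K', hK', ?_⟩
  intro u v κ t N x h' M θ n₁ n₂ hx hh' hM
  have h0 := N.kappa_pos
  have hx3 : |x| ≤ 3 * κ := by linarith
  have h1 := N.abs_poleMap_sub_one_le hx
  have h2 := N.upper
  have h3 := N.small
  refine (H u v (Real.exp x) h' t n₁ n₂ θ N.one_le_t N.one_le_u (by linarith [N.u_le])
    (by linarith [N.le_v]) N.v_le (N.bounds x hx3) hh' (N.abs_exp_sub_one_le_half hx3)
    (by linarith [N.b_mem.2]) (N.abs_exp_sub_one_le' hx3) (by linarith)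
    (by linarith [N.u_sq]) (by linarith [N.v_sq])).trans ?_
  have := ang_nonneg t θ
  gcongr

end S6V

/-! ### Kernel bounds in the diffusive regime -/

namespace S6V

open Set Metric Function Filter Topology

variable {b : ℝ}

theorem norm_contour_le (r : ℝ) (f : ℂ → ℂ) : ‖contour r f‖ ≤ ‖∮ z in C(0, r), f z‖ := by
  unfold contour
  rw [norm_mul]
  refine mul_le_of_le_one_left (norm_nonneg _) ?_
  have h3 := Real.pi_gt_three
  rw [norm_inv, norm_mul, norm_mul, Complex.norm_I, mul_one, Complex.norm_real, Real.norm_eq_abs,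
    abs_of_pos Real.pi_pos, Complex.norm_two]
  exact inv_le_one_of_one_le₀ (by linarith)

theorem norm_scatKernel_le (b u v r : ℝ) (n₁ n₂ : ℤ) (j₁ j₂ t : ℕ) :
    ‖scatKernel b u v r n₁ n₂ j₁ j₂ t‖ ≤ ‖∮ z₁ in C(0, r), ∮ z₂ in C(0, r),
      scat u v z₁ z₂ * wave b u v n₁ j₁ t z₁ * wave b u v n₂ j₂ t z₂‖ := by
  have h1 : scatKernel b u v r n₁ n₂ j₁ j₂ t = contour r fun z₁ => (2 * Real.pi * Complex.I)⁻¹ *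
      ∮ z₂ in C(0, r), scat u v z₁ z₂ * wave b u v n₁ j₁ t z₁ * wave b u v n₂ j₂ t z₂ := rfl
  have h2 : scatKernel b u v r n₁ n₂ j₁ j₂ t = (2 * Real.pi * Complex.I)⁻¹ *
      contour r fun z₁ => ∮ z₂ in C(0, r),
        scat u v z₁ z₂ * wave b u v n₁ j₁ t z₁ * wave b u v n₂ j₂ t z₂ := by
    rw [h1, contour, circleIntegral.integral_const_mul, contour]
  have h3 := norm_contour_le r fun z₁ => ∮ z₂ in C(0, r),
        scat u v z₁ z₂ * wave b u v n₁ j₁ t z₁ * wave b u v n₂ j₂ t z₂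
  have h4 : ‖(2 * Real.pi * Complex.I)⁻¹‖ ≤ 1 := by
    have h3 := Real.pi_gt_three
    rw [norm_inv, norm_mul, norm_mul, Complex.norm_I, mul_one, Complex.norm_real,
      Real.norm_eq_abs, abs_of_pos Real.pi_pos, Complex.norm_two]
    exact inv_le_one_of_one_le₀ (by linarith)
  rw [h2, norm_mul]
  exact (mul_le_of_le_one_left (norm_nonneg _) h4).trans h3

theorem norm_two_pi_I : ‖2 * (Real.pi : ℂ) * Complex.I‖ = 2 * Real.pi := by
  rw [norm_mul, norm_mul, Complex.norm_I, mul_one, Complex.norm_real,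
    Real.norm_eq_abs, abs_of_pos Real.pi_pos, Complex.norm_two]

theorem le_norm_poleMap {u v : ℝ} (huv : 0 ≤ u + v) (huv' : 0 ≤ u * v) (z : ℂ) :
    u + v - u * v / ‖z‖ ≤ ‖poleMap u v z‖ := by
  have h := norm_sub_norm_le ((u : ℂ) + v) (u * v / z)
  rwa [← Complex.ofReal_add, ← Complex.ofReal_mul, norm_div, Complex.norm_real, Complex.norm_real,
    Real.norm_eq_abs, Real.norm_eq_abs, abs_of_nonneg huv, abs_of_nonneg huv',
    Complex.ofReal_add, Complex.ofReal_mul] at h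

section

variable {c h k K u v κ : ℝ} {t : ℕ}

/-- Concentric contours, with the residue on a circle having a diameter `[±h, exp x₁]`. -/
theorem exists_norm_scat_integral_concentric_le (hb : b ∈ Ioo (0 : ℝ) 1) (hc : 0 < c)
    (hh : 0 < h) (hk : 0 < k) (hK : 0 < K) (j₁ j₂ : ℕ) : ∃ K' > 0, ∀ (u v κ r : ℝ) (t : ℕ),
      NearCritical b c h k K u v κ t → Encloses b u v r → ∀ (x₁ x₂ h' M : ℝ) (n₁ n₂ : ℤ),
      (j₂ : ℤ) + 2 ≤ n₁ - n₂ → |x₁| ≤ 2 * κ → |x₂| ≤ 3 * κ → (h' = h ∨ h' = -h) →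
      Real.exp x₂ + κ / 2 ≤ u + v - u * v / Real.exp x₁ →
      Real.exp x₁ ^ ((n₁ : ℝ) - speed b u v * t) *
        Real.exp x₂ ^ ((n₂ : ℝ) - speed b u v * t) ≤ M →
      (∀ θ, ‖diamCircle h' (Real.exp x₁) θ‖ ^ ((n₁ : ℝ) - speed b u v * t) *
        ‖poleMap u v (diamCircle h' (Real.exp x₁) θ)‖ ^ ((n₂ : ℝ) - speed b u v * t) ≤ M) →
      ‖∮ z₁ in C(0, r), ∮ z₂ in C(0, r),
          scat u v z₁ z₂ * wave b u v n₁ j₁ t z₁ * wave b u v n₂ j₂ t z₂‖ ≤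
        K' * M * (√(t : ℝ))⁻¹ ^ (2 + j₁ + j₂) := by
  obtain ⟨K₁, hK₁, H₁⟩ := exists_norm_wave_inner_le (b := b) hc hh hk hK j₁ j₂
  obtain ⟨K₂, hK₂, H₂⟩ := exists_norm_residue_le hb (c := c) (k := k) hh hK j₁ j₂
  have hG := gaussConst_pos hc (2 + j₁ + j₂)
  have hπ := Real.pi_pos
  refine ⟨gaussConst c (2 + j₁ + j₂) * K₁ + 2 * Real.pi * (gaussConst c (2 + j₁ + j₂) * K₂),
    by positivity, ?_⟩
  intro u v κ r t N hr x₁ x₂ h' M n₁ n₂ hn hx₁ hx₂ hh' hgap hM₁ hM₂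
  have h0 := N.kappa_pos
  have hx₁' : |x₁| ≤ 3 * κ := by linarith
  have hu := N.one_le_u
  have hv := N.le_v
  have huv := N.uv_mem
  have hM0 : 0 ≤ M := le_trans (by positivity) hM₁
  have H := N.bounds x₁ hx₁'
  have hp := Real.exp_pos x₁
  -- Larger than `|poleMap z₁|` whenever `|z₁| ≥ h`, so the first circle can shrink without meeting
  -- the pole.
  set R := max r (u + v + u * v / h + 1) with hR
  have hRh : u + v + u * v / h < R := lt_of_lt_of_le (lt_add_one _) (le_max_right _ _)
  have hgapz : ∀ z : ℂ, ‖z‖ = Real.exp x₁ → Real.exp x₂ + κ / 2 ≤ ‖poleMap u v z‖ := by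
    intro z hz
    refine hgap.trans ?_
    rw [← hz]
    exact le_norm_poleMap (by linarith) (by linarith) z
  have hlt : ∀ z : ℂ, ‖z‖ = Real.exp x₁ →
      Real.exp x₂ < ‖poleMap u v z‖ ∧ ‖poleMap u v z‖ < R := by
    intro z hz
    refine ⟨by linarith [hgapz z hz], lt_of_le_of_lt ?_ hRh⟩
    refine (norm_poleMap_le (by linarith) (by linarith) z).trans ?_
    have := H.h_lt
    rw [hz]
    gcongr
  have habs : |h'| = h := by rcases hh' with rfl | rfl <;> simp [abs_of_pos hh]
  obtain ⟨ha1, ha2⟩ := abs_le.1 (habs.trans_le H.h_lt.le)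
  have halt : h' < Real.exp x₁ := (le_abs_self h').trans_lt (habs.trans_lt H.h_lt)
  -- The second circle goes out to `R`, the first in to `exp x₁`, and the second back to `exp x₂`.
  -- Only the last move crosses the pole, whose modulus lies between `exp x₂` and `R`.
  rw [scat_integral_deform (m := 0) (ρ := Real.exp x₁) (R := R) hr.1 hp (le_max_left _ _) hr.2.2
    (fun z₁ z₂ h₁ h₂ => N.scatDenom_ne_zero hRh (by rw [sub_zero] at h₁; linarith [H.h_lt]) h₂)
    (fun z hz => hr.differentiableAt_wave hz _ _ _)
    (fun z hz => N.differentiableAt_wave hx₁' (by rwa [sub_zero] at hz))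
    (fun z hz => hr.differentiableAt_wave hz _ _ _),
    scat_integral_eq_add_residue hp (Real.exp_pos x₂) hlt
    (fun z hz => (N.differentiableAt_wave hx₁'
      (by simp_all)).continuousAt.continuousWithinAt)
    (fun z hz => N.differentiableAt_wave hx₂ hz),
    integral_scatResidue_eq (ρ := (Real.exp x₁ - h') / 2) (m := ((Real.exp x₁ + h') / 2 : ℝ))
    hp (by linarith) ?_ ?_ ?_]
  · refine (norm_add_le _ _).trans ?_
    rw [norm_mul, norm_two_pi_I]
    have hw0 : 0 ≤ (√(t : ℝ))⁻¹ := by positivity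
    have A₁ := norm_circleIntegral_le_gauss (m := 0) (ρ := Real.exp x₁) (c := c) (t := t)
      (k := 2 + j₁ + j₂) (K := K₁ * M * (√(t : ℝ))⁻¹ ^ (1 + j₁ + j₂))
      (f := fun z₁ => ∮ z₂ in C(0, Real.exp x₂),
        scat u v z₁ z₂ * wave b u v n₁ j₁ t z₁ * wave b u v n₂ j₂ t z₂) hp.le
      (N.half_le_exp hx₁').2 hc N.one_le_t (by positivity) fun θ => by
        have hnorm : ‖circleMap 0 (Real.exp x₁) θ‖ = Real.exp x₁ := by
          rw [norm_circleMap_zero, abs_of_pos hp]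
        refine H₁ u v κ t N x₂ (ang t θ) M _ n₁ n₂ hx₂ (ang_nonneg t θ)
          (N.pointBound_circle hx₁' H.h_lt.le θ) ?_ (by rwa [hnorm])
        refine le_trans ?_ (le_abs_self _)
        linarith [hgapz _ hnorm]
    have A₂ := norm_circleIntegral_le_gauss (m := ((Real.exp x₁ + h') / 2 : ℝ))
      (ρ := (Real.exp x₁ - h') / 2) (c := c) (t := t)
      (k := 2 + j₁ + j₂) (K := K₂ * M * (√(t : ℝ))⁻¹ ^ (1 + j₁ + j₂))
      (f := residueWave b u v n₁ n₂ j₁ j₂ t) (by linarith)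
      (by linarith [(N.half_le_exp hx₁').2]) hc N.one_le_t (by positivity)
      fun θ => H₂ u v κ t N x₁ h' M θ n₁ n₂ hx₁ hh' (hM₂ θ)
    calc _ ≤ gaussConst c (2 + j₁ + j₂) * (K₁ * M * (√(t : ℝ))⁻¹ ^ (1 + j₁ + j₂)) *
          (√(t : ℝ))⁻¹ + 2 * Real.pi * (gaussConst c (2 + j₁ + j₂) *
          (K₂ * M * (√(t : ℝ))⁻¹ ^ (1 + j₁ + j₂)) * (√(t : ℝ))⁻¹) := by gcongr
      _ = _ := by
          simp only [pow_add]
          ring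
  · rw [Complex.norm_real, Real.norm_eq_abs, abs_of_nonneg (by linarith)]
    linarith
  · rw [abs_of_pos (hh.trans H.hop_pole.1)]
    exact H.hop_pole.2
  · intro z hz
    refine H.differentiableAt_residueWave hh (by linarith) ?_ hh' hn hz
    have := H.hop_pole
    have h2 : b * v ≤ v := mul_le_of_le_one_left (by linarith) hb.2.le
    linarith

/-- The first contour is a circle with diameter `[-h, exp(-κ)]`; the second radius depends on the
position on the first contour. -/
theorem exists_norm_scat_integral_diam_le (hb : b ∈ Ioo (0 : ℝ) 1) (hc : 0 < c)
    (hh : 0 < h) (hk : 0 < k) (hK : 0 < K) (j₁ j₂ : ℕ) : ∃ K' > 0, ∀ (u v κ r : ℝ) (t : ℕ),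
      NearCritical b c h k K u v κ t → Encloses b u v r → ∀ (M : ℝ) (n₁ n₂ : ℤ),
      0 ≤ (n₁ : ℝ) - speed b u v * t → (n₂ : ℝ) - speed b u v * t ≤ 0 →
      Real.exp (-κ) ^ ((n₁ : ℝ) - speed b u v * t) *
        Real.exp κ ^ ((n₂ : ℝ) - speed b u v * t) ≤ M →
      ‖∮ z₁ in C(0, r), ∮ z₂ in C(0, r),
          scat u v z₁ z₂ * wave b u v n₁ j₁ t z₁ * wave b u v n₂ j₂ t z₂‖ ≤
        K' * M * (√(t : ℝ))⁻¹ ^ (2 + j₁ + j₂) := by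
  obtain ⟨K₁, hK₁, H₁⟩ := exists_norm_wave_inner_le (b := b) hc hh hk hK j₁ j₂
  obtain ⟨K₂, hK₂, H₂⟩ := exists_norm_residue_le hb (c := c) (k := k) hh hK j₁ j₂
  have hG := gaussConst_pos hc (2 + j₁ + j₂)
  have hπ := Real.pi_pos
  refine ⟨gaussConst c (2 + j₁ + j₂) * (K₁ + 2 * Real.pi * K₂), by positivity, ?_⟩
  intro u v κ r t N hr M n₁ n₂ hA hB hM
  have h0 := N.kappa_pos
  have hx₁ : |-κ| ≤ 2 * κ := by rw [abs_neg, abs_of_pos h0]; linarith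
  have hx₁' : |-κ| ≤ 3 * κ := by linarith
  have hxκ : |κ| ≤ 3 * κ := by rw [abs_of_pos h0]; linarith
  have hx3 : |3 * κ| ≤ 3 * κ := by rw [abs_of_pos (by linarith)]
  have hu := N.one_le_u
  have hv := N.le_v
  have huv := N.uv_mem
  have hM0 : 0 ≤ M := le_trans (by positivity) hM
  have H := N.bounds (-κ) hx₁'
  have hp := Real.exp_pos (-κ)
  have hlt := H.h_lt
  have habs : |-h| ≤ Real.exp (-κ) := by rw [abs_neg, abs_of_pos hh]; exact hlt.le
  set R := max (max r (Real.exp (3 * κ))) (u + v + u * v / h + 1) with hR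
  have hRh : u + v + u * v / h < R := lt_of_lt_of_le (lt_add_one _) (le_max_right _ _)
  have hR3 : Real.exp (3 * κ) ≤ R := (le_max_right _ _).trans (le_max_left _ _)
  have hwx : ∀ x, |x| ≤ 3 * κ → ∀ z : ℂ, Real.exp x ≤ ‖z‖ →
      DifferentiableAt ℂ (wave b u v n₂ j₂ t) z := fun x hx z hz => N.differentiableAt_wave hx hz
  rw [scat_integral_deform (m := ((Real.exp (-κ) + -h) / 2 : ℝ)) (ρ := (Real.exp (-κ) - -h) / 2)
    (R := R) hr.1 (by linarith) ((le_max_left _ _).trans (le_max_left _ _)) hr.2.2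
    (fun z₁ z₂ h₁ h₂ => N.scatDenom_ne_zero hRh (N.le_norm_of_outside_diam hx₁' h₁) h₂)
    (fun z hz => hr.differentiableAt_wave hz _ _ _)
    (fun z hz => N.differentiableAt_wave_diam hx₁' hz)
    (fun z hz => hr.differentiableAt_wave hz _ _ _)]
  have hw0 : 0 ≤ (√(t : ℝ))⁻¹ := by positivity
  refine (norm_circleIntegral_le_gauss (c := c) (t := t) (k := 2 + j₁ + j₂)
    (K := (K₁ + 2 * Real.pi * K₂) * M * (√(t : ℝ))⁻¹ ^ (1 + j₁ + j₂)) (by linarith)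
      (by linarith [(N.half_le_exp hx₁').2]) hc N.one_le_t (by positivity) fun θ => ?_).trans
    (le_of_eq (by simp only [pow_add]; ring))
  change ‖∮ z₂ in C(0, R), scat u v (diamCircle (-h) (Real.exp (-κ)) θ) z₂ *
    wave b u v n₁ j₁ t (diamCircle (-h) (Real.exp (-κ)) θ) * wave b u v n₂ j₂ t z₂‖ ≤ _
  have P := N.pointBound_diam hx₁' θ
  have hzle := norm_diamCircle_le habs θ
  have hres := H₂ u v κ t N (-κ) (-h) M θ n₁ n₂ hx₁ (Or.inr rfl)
  have hin := fun x hx => H₁ u v κ t N x (ang t θ) M _ n₁ n₂ hx (ang_nonneg t θ) P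
  generalize hz : diamCircle (-h) (Real.exp (-κ)) θ = z at *
  have hzh := P.le_norm
  have hz0 : 0 < ‖z‖ := hh.trans_le hzh
  have hz0' : z ≠ 0 := norm_pos_iff.1 hz0
  have hMx : ∀ y : ℝ, Real.exp κ ≤ y → ‖z‖ ^ ((n₁ : ℝ) - speed b u v * t) *
      y ^ ((n₂ : ℝ) - speed b u v * t) ≤ M := by
    intro y hy
    refine le_trans ?_ hM
    refine mul_le_mul (Real.rpow_le_rpow hz0.le hzle hA)
      (Real.rpow_le_rpow_of_nonpos (Real.exp_pos _) hy hB) ?_ (by positivity)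
    have := (Real.exp_pos κ).trans_le hy
    positivity
  have hs := ang_nonneg t θ
  have hpR : ‖poleMap u v z‖ < R := by
    refine lt_of_le_of_lt ((norm_poleMap_le (by linarith) (by linarith) z).trans ?_) hRh
    gcongr
  have e3 : Real.exp (3 * κ) = Real.exp (2 * κ) * Real.exp κ := by rw [← Real.exp_add]; ring_nf
  have e2 : Real.exp (2 * κ) = Real.exp κ * Real.exp κ := by rw [← Real.exp_add]; ring_nf
  have e1 := Real.add_one_le_exp κ
  have E₂ : Real.exp κ + κ ≤ Real.exp (2 * κ) := by
    rw [e2]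
    linarith [mul_nonneg (Real.exp_pos κ).le (by linarith : 0 ≤ Real.exp κ - (κ + 1)),
      mul_nonneg (by linarith : 0 ≤ Real.exp κ - 1) h0.le]
  have E₃ : Real.exp (2 * κ) + κ ≤ Real.exp (3 * κ) := by
    rw [e3]
    linarith [mul_nonneg (Real.exp_pos (2 * κ)).le (by linarith : 0 ≤ Real.exp κ - (κ + 1)),
      mul_nonneg (by linarith : 0 ≤ Real.exp (2 * κ) - 1) h0.le]
  -- The threshold `exp (2κ)` separates two radii: below it `exp (3κ)` leaves the pole inside, above
  -- it `exp κ` leaves the pole outside and gives a residue. Either way the gap is at least `κ / 2`,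
  -- and every modulus carrying the nonpositive exponent is at least `exp κ`.
  rcases le_or_gt ‖poleMap u v z‖ (Real.exp (2 * κ)) with hcase | hcase
  · have hgap : ‖poleMap u v z‖ + κ / 2 ≤ Real.exp (3 * κ) := by linarith
    rw [scat_inner_eq_of_norm_lt hz0' (Real.exp_pos (3 * κ)) hR3 (by linarith) (hwx _ hx3)]
    refine (hin (3 * κ) hx3 ?_ (hMx _ (Real.exp_le_exp.2 (by linarith)))).trans ?_
    · rw [abs_sub_comm]
      exact le_trans (by linarith) (le_abs_self _)
    · gcongr
      have : 0 ≤ 2 * Real.pi * K₂ := by positivity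
      linarith
  · have hgap : Real.exp κ + κ / 2 ≤ ‖poleMap u v z‖ := by linarith
    have hzbv : z ≠ (b * v : ℝ) := by
      rw [← hz]
      refine ne_ofReal_of_le_norm_sub (by linarith [H.hop_pole.1] : -h < b * v) H.hop_pole.2 ?_
      rw [diamCircle, circleMap_sub_center, norm_circleMap_zero]
      exact le_abs_self _
    rw [scat_inner_eq_add_residue hz0' (Real.exp_pos κ) (by linarith) hpR (hwx _ hxκ),
      scatResidue_wave hz0' hzbv]
    refine (norm_add_le _ _).trans ?_
    rw [norm_mul, norm_two_pi_I]
    have B₁ := hin κ hxκ (le_trans (by linarith) (le_abs_self _)) (hMx _ le_rfl)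
    have B₂ := hres (hMx _ (by linarith))
    calc _ ≤ _ := add_le_add B₁ (mul_le_mul_of_nonneg_left B₂ (by positivity))
      _ = _ := by ring

/-- As `n₁ ≥ n₂`, three sign patterns of the drift-corrected displacements occur, each with its own
pair of contours. When both have the same sign, the residue decays only in the larger of the two
absolute values, hence the rate `κ / 2`. -/
theorem exists_norm_scatKernel_le (hb : b ∈ Ioo (0 : ℝ) 1) (hc : 0 < c)
    (hh : 0 < h) (hk : 0 < k) (hK : 0 < K) (j₁ j₂ : ℕ) : ∃ K' > 0, ∀ (u v κ r : ℝ) (t : ℕ),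
      NearCritical b c h k K u v κ t → Encloses b u v r → ∀ n₁ n₂ : ℤ,
      (j₂ : ℤ) + 2 ≤ n₁ - n₂ →
      ‖scatKernel b u v r n₁ n₂ j₁ j₂ t‖ ≤ K' * (√(t : ℝ))⁻¹ ^ (2 + j₁ + j₂) *
        Real.exp (-(κ / 2 * (|(n₁ : ℝ) - speed b u v * t| + |(n₂ : ℝ) - speed b u v * t|))) := by
  obtain ⟨K₁, hK₁, H₁⟩ := exists_norm_scat_integral_concentric_le hb hc hh hk hK j₁ j₂
  obtain ⟨K₂, hK₂, H₂⟩ := exists_norm_scat_integral_diam_le hb hc hh hk hK j₁ j₂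
  refine ⟨K₁ + K₂, by positivity, ?_⟩
  intro u v κ r t N hr n₁ n₂ hn
  refine (norm_scatKernel_le _ _ _ _ _ _ _ _ _).trans ?_
  have hn' : ((n₂ : ℤ) : ℝ) ≤ n₁ := by exact_mod_cast (by linarith : n₂ ≤ n₁)
  have h0 := N.kappa_pos
  have hu := N.one_le_u
  have hv := N.le_v
  have hABdef : (n₂ : ℝ) - speed b u v * t ≤ (n₁ : ℝ) - speed b u v * t := by linarith
  specialize H₁ u v κ r t N hr
  specialize H₂ u v κ r t N hr
  generalize hMdef : Real.exp (-(κ / 2 * (|(n₁ : ℝ) - speed b u v * t| +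
    |(n₂ : ℝ) - speed b u v * t|))) = M
  have hM0 : 0 ≤ M := hMdef ▸ (Real.exp_pos _).le
  have hw0 : 0 ≤ (√(t : ℝ))⁻¹ ^ (2 + j₁ + j₂) := by positivity
  have fin₁ : K₁ * M * (√(t : ℝ))⁻¹ ^ (2 + j₁ + j₂) ≤
      (K₁ + K₂) * (√(t : ℝ))⁻¹ ^ (2 + j₁ + j₂) * M := by
    nlinarith [mul_nonneg (mul_nonneg hK₂.le hM0) hw0]
  have fin₂ : K₂ * M * (√(t : ℝ))⁻¹ ^ (2 + j₁ + j₂) ≤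
      (K₁ + K₂) * (√(t : ℝ))⁻¹ ^ (2 + j₁ + j₂) * M := by
    nlinarith [mul_nonneg (mul_nonneg hK₁.le hM0) hw0]
  have hpow : ∀ x y : ℝ, Real.exp x ^ ((n₁ : ℝ) - speed b u v * t) *
      Real.exp y ^ ((n₂ : ℝ) - speed b u v * t) = Real.exp (x * ((n₁ : ℝ) - speed b u v * t) +
        y * ((n₂ : ℝ) - speed b u v * t)) := fun x y => by
    rw [← Real.exp_mul, ← Real.exp_mul, ← Real.exp_add]
  -- Two regroupings through `poleNum z = z * poleMap z`, chosen so that the exponents on the right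
  -- have known signs: nonnegative for the first when both displacements are nonnegative,
  -- nonpositive for the second when both are nonpositive.
  have hprod : ∀ z : ℂ, z ≠ 0 → poleMap u v z ≠ 0 →
      (‖z‖ ^ ((n₁ : ℝ) - speed b u v * t) * ‖poleMap u v z‖ ^ ((n₂ : ℝ) - speed b u v * t) =
        ‖z‖ ^ ((n₁ : ℝ) - n₂) * ‖poleNum u v z‖ ^ ((n₂ : ℝ) - speed b u v * t)) ∧
      (‖z‖ ^ ((n₁ : ℝ) - speed b u v * t) * ‖poleMap u v z‖ ^ ((n₂ : ℝ) - speed b u v * t) =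
        ‖poleNum u v z‖ ^ ((n₁ : ℝ) - speed b u v * t) * ‖poleMap u v z‖ ^ ((n₂ : ℝ) - n₁)) := by
    intro z hz hp
    have hz0 := norm_pos_iff.2 hz
    have hp0 := norm_pos_iff.2 hp
    have e : ‖poleNum u v z‖ = ‖z‖ * ‖poleMap u v z‖ := by
      rw [poleMap_eq_div hz, norm_div, mul_div_cancel₀ _ hz0.ne']
    rw [e, Real.mul_rpow hz0.le hp0.le, Real.mul_rpow hz0.le hp0.le, ← mul_assoc,
      ← Real.rpow_add hz0, mul_assoc, ← Real.rpow_add hp0]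
    constructor <;> congr 2 <;> ring
  rcases le_total 0 ((n₁ : ℝ) - speed b u v * t) with hA | hA
  · rcases le_total ((n₂ : ℝ) - speed b u v * t) 0 with hB | hB
    -- Opposite signs ask for `|z₁| < 1 < |z₂|`, with the pole possibly on either side: the case of
    -- a second radius depending on `z₁`.
    · refine (H₂ M n₁ n₂ hA hB ?_).trans fin₂
      rw [hpow, ← hMdef, abs_of_nonneg hA, abs_of_nonpos hB]
      exact Real.exp_le_exp.2 (by nlinarith)
    -- Both displacements nonnegative: radii `exp (-κ)` and `exp (-2κ)`, and the residue on the
    -- circle with diameter `[h, exp (-κ)]`, where `|poleNum| ≤ exp (-κ)`.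
    · have hx₁ : |-κ| ≤ 2 * κ := by rw [abs_neg, abs_of_pos h0]; linarith
      have hx₂ : |-(2 * κ)| ≤ 3 * κ := by rw [abs_neg, abs_of_pos (by linarith)]; linarith
      have H := N.bounds (-κ) (by linarith)
      obtain ⟨hg, hle⟩ := N.poleMap_exp_neg
      refine (H₁ (-κ) (-(2 * κ)) h M n₁ n₂ hn hx₁ hx₂ (Or.inl rfl) hg ?_ ?_).trans fin₁
      · rw [hpow, ← hMdef, abs_of_nonneg hA, abs_of_nonneg hB]
        exact Real.exp_le_exp.2 (by nlinarith)
      · intro θ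
        have hhr : |h| ≤ Real.exp (-κ) := by rw [abs_of_pos hh]; exact H.h_lt.le
        have hz0 : 0 < ‖diamCircle h (Real.exp (-κ)) θ‖ :=
          hh.trans_le ((abs_of_pos hh).symm.trans_le (le_norm_diamCircle hhr θ))
        have hp0 : 0 < ‖poleMap u v (diamCircle h (Real.exp (-κ)) θ)‖ := by
          have := H.le_norm_poleMap hh (Or.inl rfl) θ
          linarith [Real.exp_pos (-(2 * κ))]
        rw [(hprod _ (norm_pos_iff.1 hz0) (norm_pos_iff.1 hp0)).1]
        have hN : ‖poleNum u v (diamCircle h (Real.exp (-κ)) θ)‖ ≤ Real.exp (-κ) :=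
          (H.norm_poleNum_le hh (by linarith) θ).trans
            (mul_le_of_le_one_right (Real.exp_pos _).le hle)
        calc _ ≤ Real.exp (-κ) ^ ((n₁ : ℝ) - n₂) *
              Real.exp (-κ) ^ ((n₂ : ℝ) - speed b u v * t) :=
              mul_le_mul (Real.rpow_le_rpow hz0.le (norm_diamCircle_le hhr θ) (by linarith))
                (Real.rpow_le_rpow (norm_nonneg _) hN hB) (by positivity) (by positivity)
          _ ≤ M := by
              rw [← Real.exp_mul, ← Real.exp_mul, ← Real.exp_add, ← hMdef, abs_of_nonneg hA,
                abs_of_nonneg hB]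
              exact Real.exp_le_exp.2 (by nlinarith)
  -- Both nonpositive: radii `exp (2κ)` and `exp κ`, and the residue on the circle with left end
  -- `-h`, where `|poleNum|` and `|poleMap|` are at least `exp κ`.
  · have hB : (n₂ : ℝ) - speed b u v * t ≤ 0 := by linarith
    have hx₁ : |2 * κ| ≤ 2 * κ := by rw [abs_of_pos (by linarith)]
    have hx₂ : |κ| ≤ 3 * κ := by rw [abs_of_pos (by linarith)]; linarith
    have H := N.bounds (2 * κ) (by linarith)
    have hg := N.poleMap_exp_two
    have hκ1 : Real.exp κ ≤ u + v - u * v / Real.exp (2 * κ) := by linarith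
    refine (H₁ (2 * κ) κ (-h) M n₁ n₂ hn hx₁ hx₂ (Or.inr rfl) hg ?_ ?_).trans fin₁
    · rw [hpow, ← hMdef, abs_of_nonpos hA, abs_of_nonpos hB]
      exact Real.exp_le_exp.2 (by nlinarith)
    · intro θ
      have hhr : |-h| ≤ Real.exp (2 * κ) := by rw [abs_neg, abs_of_pos hh]; exact H.h_lt.le
      have hz0 : 0 < ‖diamCircle (-h) (Real.exp (2 * κ)) θ‖ :=
        hh.trans_le (((abs_neg h).trans (abs_of_pos hh)).symm.trans_le (le_norm_diamCircle hhr θ))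
      have hp1 : Real.exp κ ≤ ‖poleMap u v (diamCircle (-h) (Real.exp (2 * κ)) θ)‖ :=
        hκ1.trans (H.le_norm_poleMap hh (Or.inr rfl) θ)
      have hp0 := (Real.exp_pos κ).trans_le hp1
      rw [(hprod _ (norm_pos_iff.1 hz0) (norm_pos_iff.1 hp0)).2]
      have hN : Real.exp κ ≤ ‖poleNum u v (diamCircle (-h) (Real.exp (2 * κ)) θ)‖ := by
        refine hκ1.trans (le_trans ?_ (H.le_norm_poleNum hh (by linarith) θ))
        refine le_mul_of_one_le_left (by linarith [Real.exp_pos κ]) ?_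
        exact Real.one_le_exp (by linarith)
      calc _ ≤ Real.exp κ ^ ((n₁ : ℝ) - speed b u v * t) * Real.exp κ ^ ((n₂ : ℝ) - n₁) :=
            mul_le_mul (Real.rpow_le_rpow_of_nonpos (Real.exp_pos _) hN hA)
              (Real.rpow_le_rpow_of_nonpos (Real.exp_pos _) hp1 (by linarith))
              (by positivity) (by positivity)
        _ ≤ M := by
            rw [← Real.exp_mul, ← Real.exp_mul, ← Real.exp_add, ← hMdef, abs_of_nonpos hA,
              abs_of_nonpos hB]
            exact Real.exp_le_exp.2 (by nlinarith)

theorem Encloses.freeKernel_eq {r ρ : ℝ} (h : Encloses b u v r) (hρ : 0 < ρ) {n : ℤ} {j : ℕ}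
    (hd : ∀ z : ℂ, ρ ≤ ‖z‖ → DifferentiableAt ℂ (wave b u v n j t) z) :
    freeKernel b u v r n j t = contour ρ (wave b u v n j t) := by
  unfold freeKernel contour
  congr 1
  rw [← circleIntegral_eq_of_annulus (R := max r ρ) h.1 (le_max_left _ _) fun z hz _ =>
    h.differentiableAt_wave (by rwa [sub_zero] at hz) _ _ _]
  exact circleIntegral_eq_of_annulus hρ (le_max_right _ _) fun z hz _ =>
    hd z (by rwa [sub_zero] at hz)

/-- The radius is `exp (-κ)` or `exp κ` according to the sign of `n - μ t`, so the power of the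
radius becomes the exponential weight. -/
theorem exists_norm_freeKernel_le (hc : 0 < c) (hh : 0 < h) (hK : 0 < K) (j : ℕ) :
    ∃ K' > 0, ∀ (u v κ r : ℝ) (t : ℕ), NearCritical b c h k K u v κ t → Encloses b u v r →
      ∀ n : ℤ, ‖freeKernel b u v r n j t‖ ≤ K' * (√(t : ℝ))⁻¹ ^ (1 + j) *
        Real.exp (-(κ * |(n : ℝ) - speed b u v * t|)) := by
  have hG := gaussConst_pos hc j
  refine ⟨gaussConst c j * (h⁻¹ * (6 * K + 4) ^ j * Real.exp (2 / (1 - b) ^ 2 * (6 * K) ^ 2)),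
    by positivity, ?_⟩
  intro u v κ r t N hr n
  have h0 := N.kappa_pos
  have key : ∀ x, |x| ≤ 3 * κ → ‖freeKernel b u v r n j t‖ ≤
      gaussConst c j * (h⁻¹ * (6 * K + 4) ^ j * Real.exp (2 / (1 - b) ^ 2 * (6 * K) ^ 2)) *
        (√(t : ℝ))⁻¹ ^ (1 + j) * Real.exp (x * ((n : ℝ) - speed b u v * t)) := by
    intro x hx
    have hp := Real.exp_pos x
    rw [hr.freeKernel_eq hp fun z hz => N.differentiableAt_wave hx hz]
    refine (norm_contour_le _ _).trans ?_
    refine (norm_circleIntegral_le_gauss (c := c) (t := t) (k := j) (K := h⁻¹ *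
      Real.exp (x * ((n : ℝ) - speed b u v * t)) * ((6 * K + 4) * (√(t : ℝ))⁻¹) ^ j *
      Real.exp (2 / (1 - b) ^ 2 * (6 * K) ^ 2)) hp.le (N.half_le_exp hx).2 hc N.one_le_t
      (by positivity) fun θ => ?_).trans (le_of_eq ?_)
    · have h1 := (N.pointBound_circle hx (N.bounds x hx).h_lt.le θ).norm_wave_le hh n j
      rw [norm_circleMap_zero, abs_of_pos hp, ← Real.exp_mul] at h1
      refine h1.trans (le_of_eq ?_)
      simp only [mul_pow]
      ring
    · simp only [mul_pow, pow_add]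
      ring
  rcases le_total 0 ((n : ℝ) - speed b u v * t) with hA | hA
  · have := key (-κ) (by rw [abs_neg, abs_of_pos h0]; linarith)
    rwa [abs_of_nonneg hA, ← neg_mul]
  · have := key κ (by rw [abs_of_pos h0]; linarith)
    rwa [abs_of_nonpos hA, ← neg_mul, neg_mul_neg]

end

end S6V

/-! ### Time zero and the subcritical regime -/

namespace S6V

open Set Metric Function Filter Topology

variable {b u v r : ℝ}

theorem norm_double_circleIntegral_le {F : ℂ → ℂ → ℂ} {c₁ c₂ : ℂ} {r₁ r₂ C : ℝ} (h₁ : 0 ≤ r₁)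
    (h₂ : 0 ≤ r₂) (hF : ∀ z₁ ∈ sphere c₁ r₁, ∀ z₂ ∈ sphere c₂ r₂, ‖F z₁ z₂‖ ≤ C) :
    ‖∮ z₁ in C(c₁, r₁), ∮ z₂ in C(c₂, r₂), F z₁ z₂‖ ≤
      2 * Real.pi * r₁ * (2 * Real.pi * r₂ * C) :=
  circleIntegral.norm_integral_le_of_norm_le_const h₁ fun z₁ hz₁ =>
    circleIntegral.norm_integral_le_of_norm_le_const h₂ fun z₂ hz₂ => hF z₁ hz₁ z₂ hz₂

theorem norm_scatDenom_le (hu : 0 ≤ u) (hv : 0 ≤ v) (z₁ z₂ : ℂ) :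
    ‖scatDenom u v z₁ z₂‖ ≤ u * v + ‖z₁‖ * ‖z₂‖ + (u + v) * ‖z₁‖ := by
  unfold scatDenom
  refine (norm_sub_le _ _).trans (add_le_add ((norm_add_le _ _).trans ?_) ?_)
  · rw [norm_mul, norm_mul, Complex.norm_real, Complex.norm_real, Real.norm_eq_abs,
      Real.norm_eq_abs, abs_of_nonneg hu, abs_of_nonneg hv]
  · rw [norm_mul, ← Complex.ofReal_add, Complex.norm_real, Real.norm_eq_abs,
      abs_of_nonneg (by linarith)]

theorem norm_scat_le (hu : 0 ≤ u) (hv : 0 ≤ v) {z₁ z₂ : ℂ} {g D : ℝ} (hz : 0 < ‖z₁‖) (hg : 0 < g)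
    (hgap : g ≤ |‖z₂‖ - ‖poleMap u v z₁‖|)
    (hD : u * v + ‖z₂‖ * ‖z₁‖ + (u + v) * ‖z₂‖ ≤ D) : ‖scat u v z₁ z₂‖ ≤ D / (‖z₁‖ * g) := by
  rw [scat, scatDenom_eq_mul u v (norm_pos_iff.1 hz), norm_div, norm_mul]
  have h1 : g ≤ ‖z₂ - poleMap u v z₁‖ := hgap.trans (abs_norm_sub_norm_le _ _)
  have h2 := (norm_scatDenom_le hu hv z₂ z₁).trans hD
  have := norm_nonneg (scatDenom u v z₂ z₁)
  gcongr
  linarith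

theorem wave_zero_time (n : ℤ) (z : ℂ) : wave b u v n 0 0 z = z ^ (n - 1) := by
  simp [wave]

theorem Encloses.freeKernel_zero_time (h : Encloses b u v r) (n : ℤ) :
    freeKernel b u v r n 0 0 = if n = 0 then 1 else 0 := by
  have hf : freeKernel b u v r n 0 0 =
      (2 * Real.pi * Complex.I)⁻¹ * ∮ z in C(0, r), (z - 0) ^ (n - 1) := by
    unfold freeKernel contour
    congr 1
    refine circleIntegral.integral_congr h.1.le fun z _ => ?_
    simp only [wave_zero_time, sub_zero]
  rw [hf]
  split_ifs with hn
  · subst hn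
    simp only [zero_sub, zpow_neg_one]
    rw [circleIntegral.integral_sub_center_inv _ h.1.ne']
    exact inv_mul_cancel₀ (by simp [Real.pi_ne_zero, Complex.I_ne_zero])
  · rw [circleIntegral.integral_sub_zpow_of_ne (by omega), mul_zero]

/-- At time `0` the scattering part vanishes: shrink the first circle like `1 / R` while the second
one grows like `R`. -/
theorem Encloses.scatKernel_zero_time (h : Encloses b u v r) (hu : 0 < u) (hv : 0 < v) {n₁ n₂ : ℤ}
    (hn : 2 ≤ n₁ - n₂) : scatKernel b u v r n₁ n₂ 0 0 0 = 0 := by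
  set C : ℝ := (2 * Real.pi) ^ 2 * ((5 * (u * v) + (u + v)) / (2 * (u * v))) *
    (4 * (u * v)) ^ n₁ with hC
  have huv : 0 < u * v := mul_pos hu hv
  have key : ∀ᶠ R : ℝ in atTop, ‖scatKernel b u v r n₁ n₂ 0 0 0‖ ≤ C * R⁻¹ := by
    filter_upwards [eventually_ge_atTop r, eventually_ge_atTop 1,
      eventually_ge_atTop (4 * (u + v) + 1)] with R hRr hR1 hR2
    have hR0 : 0 < R := by linarith
    -- With this radius `u v / ρ = R / 4`, and `u + v ≤ R / 4` by the choice of `R`, so the pole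
    -- stays within `R / 2`.
    set ρ := 4 * (u * v) / R with hρ
    have hρ0 : 0 < ρ := by positivity
    have hpole : ∀ z : ℂ, ρ ≤ ‖z‖ → ‖poleMap u v z‖ ≤ R / 2 := by
      intro z hz
      refine (norm_poleMap_le hu.le hv.le z).trans ?_
      have : u * v / ‖z‖ ≤ u * v / ρ := by gcongr
      have e : u * v / ρ = R / 4 := by rw [hρ]; field_simp
      linarith
    refine (norm_scatKernel_le _ _ _ _ _ _ _ _ _).trans ?_
    have hne : ∀ (y : ℝ), 0 < y → ∀ z : ℂ, y ≤ ‖z‖ → z ≠ 0 := fun y hy z hz =>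
      norm_pos_iff.1 (hy.trans_le hz)
    have hd : ∀ (n : ℤ) (y : ℝ), 0 < y → ∀ z : ℂ, y ≤ ‖z‖ →
        DifferentiableAt ℂ (wave b u v n 0 0) z := by
      intro n y hy z hz
      have : wave b u v n 0 0 = fun z => z ^ (n - 1) := funext (wave_zero_time n)
      rw [this]
      exact differentiableAt_zpow.2 (Or.inl (hne y hy z hz))
    rw [scat_integral_deform (m := 0) (ρ := ρ) (R := R) h.1 hρ0 hRr h.2.2
      (fun z₁ z₂ h₁ h₂ => by
        rw [sub_zero] at h₁
        refine scatDenom_ne_zero_of_norm_ne (hne ρ hρ0 _ h₁) ?_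
        have := hpole z₁ h₁
        exact ne_of_gt (by linarith))
      (hd n₁ r h.1) (fun z hz => hd n₁ ρ hρ0 z (by rwa [sub_zero] at hz)) (hd n₂ r h.1)]
    refine (norm_double_circleIntegral_le (C := (5 * (u * v) + (u + v)) * R / (2 * (u * v)) *
      ρ ^ (n₁ - 1) * R ^ (n₂ - 1)) hρ0.le hR0.le fun z₁ h₁ z₂ h₂ => ?_).trans ?_
    · have hz₁ : ‖z₁‖ = ρ := by simpa using h₁
      have hz₂ : ‖z₂‖ = R := by simpa using h₂
      have hs : ‖scat u v z₁ z₂‖ ≤ (5 * (u * v) + (u + v)) * R / (‖z₁‖ * (R / 2)) := by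
        refine norm_scat_le hu.le hv.le (by rw [hz₁]; exact hρ0) (by positivity) ?_ ?_
        · refine le_trans ?_ (le_abs_self _)
          have := hpole z₁ hz₁.ge
          linarith
        · rw [hz₁, hz₂, hρ, mul_div_cancel₀ _ hR0.ne']
          have : u * v ≤ u * v * R := le_mul_of_one_le_right huv.le hR1
          linarith
      have e : ‖z₁‖ * (R / 2) = 2 * (u * v) := by rw [hz₁, hρ]; field_simp; ring
      rw [e] at hs
      rw [norm_mul, norm_mul, wave_zero_time, wave_zero_time, norm_zpow, norm_zpow, hz₁, hz₂]
      gcongr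
    · have e1 : ρ ^ (n₁ - 1) * ρ = (4 * (u * v)) ^ n₁ * (R ^ n₁)⁻¹ := by
        rw [← zpow_add_one₀ hρ0.ne', sub_add_cancel, hρ, div_zpow, div_eq_mul_inv]
      have e2 : R ^ (n₂ - 1) * R = R ^ n₂ := by rw [← zpow_add_one₀ hR0.ne', sub_add_cancel]
      -- The exponent is `1 - n₁ + n₂ ≤ -1`; this is where the gap of at least `2` enters.
      have e3 : R * ((R ^ n₁)⁻¹ * R ^ n₂) ≤ R⁻¹ := by
        have : R * ((R ^ n₁)⁻¹ * R ^ n₂) = R ^ (1 - n₁ + n₂) := by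
          rw [zpow_add₀ hR0.ne', zpow_sub₀ hR0.ne', zpow_one]
          ring
        rw [this, ← zpow_neg_one]
        exact zpow_le_zpow_right₀ hR1 (by omega)
      calc _ = C * (R * ((R ^ n₁)⁻¹ * R ^ n₂)) := by
            rw [hC]
            linear_combination (2 * Real.pi) ^ 2 *
              ((5 * (u * v) + (u + v)) * R / (2 * (u * v))) * (R ^ (n₂ - 1) * R * e1 +
              (4 * (u * v)) ^ n₁ * (R ^ n₁)⁻¹ * e2)
        _ ≤ C * R⁻¹ := by gcongr
  have hlim : Tendsto (fun R : ℝ => C * R⁻¹) atTop (𝓝 0) := by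
    simpa using tendsto_inv_atTop_zero.const_mul C
  exact norm_le_zero_iff.1 (ge_of_tendsto hlim key)

/-- The parameter regime in which `v` stays below `c² < 1`. -/
structure Subcritical (b c U u v : ℝ) : Prop where
  b_mem : b ∈ Ioo (0 : ℝ) 1
  c_mem : c ∈ Ioo (0 : ℝ) 1
  one_le_u : 1 ≤ u
  u_le : u ≤ U
  v_pos : 0 < v
  v_le : v ≤ c ^ 2

/-- A radius beyond all poles in the subcritical regime. -/
noncomputable def outerRadius (c U : ℝ) : ℝ := U + 2 + U / c + 1 / c

/-- A bound for the symbol on the circles of radius `c` and `outerRadius c U`. -/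
noncomputable def hopBound (b c U : ℝ) : ℝ :=
  1 / (1 - b) * ((outerRadius c U + U + 1) / (c - c ^ 2))

namespace Subcritical

variable {c U : ℝ}

theorem outer_bounds (S : Subcritical b c U u v) :
    U + 2 ≤ outerRadius c U ∧ U / c + (U + 2) ≤ outerRadius c U ∧ 1 / c ≤ outerRadius c U ∧
      U + 1 + U / c + 1 ≤ outerRadius c U := by
  have hc := S.c_mem.1
  have hU : 1 ≤ U := S.one_le_u.trans S.u_le
  have h1 : 0 < U / c := by positivity
  have h2 : 0 < 1 / c := by positivity
  unfold outerRadius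
  exact ⟨by linarith, by linarith, by linarith, by linarith⟩

theorem v_lt_one (S : Subcritical b c U u v) : v < 1 := by
  have := S.c_mem
  exact S.v_le.trans_lt (by nlinarith [this.1, this.2])

theorem coef_bounds (S : Subcritical b c U u v) :
    0 ≤ hopCoef b u v ∧ hopCoef b u v ≤ 1 / (1 - b) ∧ |u - b * u - b * v| ≤ U + 1 := by
  obtain ⟨hb0, hb1⟩ := S.b_mem
  have hv := S.v_lt_one
  have hv0 := S.v_pos
  have hu := S.one_le_u
  have h1 : 0 < b * v := by positivity
  have h2 : b * v < 1 := by nlinarith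
  have h4 : b * v ≤ b := mul_le_of_le_one_right hb0.le hv.le
  have h3 : 1 - b ≤ b + (u - b * u - b * v) := by nlinarith
  refine ⟨div_nonneg (by linarith) (by linarith), ?_, ?_⟩
  · unfold hopCoef
    have : 0 < 1 - b := by linarith
    gcongr
    linarith
  · have h5 : b * u ≤ u := mul_le_of_le_one_left (by linarith) hb1.le
    have h6 : 0 < b * u := by positivity
    rw [abs_le]
    constructor <;> linarith [S.u_le]

theorem norm_affine_le (S : Subcritical b c U u v) {z : ℂ} (hz : ‖z‖ ≤ outerRadius c U) :
    ‖(b : ℂ) * z + (u - b * u - b * v : ℝ)‖ ≤ outerRadius c U + U + 1 := by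
  refine (norm_add_le _ _).trans ?_
  rw [norm_mul, Complex.norm_real, Complex.norm_real, Real.norm_eq_abs, Real.norm_eq_abs,
    abs_of_pos S.b_mem.1]
  have h1 := S.coef_bounds.2.2
  have h2 : b * ‖z‖ ≤ ‖z‖ := mul_le_of_le_one_left (norm_nonneg _) S.b_mem.2.le
  linarith

theorem bv_lt (S : Subcritical b c U u v) : 0 < b * v ∧ b * v ≤ c ^ 2 ∧ c ^ 2 < c := by
  have hb := S.b_mem
  have hv0 := S.v_pos
  have hc := S.c_mem
  exact ⟨mul_pos hb.1 hv0, (mul_le_of_le_one_left hv0.le hb.2.le).trans S.v_le,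
    by nlinarith [hc.1, hc.2]⟩

theorem norm_hop_le (S : Subcritical b c U u v) {z : ℂ} (hcz : c ≤ ‖z‖)
    (hz : ‖z‖ ≤ outerRadius c U) : ‖hop b u v z‖ ≤ hopBound b c U := by
  obtain ⟨h1, h2, -⟩ := S.coef_bounds
  obtain ⟨h4, h5, h6⟩ := S.bv_lt
  have h7 : c - c ^ 2 ≤ ‖z - (b * v : ℝ)‖ := by
    have := norm_sub_norm_le z (b * v : ℝ)
    rw [Complex.norm_real, Real.norm_eq_abs, abs_of_pos h4] at this
    linarith
  have h8 : 0 < c - c ^ 2 := by linarith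
  have h9 := S.norm_affine_le hz
  have h10 := (norm_nonneg _).trans h9
  have h11 : 0 < 1 - b := by linarith [S.b_mem.2]
  unfold hop hopBound
  rw [norm_mul, norm_div, Complex.norm_real, Real.norm_eq_abs, abs_of_nonneg h1]
  gcongr

theorem one_le_hopBound (S : Subcritical b c U u v) : 1 ≤ hopBound b c U := by
  obtain ⟨hb0, hb1⟩ := S.b_mem
  obtain ⟨hc0, hc1⟩ := S.c_mem
  have h1 := S.outer_bounds.1
  have hU : 1 ≤ U := S.one_le_u.trans S.u_le
  have h2 : 0 < c - c ^ 2 := by linarith [S.bv_lt.2.2]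
  unfold hopBound
  refine one_le_mul_of_one_le_of_one_le ?_ ?_
  · rw [le_div_iff₀ (by linarith)]; linarith
  · rw [le_div_iff₀ h2]; nlinarith

theorem norm_wave_le (S : Subcritical b c U u v) {z : ℂ} (hcz : c ≤ ‖z‖)
    (hz : ‖z‖ ≤ outerRadius c U) (n : ℤ) {t N : ℕ} (ht : t ≤ N) :
    ‖wave b u v n 0 t z‖ ≤ ‖z‖ ^ n * (c⁻¹ * hopBound b c U ^ N) := by
  have hc := S.c_mem.1
  have hz0 : 0 < ‖z‖ := hc.trans_le hcz
  simp only [wave, pow_zero, mul_one]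
  rw [norm_mul, norm_zpow, norm_pow, zpow_sub_one₀ hz0.ne', mul_assoc]
  have h1 : ‖hop b u v z‖ ^ t ≤ hopBound b c U ^ N :=
    (pow_le_pow_left₀ (norm_nonneg _) (S.norm_hop_le hcz hz) t).trans
      (pow_le_pow_right₀ S.one_le_hopBound ht)
  gcongr

theorem differentiableAt_wave (S : Subcritical b c U u v) {z : ℂ} (hcz : c ≤ ‖z‖) (n : ℤ)
    (j t : ℕ) : DifferentiableAt ℂ (wave b u v n j t) z := by
  obtain ⟨h4, h5, h6⟩ := S.bv_lt
  refine S6V.differentiableAt_wave (norm_pos_iff.1 (S.c_mem.1.trans_le hcz)) ?_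
  rintro rfl
  rw [Complex.norm_real, Real.norm_eq_abs, abs_of_pos h4] at hcz
  linarith

theorem norm_poleMap_le (S : Subcritical b c U u v) {z : ℂ} (hcz : c ≤ ‖z‖) :
    ‖poleMap u v z‖ + 1 ≤ outerRadius c U := by
  have hc := S.c_mem.1
  have hu := S.one_le_u
  have hv := S.v_pos
  have h1 := S6V.norm_poleMap_le (by linarith : 0 ≤ u) hv.le z
  have h2 : u * v / ‖z‖ ≤ U * 1 / c := by
    have := S.u_le
    have := S.v_lt_one
    have hU : 0 ≤ U := by linarith
    gcongr
  have h3 := S.outer_bounds.2.2.2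
  have := S.u_le
  have := S.v_lt_one
  rw [mul_one] at h2
  linarith

/-- Since `u ≥ 1` and `v / c ≤ c`, one has `u + v - u v / c ≥ 1 - (v / c)(1 - c) ≥ 1 - c (1 - c) = c
+ (1 - c)²`. Hence both circles may have radius `c`, with the pole strictly outside. -/
theorem le_norm_poleMap (S : Subcritical b c U u v) {z : ℂ} (hz : ‖z‖ = c) :
    c + (1 - c) ^ 2 ≤ ‖poleMap u v z‖ := by
  have hc := S.c_mem.1
  have hu := S.one_le_u
  have hv := S.v_pos
  refine le_trans ?_ (S6V.le_norm_poleMap (by linarith) (by positivity) z)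
  rw [hz]
  have h1 : v / c ≤ c := by rw [div_le_iff₀ hc]; linarith [S.v_le]
  have h2 : u * v / c = u * (v / c) := by ring
  have h3 : 0 ≤ v / c := by positivity
  have h4 : v = v / c * c := by field_simp
  rw [h2]
  nlinarith [S.c_mem.2]

theorem denom_le (S : Subcritical b c U u v) {z₁ z₂ : ℂ} (h₁ : ‖z₁‖ ≤ outerRadius c U)
    (h₂ : ‖z₂‖ ≤ outerRadius c U) :
    u * v + ‖z₂‖ * ‖z₁‖ + (u + v) * ‖z₂‖ ≤ 3 * outerRadius c U ^ 2 := by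
  have hu := S.one_le_u
  have hu' := S.u_le
  have hv := S.v_pos
  have hv1 := S.v_lt_one
  have hR := S.outer_bounds.1
  have a1 : u * v ≤ outerRadius c U * outerRadius c U :=
    mul_le_mul (by linarith) (by linarith) hv.le (by linarith)
  have a2 : ‖z₂‖ * ‖z₁‖ ≤ outerRadius c U * outerRadius c U :=
    mul_le_mul h₂ h₁ (norm_nonneg _) (by linarith)
  have a3 : (u + v) * ‖z₂‖ ≤ outerRadius c U * outerRadius c U :=
    mul_le_mul (by linarith) h₂ (norm_nonneg _) (by linarith)
  linarith

theorem zpow_le (S : Subcritical b c U u v) {n : ℤ} (hn : n ≤ 0) :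
    outerRadius c U ^ n ≤ c ^ n.natAbs := by
  obtain ⟨m, rfl⟩ : ∃ m : ℕ, n = -m := ⟨n.natAbs, by omega⟩
  have hc := S.c_mem.1
  have h1 := S.outer_bounds.2.2.1
  have h2 : (outerRadius c U)⁻¹ ≤ c := by
    rw [inv_le_comm₀ (lt_of_lt_of_le (by positivity) h1) hc]
    simpa using h1
  rw [Int.natAbs_neg, Int.natAbs_natCast, zpow_neg, zpow_natCast, ← inv_pow]
  have : 0 < outerRadius c U := lt_of_lt_of_le (by positivity) h1
  exact pow_le_pow_left₀ (by positivity) h2 m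

end Subcritical

theorem zpow_eq_natAbs (c : ℝ) {n : ℤ} (hn : 0 ≤ n) : c ^ n = c ^ n.natAbs := by
  obtain ⟨m, rfl⟩ : ∃ m : ℕ, n = m := ⟨n.natAbs, by omega⟩
  simp

/-- Time is bounded, so the symbol contributes only a constant. Radius `c` is used for `n ≥ 0` and
the outer radius, at least `1 / c`, for `n ≤ 0`. -/
theorem exists_norm_freeKernel_subcritical_le (hb : b ∈ Ioo (0 : ℝ) 1) {c U : ℝ}
    (hc : c ∈ Ioo (0 : ℝ) 1) (hU : 1 ≤ U) (N : ℕ) : ∃ K > 0, ∀ (u v r : ℝ) (t : ℕ),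
      Subcritical b c U u v → Encloses b u v r → t ≤ N → ∀ n : ℤ,
      ‖freeKernel b u v r n 0 t‖ ≤ K * c ^ n.natAbs := by
  have S₀ : Subcritical b c U 1 (c ^ 2) := ⟨hb, hc, le_rfl, hU, by have := hc.1; positivity, le_rfl⟩
  have hc0 := hc.1
  have hπ := Real.pi_pos
  have hH : 0 < hopBound b c U := by linarith [S₀.one_le_hopBound]
  have hR : 0 < outerRadius c U := by linarith [S₀.outer_bounds.1]
  refine ⟨2 * Real.pi * (outerRadius c U) * (c⁻¹ * hopBound b c U ^ N), by positivity, ?_⟩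
  intro u v r t S hr ht n
  have hcR : c ≤ outerRadius c U := by linarith [S.outer_bounds.1, hc.2]
  have key : ∀ ρ, c ≤ ρ → ρ ≤ outerRadius c U → ‖freeKernel b u v r n 0 t‖ ≤
      2 * Real.pi * (outerRadius c U) * (c⁻¹ * hopBound b c U ^ N) * ρ ^ n := by
    intro ρ hρ hρ'
    have hρ0 : 0 < ρ := hc0.trans_le hρ
    rw [hr.freeKernel_eq hρ0 fun z hz => S.differentiableAt_wave (hρ.trans hz) _ _ _]
    refine (norm_contour_le _ _).trans
      ((circleIntegral.norm_integral_le_of_norm_le_const (C := ρ ^ n * (c⁻¹ * hopBound b c U ^ N))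
      hρ0.le fun z hz => ?_).trans ?_)
    · have hz' : ‖z‖ = ρ := by simpa using hz
      have := S.norm_wave_le (hρ.trans hz'.ge) (hz'.le.trans hρ') n ht
      rwa [hz'] at this
    · calc _ ≤ 2 * Real.pi * outerRadius c U * (ρ ^ n * (c⁻¹ * hopBound b c U ^ N)) := by gcongr
        _ = _ := by ring
  rcases le_total 0 n with hn | hn
  · exact (key c le_rfl hcR).trans_eq (by rw [zpow_eq_natAbs c hn])
  · refine (key _ hcR le_rfl).trans ?_
    have := S.zpow_le hn
    gcongr

/-- At the pole `p` of `hopPair` one has `p ≤ v ≤ c²` and `poleNum p = p b v`. On a small circle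
around it `|z| ≤ c` and `|poleNum z| ≤ c²`, and the exponents `m` and `l` of these two satisfy `m +
2l = n₁ + n₂ - 4`; the missing four powers are the constant `c⁻¹ ^ 4`. -/
theorem norm_residueWave_subcritical_le {c U : ℝ} (S : Subcritical b c U u v) {n₁ n₂ : ℤ}
    (hn : 2 ≤ n₁ - n₂) (hn₂ : 1 ≤ n₂) {t N : ℕ} (ht : t ≤ N) {η : ℝ} (hη0 : 0 < η)
    (hη : (U + 1) * η ≤ c ^ 2 - c ^ 4) {z : ℂ}
    (hz : ‖z - (u * v / (u + v - b * v) : ℝ)‖ = η) :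
    ‖residueWave b u v n₁ n₂ 0 0 t z‖ ≤ c ^ (n₁.natAbs + n₂.natAbs) *
      ((U + 1) * ((U + 1) * 2) * c⁻¹ ^ 4 *
        ((1 / (1 - b)) ^ 2 * U * ((outerRadius c U + U + 1) / η) + 1) ^ N) := by
  obtain ⟨hb0, hb1⟩ := S.b_mem
  obtain ⟨hc0, hc1⟩ := S.c_mem
  have hu := S.one_le_u
  have huU := S.u_le
  have hv := S.v_pos
  have hv1 := S.v_lt_one
  have hvc := S.v_le
  have hR := S.outer_bounds.1
  obtain ⟨hbv0, hbv, hcc⟩ := S.bv_lt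
  have hbvv : b * v ≤ v := mul_le_of_le_one_left hv.le hb1.le
  have hd : u ≤ u + v - b * v := by linarith
  have hd0 : 0 < u + v - b * v := by linarith
  set p := u * v / (u + v - b * v) with hp
  have hp0 : 0 < p := by positivity
  have hpv : p ≤ v := by
    rw [hp, div_le_iff₀ hd0, mul_comm u v]
    gcongr
  have hpmul : p * (u + v - b * v) = u * v := by
    rw [hp, div_mul_cancel₀ _ hd0.ne']
  have hηc : η ≤ c - c ^ 2 := by
    have h1 : 2 * η ≤ (U + 1) * η := by gcongr; linarith
    have h2 : c ^ 2 - c ^ 4 ≤ 2 * (c - c ^ 2) := by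
      have : 0 ≤ (c - c ^ 2) * (2 - c - c ^ 2) := mul_nonneg (by linarith) (by linarith)
      nlinarith
    linarith
  have hzc : ‖z‖ ≤ c := by
    have h1 := norm_add_le (z - (p : ℂ)) p
    rw [sub_add_cancel, hz, Complex.norm_real, Real.norm_eq_abs, abs_of_pos hp0] at h1
    linarith
  have hN : ‖poleNum u v z‖ ≤ c ^ 2 := by
    have e : poleNum u v z = (u + v : ℝ) * (z - (p : ℂ)) + ((p * (b * v) : ℝ) : ℂ) := by
      have : ((p * (b * v) : ℝ) : ℂ) = ((u + v : ℝ) : ℂ) * p - ((u * v : ℝ) : ℂ) := by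
        rw [← hpmul]
        push_cast
        ring
      rw [this]
      unfold poleNum
      push_cast
      ring
    rw [e]
    refine (norm_add_le _ _).trans ?_
    rw [norm_mul, hz, Complex.norm_real, Complex.norm_real, Real.norm_eq_abs, Real.norm_eq_abs,
      abs_of_pos (by linarith), abs_of_pos (by positivity)]
    have h1 : (u + v) * η ≤ (U + 1) * η := by gcongr
    have h2 : p * (b * v) ≤ c ^ 2 * c ^ 2 := by
      have := hpv.trans hvc
      gcongr
    have : c ^ 2 * c ^ 2 = c ^ 4 := by ring
    linarith
  have hpair : ‖hopPair b u v z‖ ≤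
      (1 / (1 - b)) ^ 2 * U * ((outerRadius c U + U + 1) / η) + 1 := by
    obtain ⟨h1, h2, -⟩ := S.coef_bounds
    have e : ((u + v - b * v : ℝ) : ℂ) * z - (u * v : ℝ) =
        (u + v - b * v : ℝ) * (z - (p : ℂ)) := by
      rw [← hpmul]
      push_cast
      ring
    have h3 := S.norm_affine_le (z := z) (by linarith)
    have h4 := (norm_nonneg _).trans h3
    unfold hopPair
    rw [e, norm_mul, norm_mul, norm_pow, norm_div, norm_mul, hz, Complex.norm_real,
      Complex.norm_real, Complex.norm_real, Real.norm_eq_abs, Real.norm_eq_abs, Real.norm_eq_abs,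
      abs_of_nonneg h1, abs_of_pos (by linarith : 0 < u), abs_of_pos hd0]
    have h5 : 1 * η ≤ (u + v - b * v) * η := by gcongr; linarith
    rw [one_mul] at h5
    have h6 : hopCoef b u v ^ 2 * u * (‖(b : ℂ) * z + (u - b * u - b * v : ℝ)‖ /
        ((u + v - b * v) * η)) ≤
        (1 / (1 - b)) ^ 2 * U * ((outerRadius c U + U + 1) / η) := by
      have : 0 < 1 - b := by linarith
      have : 0 ≤ (1 / (1 - b)) ^ 2 * U := mul_nonneg (sq_nonneg _) (by linarith)
      gcongr
    linarith
  have hpow : ‖hopPair b u v z‖ ^ t ≤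
      ((1 / (1 - b)) ^ 2 * U * ((outerRadius c U + U + 1) / η) + 1) ^ N := by
    refine (pow_le_pow_left₀ (norm_nonneg _) hpair t).trans (pow_le_pow_right₀ ?_ ht)
    have : 0 < 1 - b := by linarith
    have : 0 ≤ outerRadius c U + U + 1 := by linarith
    have : 0 ≤ (1 / (1 - b)) ^ 2 * U * ((outerRadius c U + U + 1) / η) :=
      mul_nonneg (mul_nonneg (sq_nonneg _) (by linarith)) (by positivity)
    linarith
  obtain ⟨m, hm⟩ : ∃ m : ℕ, n₁ - n₂ - 2 = m := ⟨(n₁ - n₂ - 2).toNat, by omega⟩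
  obtain ⟨l, hl⟩ : ∃ l : ℕ, n₂ - 1 = l := ⟨(n₂ - 1).toNat, by omega⟩
  have hml : n₁.natAbs + n₂.natAbs = m + 2 * l + 4 := by omega
  have hzy : ∀ y : ℝ, 0 ≤ y → ‖z - y‖ ≤ 1 + y := by
    intro y hy
    refine (norm_sub_le _ _).trans ?_
    rw [Complex.norm_real, Real.norm_eq_abs, abs_of_nonneg hy]
    linarith
  have hzu := hzy u (by linarith)
  have hzv := hzy v hv.le
  have huv : ‖(u : ℂ) + v‖ ≤ U + 1 := by
    rw [← Complex.ofReal_add, Complex.norm_real, Real.norm_eq_abs, abs_of_pos (by linarith)]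
    linarith
  unfold residueWave
  simp only [Nat.cast_zero, sub_zero, pow_zero, mul_one, hm, hl, zpow_natCast, norm_mul, norm_pow,
    hml]
  have hC : 0 ≤ U + 1 := by linarith
  calc _ ≤ (U + 1) * ((U + 1) * 2) * c ^ m * (c ^ 2) ^ l *
        ((1 / (1 - b)) ^ 2 * U * ((outerRadius c U + U + 1) / η) + 1) ^ N := by
        have hzu' : ‖z - u‖ ≤ U + 1 := by linarith
        have hzv' : ‖z - v‖ ≤ 2 := by linarith
        gcongr
    _ = _ := by
        rw [pow_add, pow_add, ← pow_mul]
        field_simp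

/-- For `n₂ ≤ 0` the second circle stays at the outer radius and the pole is never crossed. For `n₂
≥ 1` both circles shrink to `c`, and the residue has a single pole left, enclosed by a circle of
radius `η`. -/
theorem exists_norm_scatKernel_subcritical_le (hb : b ∈ Ioo (0 : ℝ) 1) {c U : ℝ}
    (hc : c ∈ Ioo (0 : ℝ) 1) (hU : 1 ≤ U) (N : ℕ) : ∃ K > 0, ∀ (u v r : ℝ) (t : ℕ),
      Subcritical b c U u v → Encloses b u v r → t ≤ N → ∀ n₁ n₂ : ℤ, 2 ≤ n₁ - n₂ →
      ‖scatKernel b u v r n₁ n₂ 0 0 t‖ ≤ K * c ^ (n₁.natAbs + n₂.natAbs) := by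
  have S₀ : Subcritical b c U 1 (c ^ 2) := ⟨hb, hc, le_rfl, hU, by have := hc.1; positivity, le_rfl⟩
  obtain ⟨hc0, hc1⟩ := hc
  have hπ := Real.pi_pos
  have hH : 0 < hopBound b c U := by linarith [S₀.one_le_hopBound]
  have hR0 : 0 < outerRadius c U := by linarith [S₀.outer_bounds.1]
  have hb1 : 0 < 1 - b := by linarith [hb.2]
  have hc4 : 0 < c ^ 2 - c ^ 4 := by
    have : c ^ 4 = c ^ 2 * c ^ 2 := by ring
    have h1 : c ^ 2 < 1 := by nlinarith
    have h2 : 0 < c ^ 2 := by positivity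
    nlinarith
  set η := (c ^ 2 - c ^ 4) / (U + 1) with hη
  have hη0 : 0 < η := by positivity
  have hηU : (U + 1) * η = c ^ 2 - c ^ 4 := by rw [hη]; field_simp
  set R := outerRadius c U with hR
  set D := 3 * R ^ 2 / (c * (1 - c) ^ 2) * (c⁻¹ * hopBound b c U ^ N) ^ 2 with hD
  set P := (U + 1) * ((U + 1) * 2) * c⁻¹ ^ 4 *
        ((1 / (1 - b)) ^ 2 * U * ((outerRadius c U + U + 1) / η) + 1) ^ N with hP
  have hc1' : 0 < 1 - c := by linarith
  have hD0 : 0 < D := by positivity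
  have hP0 : 0 < P := by positivity
  refine ⟨2 * Real.pi * R * (2 * Real.pi * R * D) + 2 * Real.pi * (2 * Real.pi * η * P),
    by positivity, ?_⟩
  intro u v r t S hr ht n₁ n₂ hn
  refine (norm_scatKernel_le _ _ _ _ _ _ _ _ _).trans ?_
  have hcR : c ≤ R := by linarith [S.outer_bounds.1]
  have hu := S.one_le_u
  have hv := S.v_pos
  have hdeform : ∀ ρ R', c ≤ ρ → r ≤ R' → R ≤ R' →
      (∮ z₁ in C(0, r), ∮ z₂ in C(0, r),
        scat u v z₁ z₂ * wave b u v n₁ 0 t z₁ * wave b u v n₂ 0 t z₂) =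
      ∮ z₁ in C(0, ρ), ∮ z₂ in C(0, R'),
        scat u v z₁ z₂ * wave b u v n₁ 0 t z₁ * wave b u v n₂ 0 t z₂ := by
    intro ρ R' hρ hrR hRR
    refine scat_integral_deform (m := 0) hr.1 (hc0.trans_le hρ) hrR hr.2.2
      (fun z₁ z₂ h₁ h₂ => ?_) (fun z hz => hr.differentiableAt_wave hz _ _ _)
      (fun z hz => S.differentiableAt_wave (hρ.trans (by rwa [sub_zero] at hz)) _ _ _)
      (fun z hz => hr.differentiableAt_wave hz _ _ _)
    rw [sub_zero] at h₁
    have := S.norm_poleMap_le (hρ.trans h₁)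
    exact scatDenom_ne_zero_of_norm_ne (norm_pos_iff.1 (hc0.trans_le (hρ.trans h₁)))
      (ne_of_gt (by linarith))
  have hinner : ∀ ρ R', c ≤ ρ → R ≤ R' →
      (∮ z₁ in C(0, ρ), ∮ z₂ in C(0, R'),
        scat u v z₁ z₂ * wave b u v n₁ 0 t z₁ * wave b u v n₂ 0 t z₂) =
      ∮ z₁ in C(0, ρ), ∮ z₂ in C(0, R),
        scat u v z₁ z₂ * wave b u v n₁ 0 t z₁ * wave b u v n₂ 0 t z₂ := by
    intro ρ R' hρ hRR
    refine circleIntegral.integral_congr (hc0.le.trans hρ) fun z₁ h₁ => ?_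
    have h₁' : ‖z₁‖ = ρ := by simpa using h₁
    have hcz : c ≤ ‖z₁‖ := hρ.trans h₁'.ge
    have := S.norm_poleMap_le hcz
    exact scat_inner_eq_of_norm_lt (norm_pos_iff.1 (hc0.trans_le hcz)) hR0 hRR (by linarith)
      fun z hz => S.differentiableAt_wave (hcR.trans hz) _ _ _
  have hbound : ∀ ρ₁ ρ₂, c ≤ ρ₁ → ρ₁ ≤ R → c ≤ ρ₂ → ρ₂ ≤ R →
      (∀ z₁ : ℂ, ‖z₁‖ = ρ₁ → (1 - c) ^ 2 ≤ |ρ₂ - ‖poleMap u v z₁‖|) →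
      ρ₁ ^ n₁ * ρ₂ ^ n₂ ≤ c ^ (n₁.natAbs + n₂.natAbs) →
      ‖∮ z₁ in C(0, ρ₁), ∮ z₂ in C(0, ρ₂),
        scat u v z₁ z₂ * wave b u v n₁ 0 t z₁ * wave b u v n₂ 0 t z₂‖ ≤
        2 * Real.pi * R * (2 * Real.pi * R * D) * c ^ (n₁.natAbs + n₂.natAbs) := by
    intro ρ₁ ρ₂ h1 h1' h2 h2' hgap hpow
    have hρ₁ : 0 < ρ₁ := hc0.trans_le h1
    have hρ₂ : 0 < ρ₂ := hc0.trans_le h2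
    refine (norm_double_circleIntegral_le (C := D * c ^ (n₁.natAbs + n₂.natAbs)) hρ₁.le hρ₂.le
      fun z₁ hz₁ z₂ hz₂ => ?_).trans ?_
    · replace hz₁ : ‖z₁‖ = ρ₁ := by simpa using hz₁
      replace hz₂ : ‖z₂‖ = ρ₂ := by simpa using hz₂
      have hs := norm_scat_le (g := (1 - c) ^ 2) (by linarith) hv.le (by rw [hz₁]; exact hρ₁)
        (by positivity)
        (by rw [hz₂]; exact hgap z₁ hz₁)
        (S.denom_le (hz₁.le.trans h1') (hz₂.le.trans h2'))
      have hs' : ‖scat u v z₁ z₂‖ ≤ 3 * R ^ 2 / (c * (1 - c) ^ 2) := by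
        refine hs.trans ?_
        rw [hz₁]
        gcongr
      have w₁ := S.norm_wave_le (h1.trans hz₁.ge) (hz₁.le.trans h1') n₁ ht
      have w₂ := S.norm_wave_le (h2.trans hz₂.ge) (hz₂.le.trans h2') n₂ ht
      rw [hz₁] at w₁
      rw [hz₂] at w₂
      rw [norm_mul, norm_mul]
      calc _ ≤ 3 * R ^ 2 / (c * (1 - c) ^ 2) * (ρ₁ ^ n₁ * (c⁻¹ * hopBound b c U ^ N)) *
            (ρ₂ ^ n₂ * (c⁻¹ * hopBound b c U ^ N)) := by gcongr
        _ = D * (ρ₁ ^ n₁ * ρ₂ ^ n₂) := by rw [hD]; ring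
        _ ≤ _ := by gcongr
    · calc _ ≤ 2 * Real.pi * R * (2 * Real.pi * R * (D * c ^ (n₁.natAbs + n₂.natAbs))) := by
            gcongr
        _ = _ := by ring
  have hcpow : 0 ≤ c ^ (n₁.natAbs + n₂.natAbs) := by positivity
  have hweak : 2 * Real.pi * R * (2 * Real.pi * R * D) * c ^ (n₁.natAbs + n₂.natAbs) ≤
      (2 * Real.pi * R * (2 * Real.pi * R * D) + 2 * Real.pi * (2 * Real.pi * η * P)) *
        c ^ (n₁.natAbs + n₂.natAbs) := by
    have : 0 < 2 * Real.pi * (2 * Real.pi * η * P) := by positivity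
    gcongr
    linarith
  have hc2 : (1 - c) ^ 2 ≤ 1 := by nlinarith
  have hgapR : ∀ ρ, c ≤ ρ → ∀ z₁ : ℂ, ‖z₁‖ = ρ → (1 - c) ^ 2 ≤ |R - ‖poleMap u v z₁‖| := by
    intro ρ hρ z₁ hz₁
    have := S.norm_poleMap_le (hρ.trans hz₁.ge)
    exact le_trans (by linarith) (le_abs_self _)
  rcases le_total n₂ 0 with hn₂ | hn₂
  · have hex : ∃ ρ, c ≤ ρ ∧ ρ ≤ R ∧ ρ ^ n₁ ≤ c ^ n₁.natAbs := by
      rcases le_total n₁ 0 with hn₁ | hn₁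
      · exact ⟨R, hcR, le_rfl, S.zpow_le hn₁⟩
      · exact ⟨c, le_rfl, hcR, (zpow_eq_natAbs c hn₁).le⟩
    obtain ⟨ρ, h1, h2, h3⟩ := hex
    have hρ0 : 0 < ρ := hc0.trans_le h1
    rw [hdeform ρ (max r R) h1 (le_max_left _ _) (le_max_right _ _),
      hinner ρ (max r R) h1 (le_max_right _ _)]
    refine (hbound ρ R h1 h2 hcR le_rfl (hgapR ρ h1) ?_).trans hweak
    rw [pow_add]
    have := S.zpow_le hn₂
    gcongr
  -- At `n₂ = 0` the residue would contain `poleNum⁻¹`. There the power of the second radius is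
  -- trivial anyway, so the outer circle is kept.
  · rcases hn₂.eq_or_lt with hn₂' | hn₂'
    · rw [hdeform c (max r R) le_rfl (le_max_left _ _) (le_max_right _ _),
        hinner c (max r R) le_rfl (le_max_right _ _)]
      refine (hbound c R le_rfl hcR hcR le_rfl (hgapR c le_rfl) ?_).trans hweak
      rw [← hn₂', zpow_zero, mul_one, zpow_eq_natAbs c (by omega)]
      simp
    · obtain ⟨hbv0, hbv, hcc⟩ := S.bv_lt
      have hgapc : ∀ z₁ : ℂ, ‖z₁‖ = c → (1 - c) ^ 2 ≤ |c - ‖poleMap u v z₁‖| := by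
        intro z₁ hz₁
        have := S.le_norm_poleMap hz₁
        rw [abs_sub_comm]
        exact le_trans (by linarith) (le_abs_self _)
      have hbvv : b * v ≤ v := mul_le_of_le_one_left hv.le hb.2.le
      have hd0 : 0 < u + v - b * v := by linarith
      set p := u * v / (u + v - b * v) with hp
      have hp0 : 0 < p := by positivity
      have hpv : p ≤ v := by
        rw [hp, div_le_iff₀ hd0, mul_comm u v]
        gcongr
        linarith
      have hηc : η ≤ c - c ^ 2 := by
        have h1 : 2 * η ≤ (U + 1) * η := by gcongr; linarith
        have h2 : c ^ 2 - c ^ 4 ≤ 2 * (c - c ^ 2) := by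
          have : 0 ≤ (c - c ^ 2) * (2 - c - c ^ 2) := mul_nonneg (by linarith) (by linarith)
          nlinarith
        linarith
      rw [hdeform c (max r R) le_rfl (le_max_left _ _) (le_max_right _ _),
        scat_integral_eq_add_residue hc0 hc0
          (fun z hz => ⟨by nlinarith [S.le_norm_poleMap hz, sq_pos_of_pos hc1'],
            by linarith [S.norm_poleMap_le hz.ge, le_max_right r R]⟩)
          (fun z hz => (S.differentiableAt_wave (by simp_all) _ _
            _).continuousAt.continuousWithinAt)
          (fun z hz => S.differentiableAt_wave hz _ _ _),
        integral_scatResidue_eq (m := (p : ℂ)) (ρ := η) hc0 hη0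
          (by rw [Complex.norm_real, Real.norm_eq_abs, abs_of_pos hp0]; linarith [S.v_le])
          (by rw [abs_of_pos hbv0]; linarith)
          (fun z hz => differentiableAt_residueWave (Or.inr (by simpa using hn)) (Or.inr hn₂')
            fun h0 => by
              have e : z = p := by
                have hd : ((u + v - b * v : ℝ) : ℂ) ≠ 0 := by exact_mod_cast hd0.ne'
                rw [hp, Complex.ofReal_div, eq_div_iff hd]
                linear_combination h0
              rw [e, sub_self, norm_zero] at hz
              linarith)]
      refine (norm_add_le _ _).trans ?_
      rw [add_mul]
      refine add_le_add (hbound c c le_rfl hcR le_rfl hcR hgapc ?_) ?_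
      · rw [zpow_eq_natAbs c (by omega), zpow_eq_natAbs c hn₂, pow_add]
      · rw [norm_mul, norm_two_pi_I]
        have := circleIntegral.norm_integral_le_of_norm_le_const
          (f := residueWave b u v n₁ n₂ 0 0 t) (c := (p : ℂ)) hη0.le fun z hz =>
          norm_residueWave_subcritical_le S hn hn₂' ht hη0 hηU.le
            (mem_sphere_iff_norm.1 hz)
        calc _ ≤ 2 * Real.pi * (2 * Real.pi * η * (c ^ (n₁.natAbs + n₂.natAbs) * P)) := by
              gcongr
          _ = _ := by ring

end S6V

/-! ### Uniform kernel bounds -/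

namespace S6V

open Set Metric Function Filter Topology

variable {b u v r : ℝ}

/-- Decay of the one-particle and the scattering kernels and of their discrete derivatives, at
scale `(t + 1)^(-1/2)` and exponential rate `κ`. -/
structure KernelBounds (b u v r κ K : ℝ) (t : ℕ) : Prop where
  free_zero : ∀ n : ℤ, ‖freeKernel b u v r n 0 t‖ ≤
    K * (√((t : ℝ) + 1))⁻¹ ^ 1 * Real.exp (-(κ * |(n : ℝ) - speed b u v * t|))
  free_one : ∀ n : ℤ, ‖freeKernel b u v r n 1 t‖ ≤
    K * (√((t : ℝ) + 1))⁻¹ ^ 2 * Real.exp (-(κ * |(n : ℝ) - speed b u v * t|))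
  scat_zero : ∀ n₁ n₂ : ℤ, 2 ≤ n₁ - n₂ → ‖scatKernel b u v r n₁ n₂ 0 0 t‖ ≤
    K * (√((t : ℝ) + 1))⁻¹ ^ 2 *
      Real.exp (-(κ * (|(n₁ : ℝ) - speed b u v * t| + |(n₂ : ℝ) - speed b u v * t|)))
  scat_left : ∀ n₁ n₂ : ℤ, 2 ≤ n₁ - n₂ → ‖scatKernel b u v r n₁ n₂ 1 0 t‖ ≤
    K * (√((t : ℝ) + 1))⁻¹ ^ 3 *
      Real.exp (-(κ * (|(n₁ : ℝ) - speed b u v * t| + |(n₂ : ℝ) - speed b u v * t|)))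
  scat_right : ∀ n₁ n₂ : ℤ, 3 ≤ n₁ - n₂ → ‖scatKernel b u v r n₁ n₂ 0 1 t‖ ≤
    K * (√((t : ℝ) + 1))⁻¹ ^ 3 *
      Real.exp (-(κ * (|(n₁ : ℝ) - speed b u v * t| + |(n₂ : ℝ) - speed b u v * t|)))

theorem KernelBounds.mono {κ K K' : ℝ} {t : ℕ} (H : KernelBounds b u v r κ K t) (hK : K ≤ K') :
    KernelBounds b u v r κ K' t := by
  have key : ∀ (k : ℕ) (x : ℝ), K * (√((t : ℝ) + 1))⁻¹ ^ k * Real.exp x ≤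
      K' * (√((t : ℝ) + 1))⁻¹ ^ k * Real.exp x := fun k x => by gcongr
  exact ⟨fun n => (H.free_zero n).trans (key _ _), fun n => (H.free_one n).trans (key _ _),
    fun n₁ n₂ h => (H.scat_zero n₁ n₂ h).trans (key _ _),
    fun n₁ n₂ h => (H.scat_left n₁ n₂ h).trans (key _ _),
    fun n₁ n₂ h => (H.scat_right n₁ n₂ h).trans (key _ _)⟩

/-- A shift by at most one changes the exponential weight by a bounded factor. -/
theorem exp_neg_mul_shift_le {κ A B : ℝ} (hκ : 0 ≤ κ) (hκ1 : κ ≤ 1) (h : A ≤ B + 1) :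
    Real.exp (-(κ * B)) ≤ 3 * Real.exp (-(κ * A)) := by
  have h1 : Real.exp (-(κ * B)) ≤ Real.exp (1 + -(κ * A)) := by
    refine Real.exp_le_exp.2 ?_
    nlinarith
  rw [Real.exp_add] at h1
  have := Real.exp_one_lt_d9
  refine h1.trans ?_
  gcongr
  linarith

/-- For `t ≤ N` the powers of `(t + 1)^(-1/2)` are bounded below and cost only a constant, and
gradients are estimated crudely as differences of kernels. -/
theorem KernelBounds.of_bounded_time {κ K : ℝ} {t N : ℕ} (hE : Encloses b u v r) (hκ : 0 ≤ κ)
    (hκ1 : κ ≤ 1) (hK : 0 ≤ K) (ht : t ≤ N)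
    (hf : ∀ n : ℤ, ‖freeKernel b u v r n 0 t‖ ≤
      K * Real.exp (-(κ * |(n : ℝ) - speed b u v * t|)))
    (hs : ∀ n₁ n₂ : ℤ, 2 ≤ n₁ - n₂ → ‖scatKernel b u v r n₁ n₂ 0 0 t‖ ≤
      K * Real.exp (-(κ * (|(n₁ : ℝ) - speed b u v * t| + |(n₂ : ℝ) - speed b u v * t|)))) :
    KernelBounds b u v r κ (4 * K * √((N : ℝ) + 1) ^ 3) t := by
  have hw : ∀ k : ℕ, k ≤ 3 → 1 ≤ √((N : ℝ) + 1) ^ 3 * (√((t : ℝ) + 1))⁻¹ ^ k := by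
    intro k hk
    have h1 : 1 ≤ √((t : ℝ) + 1) := by
      rw [Real.one_le_sqrt]
      linarith [(Nat.cast_nonneg t : (0 : ℝ) ≤ t)]
    have h2 : √((t : ℝ) + 1) ≤ √((N : ℝ) + 1) := by
      have : (t : ℝ) ≤ N := by exact_mod_cast ht
      exact Real.sqrt_le_sqrt (by linarith)
    rw [inv_pow, ← div_eq_mul_inv, one_le_div (by positivity)]
    exact (pow_le_pow_right₀ h1 hk).trans (pow_le_pow_left₀ (by linarith) h2 3)
  have fin : ∀ (k : ℕ) (X e : ℝ), k ≤ 3 → 0 ≤ e → X ≤ 4 * K * e →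
      X ≤ 4 * K * √((N : ℝ) + 1) ^ 3 * (√((t : ℝ) + 1))⁻¹ ^ k * e := by
    intro k X e hk he hX
    have := mul_le_mul_of_nonneg_left (hw k hk) (by positivity : 0 ≤ 4 * K * e)
    calc X ≤ 4 * K * e * 1 := by linarith
      _ ≤ _ := this
      _ = _ := by ring
  have diff : ∀ (x y : ℂ) (A B : ℝ), ‖x‖ ≤ K * Real.exp (-(κ * B)) →
      ‖y‖ ≤ K * Real.exp (-(κ * A)) → A ≤ B + 1 → ‖x - y‖ ≤ 4 * K * Real.exp (-(κ * A)) := by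
    intro x y A B hx hy hAB
    have h1 := mul_le_mul_of_nonneg_left (exp_neg_mul_shift_le hκ hκ1 hAB) hK
    linarith [norm_sub_le x y]
  have hshift : ∀ n : ℤ, |(n : ℝ) - speed b u v * t| ≤
      |((n + 1 : ℤ) : ℝ) - speed b u v * t| + 1 := by
    intro n
    have := abs_sub_abs_le_abs_sub ((n : ℝ) - speed b u v * t)
      (((n + 1 : ℤ) : ℝ) - speed b u v * t)
    have e : (n : ℝ) - speed b u v * t - (((n + 1 : ℤ) : ℝ) - speed b u v * t) = -1 := by
      push_cast
      ring
    rw [e, abs_neg, abs_one] at this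
    linarith
  refine ⟨fun n => fin 1 _ _ (by norm_num) (Real.exp_pos _).le ?_,
    fun n => fin 2 _ _ (by norm_num) (Real.exp_pos _).le ?_,
    fun n₁ n₂ hn => fin 2 _ _ (by norm_num) (Real.exp_pos _).le ?_,
    fun n₁ n₂ hn => fin 3 _ _ (by norm_num) (Real.exp_pos _).le ?_,
    fun n₁ n₂ hn => fin 3 _ _ (by norm_num) (Real.exp_pos _).le ?_⟩
  · refine (hf n).trans ?_
    gcongr
    linarith
  · rw [← freeKernel_succ_sub hE]
    exact diff _ _ _ _ (hf _) (hf _) (hshift n)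
  · refine (hs n₁ n₂ hn).trans ?_
    gcongr
    linarith
  · rw [← scatKernel_succ_left_sub hE]
    exact diff _ _ _ _ (hs _ _ (by omega)) (hs _ _ hn) (by linarith [hshift n₁])
  · rw [← scatKernel_succ_right_sub hE]
    exact diff _ _ _ _ (hs _ _ (by omega)) (hs _ _ (by omega)) (by linarith [hshift n₂])

/-- Convexity of the absolute value: for a given sum, the more spread pair has the larger total. -/
theorem abs_add_abs_le_of_add_eq {A B x y : ℝ} (hsum : x + y = A + B) (hx : B ≤ x) (hx' : x ≤ A) :
    |x| + |y| ≤ |A| + |B| := by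
  have hA := le_abs_self A
  have hA' := neg_le_abs A
  have hB := le_abs_self B
  have hB' := neg_le_abs B
  rcases abs_cases x with h | h <;> rcases abs_cases y with h' | h' <;> linarith

/-! ### From the kernels to the two-particle kernel and its four gradients. -/

section Pair

variable {κ K : ℝ} {t : ℕ} {X₁ X₂ Y₁ Y₂ : ℤ}

theorem KernelBounds.norm_mul_sub_le {a₁ a₂ s : ℂ} {A₁ A₂ S w : ℝ} {k l : ℕ} (hK : 0 ≤ K)
    (hκ : 0 ≤ κ) (hκ1 : κ ≤ 1) (hw : 0 ≤ w) {D : ℝ}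
    (h₁ : ‖a₁‖ ≤ K * w ^ k * Real.exp (-(κ * A₁))) (h₂ : ‖a₂‖ ≤ K * w ^ l * Real.exp (-(κ * A₂)))
    (hs : ‖s‖ ≤ K * w ^ (k + l) * Real.exp (-(κ * S))) (hA : D ≤ A₁ + A₂ + 1) (hS : D ≤ S + 1) :
    ‖a₁ * a₂ - s‖ ≤ 3 * (K ^ 2 + K) * w ^ (k + l) * Real.exp (-(κ * D)) := by
  have e₁ : Real.exp (-(κ * A₁)) * Real.exp (-(κ * A₂)) ≤ 3 * Real.exp (-(κ * D)) := by
    rw [← Real.exp_add, ← neg_add, ← mul_add]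
    exact exp_neg_mul_shift_le hκ hκ1 hA
  have e₂ := exp_neg_mul_shift_le hκ hκ1 hS
  calc ‖a₁ * a₂ - s‖ ≤ ‖a₁‖ * ‖a₂‖ + ‖s‖ := (norm_sub_le _ _).trans (by rw [norm_mul])
    _ ≤ (K * w ^ k * Real.exp (-(κ * A₁))) * (K * w ^ l * Real.exp (-(κ * A₂))) +
        K * w ^ (k + l) * Real.exp (-(κ * S)) := by gcongr
    _ = K ^ 2 * w ^ (k + l) * (Real.exp (-(κ * A₁)) * Real.exp (-(κ * A₂))) +
        K * w ^ (k + l) * Real.exp (-(κ * S)) := by rw [pow_add]; ring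
    _ ≤ K ^ 2 * w ^ (k + l) * (3 * Real.exp (-(κ * D))) +
        K * w ^ (k + l) * (3 * Real.exp (-(κ * D))) := by gcongr
    _ = _ := by ring

/-- The exchanged displacements have the same sum as the direct ones and surround them. The decay of
the scattering part is therefore at least as good as required. -/
theorem abs_displacement_le (hX : X₁ < X₂) (hY : Y₁ < Y₂) (m : ℝ) :
    |((X₁ - Y₁ : ℤ) : ℝ) - m| + |((X₂ - Y₂ : ℤ) : ℝ) - m| ≤
      |((X₂ - Y₁ : ℤ) : ℝ) - m| + |((X₁ - Y₂ : ℤ) : ℝ) - m| := by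
  have hX' : (X₁ : ℝ) < X₂ := by exact_mod_cast hX
  have hY' : (Y₁ : ℝ) < Y₂ := by exact_mod_cast hY
  refine abs_add_abs_le_of_add_eq ?_ ?_ ?_ <;> push_cast <;> linarith

theorem abs_pred_sub_le (n : ℤ) (m : ℝ) : |(n : ℝ) - m| ≤ |((n - 1 : ℤ) : ℝ) - m| + 1 := by
  have := abs_sub_abs_le_abs_sub ((n : ℝ) - m) (((n - 1 : ℤ) : ℝ) - m)
  have e : (n : ℝ) - m - (((n - 1 : ℤ) : ℝ) - m) = 1 := by push_cast; ring
  rw [e, abs_one] at this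
  linarith

theorem KernelBounds.norm_pairKernel_le (H : KernelBounds b u v r κ K t) (hK : 0 ≤ K)
    (hκ : 0 ≤ κ) (hκ1 : κ ≤ 1) (hX : X₁ < X₂) (hY : Y₁ < Y₂) :
    ‖pairKernel b u v r Y₁ Y₂ X₁ X₂ t‖ ≤ 3 * (K ^ 2 + K) * (√((t : ℝ) + 1))⁻¹ ^ 2 *
      Real.exp (-(κ * (|((X₁ - Y₁ : ℤ) : ℝ) - speed b u v * t| +
        |((X₂ - Y₂ : ℤ) : ℝ) - speed b u v * t|))) := by
  have := abs_displacement_le hX hY (speed b u v * t)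
  exact norm_mul_sub_le hK hκ hκ1 (by positivity) (H.free_zero _) (H.free_zero _)
    (H.scat_zero _ _ (by omega)) (by linarith) (by linarith)

/-- Differencing in `X₁` acts on the second scattering variable, and `poleMap z - 1` brings a factor
`z⁻¹` into the residue. The gap must then be at least `3`, which is the role of `X₁ + 1 < X₂`. -/
theorem KernelBounds.norm_pairKernel_sub_right_one_le (H : KernelBounds b u v r κ K t)
    (hE : Encloses b u v r) (hK : 0 ≤ K) (hκ : 0 ≤ κ) (hκ1 : κ ≤ 1) (hX : X₁ + 1 < X₂)
    (hY : Y₁ < Y₂) :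
    ‖pairKernel b u v r Y₁ Y₂ (X₁ + 1) X₂ t - pairKernel b u v r Y₁ Y₂ X₁ X₂ t‖ ≤
      3 * (K ^ 2 + K) * (√((t : ℝ) + 1))⁻¹ ^ 3 *
      Real.exp (-(κ * (|((X₁ - Y₁ : ℤ) : ℝ) - speed b u v * t| +
        |((X₂ - Y₂ : ℤ) : ℝ) - speed b u v * t|))) := by
  have := abs_displacement_le (by omega : X₁ < X₂) hY (speed b u v * t)
  have e : pairKernel b u v r Y₁ Y₂ (X₁ + 1) X₂ t - pairKernel b u v r Y₁ Y₂ X₁ X₂ t =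
      freeKernel b u v r (X₁ - Y₁) 1 t * freeKernel b u v r (X₂ - Y₂) 0 t -
        scatKernel b u v r (X₂ - Y₁) (X₁ - Y₂) 0 1 t := by
    rw [← freeKernel_succ_sub hE, ← scatKernel_succ_right_sub hE]
    unfold pairKernel
    rw [show X₁ + 1 - Y₁ = X₁ - Y₁ + 1 by ring, show X₁ + 1 - Y₂ = X₁ - Y₂ + 1 by ring]
    ring
  rw [e]
  exact norm_mul_sub_le (k := 2) (l := 1) hK hκ hκ1 (by positivity) (H.free_one _) (H.free_zero _)
    (H.scat_right _ _ (by omega)) (by linarith) (by linarith)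

theorem KernelBounds.norm_pairKernel_sub_right_two_le (H : KernelBounds b u v r κ K t)
    (hE : Encloses b u v r) (hK : 0 ≤ K) (hκ : 0 ≤ κ) (hκ1 : κ ≤ 1) (hX : X₁ < X₂)
    (hY : Y₁ < Y₂) :
    ‖pairKernel b u v r Y₁ Y₂ X₁ (X₂ + 1) t - pairKernel b u v r Y₁ Y₂ X₁ X₂ t‖ ≤
      3 * (K ^ 2 + K) * (√((t : ℝ) + 1))⁻¹ ^ 3 *
      Real.exp (-(κ * (|((X₁ - Y₁ : ℤ) : ℝ) - speed b u v * t| +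
        |((X₂ - Y₂ : ℤ) : ℝ) - speed b u v * t|))) := by
  have := abs_displacement_le hX hY (speed b u v * t)
  have e : pairKernel b u v r Y₁ Y₂ X₁ (X₂ + 1) t - pairKernel b u v r Y₁ Y₂ X₁ X₂ t =
      freeKernel b u v r (X₁ - Y₁) 0 t * freeKernel b u v r (X₂ - Y₂) 1 t -
        scatKernel b u v r (X₂ - Y₁) (X₁ - Y₂) 1 0 t := by
    rw [← freeKernel_succ_sub hE, ← scatKernel_succ_left_sub hE]
    unfold pairKernel
    rw [show X₂ + 1 - Y₁ = X₂ - Y₁ + 1 by ring, show X₂ + 1 - Y₂ = X₂ - Y₂ + 1 by ring]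
    ring
  rw [e]
  exact norm_mul_sub_le (k := 1) (l := 2) hK hκ hκ1 (by positivity) (H.free_zero _) (H.free_one _)
    (H.scat_left _ _ (by omega)) (by linarith) (by linarith)

/-- Raising `Y₁` lowers the displacements, so the gradient is based at `n - 1`. The gap loses one,
which `Y₁ + 1 < Y₂` compensates, and the shift in the weight is absorbed by the slack of one. -/
theorem KernelBounds.norm_pairKernel_sub_left_one_le (H : KernelBounds b u v r κ K t)
    (hE : Encloses b u v r) (hK : 0 ≤ K) (hκ : 0 ≤ κ) (hκ1 : κ ≤ 1) (hX : X₁ < X₂)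
    (hY : Y₁ + 1 < Y₂) :
    ‖pairKernel b u v r (Y₁ + 1) Y₂ X₁ X₂ t - pairKernel b u v r Y₁ Y₂ X₁ X₂ t‖ ≤
      3 * (K ^ 2 + K) * (√((t : ℝ) + 1))⁻¹ ^ 3 *
      Real.exp (-(κ * (|((X₁ - Y₁ : ℤ) : ℝ) - speed b u v * t| +
        |((X₂ - Y₂ : ℤ) : ℝ) - speed b u v * t|))) := by
  have := abs_displacement_le hX (by omega : Y₁ < Y₂) (speed b u v * t)
  have h1 := abs_pred_sub_le (X₁ - Y₁) (speed b u v * t)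
  have h2 := abs_pred_sub_le (X₂ - Y₁) (speed b u v * t)
  have e : pairKernel b u v r (Y₁ + 1) Y₂ X₁ X₂ t - pairKernel b u v r Y₁ Y₂ X₁ X₂ t =
      -(freeKernel b u v r (X₁ - Y₁ - 1) 1 t * freeKernel b u v r (X₂ - Y₂) 0 t -
        scatKernel b u v r (X₂ - Y₁ - 1) (X₁ - Y₂) 1 0 t) := by
    rw [← freeKernel_succ_sub hE, ← scatKernel_succ_left_sub hE]
    unfold pairKernel
    rw [show X₁ - (Y₁ + 1) = X₁ - Y₁ - 1 by ring, show X₂ - (Y₁ + 1) = X₂ - Y₁ - 1 by ring,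
      sub_add_cancel, sub_add_cancel]
    ring
  rw [e, norm_neg]
  exact norm_mul_sub_le (k := 2) (l := 1) hK hκ hκ1 (by positivity) (H.free_one _) (H.free_zero _)
    (H.scat_left _ _ (by omega)) (by linarith) (by linarith)

/-- Here the shift lowers the second scattering displacement and widens the gap to `3`, so no extra
separation is needed. -/
theorem KernelBounds.norm_pairKernel_sub_left_two_le (H : KernelBounds b u v r κ K t)
    (hE : Encloses b u v r) (hK : 0 ≤ K) (hκ : 0 ≤ κ) (hκ1 : κ ≤ 1) (hX : X₁ < X₂)
    (hY : Y₁ < Y₂) :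
    ‖pairKernel b u v r Y₁ (Y₂ + 1) X₁ X₂ t - pairKernel b u v r Y₁ Y₂ X₁ X₂ t‖ ≤
      3 * (K ^ 2 + K) * (√((t : ℝ) + 1))⁻¹ ^ 3 *
      Real.exp (-(κ * (|((X₁ - Y₁ : ℤ) : ℝ) - speed b u v * t| +
        |((X₂ - Y₂ : ℤ) : ℝ) - speed b u v * t|))) := by
  have := abs_displacement_le hX hY (speed b u v * t)
  have h1 := abs_pred_sub_le (X₂ - Y₂) (speed b u v * t)
  have h2 := abs_pred_sub_le (X₁ - Y₂) (speed b u v * t)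
  have e : pairKernel b u v r Y₁ (Y₂ + 1) X₁ X₂ t - pairKernel b u v r Y₁ Y₂ X₁ X₂ t =
      -(freeKernel b u v r (X₁ - Y₁) 0 t * freeKernel b u v r (X₂ - Y₂ - 1) 1 t -
        scatKernel b u v r (X₂ - Y₁) (X₁ - Y₂ - 1) 0 1 t) := by
    rw [← freeKernel_succ_sub hE, ← scatKernel_succ_right_sub hE]
    unfold pairKernel
    rw [show X₂ - (Y₂ + 1) = X₂ - Y₂ - 1 by ring, show X₁ - (Y₂ + 1) = X₁ - Y₂ - 1 by ring,
      sub_add_cancel, sub_add_cancel]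
    ring
  rw [e, norm_neg]
  exact norm_mul_sub_le (k := 1) (l := 2) hK hκ hκ1 (by positivity) (H.free_zero _) (H.free_one _)
    (H.scat_right _ _ (by omega)) (by linarith) (by linarith)

end Pair

/-- The kernel bounds at time `0`. -/
theorem kernelBounds_zero_time {κ : ℝ} (hE : Encloses b u v r) (hu : 0 < u) (hv : 0 < v)
    (hκ : 0 ≤ κ) (hκ1 : κ ≤ 1) : KernelBounds b u v r κ 4 0 := by
  have h := KernelBounds.of_bounded_time (K := 1) (t := 0) (N := 0) hE hκ hκ1 zero_le_one le_rfl
    (fun n => ?_) (fun n₁ n₂ hn => ?_)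
  · simpa using h
  · rw [hE.freeKernel_zero_time]
    split_ifs with hn
    · simp [hn]
    · rw [norm_zero]
      positivity
  · rw [hE.scatKernel_zero_time hu hv hn, norm_zero]
    positivity

theorem Subcritical.abs_speed_le {c U : ℝ} (S : Subcritical b c U u v) :
    |speed b u v| ≤ U / (1 - b) := by
  obtain ⟨hb0, hb1⟩ := S.b_mem
  have hv := S.v_lt_one
  have hv0 := S.v_pos
  have hu := S.one_le_u
  have h4 : b * v ≤ b := mul_le_of_le_one_right hb0.le hv.le
  have h0 : 0 < b * v := by positivity
  have h3 : 1 - b ≤ b + (u - b * u - b * v) := by nlinarith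
  have hb' : 0 < 1 - b := by linarith
  rw [speed, abs_of_nonneg (div_nonneg (mul_nonneg hb'.le (by linarith))
    (mul_nonneg (by linarith) (by linarith)))]
  calc (1 - b) * (u - b * v) / ((b + (u - b * u - b * v)) * (1 - b * v))
      ≤ (1 - b) * U / ((1 - b) * (1 - b)) := by
        have := S.u_le
        have : 0 ≤ U := by linarith
        gcongr <;> linarith
    _ = _ := by field_simp

/-- For `t ≤ N` the drift `μ t` is at most `M`. Passing from `|n|` to `|n - μ t|` then costs at most
`exp (2M)`, even for two particles, because `κ ≤ 1`. -/
theorem exists_kernelBounds_subcritical (hb : b ∈ Ioo (0 : ℝ) 1) {γ U : ℝ} (hγ : 0 < γ)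
    (hU : 1 ≤ U) (N : ℕ) : ∃ K > 0, ∀ (u v r κ : ℝ) (t : ℕ),
      Subcritical b (Real.exp (-γ)) U u v → Encloses b u v r → t ≤ N → 0 ≤ κ → κ ≤ 1 → κ ≤ γ →
      KernelBounds b u v r κ K t := by
  have hc : Real.exp (-γ) ∈ Ioo (0 : ℝ) 1 := ⟨Real.exp_pos _, Real.exp_lt_one_iff.2 (by linarith)⟩
  obtain ⟨K₁, hK₁, H₁⟩ := exists_norm_freeKernel_subcritical_le hb hc hU N
  obtain ⟨K₂, hK₂, H₂⟩ := exists_norm_scatKernel_subcritical_le hb hc hU N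
  set M := U / (1 - b) * N with hM
  have hM0 : 0 ≤ M := by
    have : 0 < 1 - b := by linarith [hb.2]
    positivity
  refine ⟨4 * ((K₁ + K₂) * Real.exp (2 * M)) * √((N : ℝ) + 1) ^ 3, by positivity, ?_⟩
  intro u v r κ t S hE ht hκ hκ1 hκγ
  have hshift : ∀ n : ℤ, |(n : ℝ) - speed b u v * t| ≤ n.natAbs + M := by
    intro n
    have h1 : |speed b u v * t| ≤ M := by
      rw [abs_mul, Nat.abs_cast]
      have := S.abs_speed_le
      have : (t : ℝ) ≤ N := by exact_mod_cast ht
      have : 0 ≤ U / (1 - b) := (abs_nonneg _).trans S.abs_speed_le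
      exact mul_le_mul (by assumption) (by assumption) t.cast_nonneg (by assumption)
    have h2 : |(n : ℝ)| = n.natAbs := by rw [Nat.cast_natAbs, Int.cast_abs]
    linarith [abs_sub (n : ℝ) (speed b u v * t)]
  have hexp : ∀ (m : ℕ) (x : ℝ), x ≤ m + 2 * M →
      Real.exp (-γ) ^ m ≤ Real.exp (2 * M) * Real.exp (-(κ * x)) := by
    intro m x hx
    rw [← Real.exp_nat_mul, ← Real.exp_add]
    refine Real.exp_le_exp.2 ?_
    have h1 : κ * x ≤ κ * (m + 2 * M) := by gcongr
    have h2 : κ * (2 * M) ≤ 1 * (2 * M) := by gcongr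
    have h3 : (m : ℝ) * κ ≤ m * γ := by gcongr
    linarith
  refine KernelBounds.of_bounded_time hE hκ hκ1 (by positivity) ht (fun n => ?_)
    (fun n₁ n₂ hn => ?_)
  · refine (H₁ u v r t S hE ht n).trans ?_
    have := hexp n.natAbs |(n : ℝ) - speed b u v * t| (by linarith [hshift n])
    rw [mul_assoc (K₁ + K₂)]
    gcongr
    linarith
  · refine (H₂ u v r t S hE ht n₁ n₂ hn).trans ?_
    have := hexp (n₁.natAbs + n₂.natAbs) (|(n₁ : ℝ) - speed b u v * t| +
      |(n₂ : ℝ) - speed b u v * t|) (by push_cast; linarith [hshift n₁, hshift n₂])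
    rw [mul_assoc (K₁ + K₂)]
    gcongr
    linarith

theorem exists_kernelBounds_nearCritical (hb : b ∈ Ioo (0 : ℝ) 1) {c h k K : ℝ} (hc : 0 < c)
    (hh : 0 < h) (hk : 0 < k) (hK : 0 < K) : ∃ K' > 0, ∀ (u v r κ κ' : ℝ) (t : ℕ),
      NearCritical b c h k K u v κ t → Encloses b u v r → κ' ≤ κ / 2 →
      KernelBounds b u v r κ' K' t := by
  obtain ⟨F₀, hF₀, f₀⟩ := exists_norm_freeKernel_le (b := b) (k := k) hc hh hK 0
  obtain ⟨F₁, hF₁, f₁⟩ := exists_norm_freeKernel_le (b := b) (k := k) hc hh hK 1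
  obtain ⟨S₀, hS₀, s₀⟩ := exists_norm_scatKernel_le hb hc hh hk hK 0 0
  obtain ⟨S₁, hS₁, s₁⟩ := exists_norm_scatKernel_le hb hc hh hk hK 1 0
  obtain ⟨S₂, hS₂, s₂⟩ := exists_norm_scatKernel_le hb hc hh hk hK 0 1
  -- The factor `8 = 2 ^ 3` pays for replacing `t^(-1/2)` by `2 (t + 1)^(-1/2)` in powers up to
  -- three.
  refine ⟨8 * (F₀ + F₁ + S₀ + S₁ + S₂), by positivity, ?_⟩
  intro u v r κ κ' t N hE hκ
  have h0 := N.kappa_pos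
  have ht : (1 : ℝ) ≤ t := by exact_mod_cast N.one_le_t
  have hw : (√(t : ℝ))⁻¹ ≤ 2 * (√((t : ℝ) + 1))⁻¹ := by
    rw [← div_eq_mul_inv, inv_le_comm₀ (by positivity) (by positivity), inv_div,
      div_le_iff₀ two_pos, Real.sqrt_le_left (by positivity), mul_pow, Real.sq_sqrt (by linarith)]
    linarith
  have fin : ∀ (i : ℕ) (P x y : ℝ), i ≤ 3 → 0 ≤ P → P ≤ F₀ + F₁ + S₀ + S₁ + S₂ → x ≤ y →
      P * (√(t : ℝ))⁻¹ ^ i * Real.exp x ≤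
        8 * (F₀ + F₁ + S₀ + S₁ + S₂) * (√((t : ℝ) + 1))⁻¹ ^ i * Real.exp y := by
    intro i P x y hi hP0 hP hxy
    have h1 : (√(t : ℝ))⁻¹ ^ i ≤ 8 * (√((t : ℝ) + 1))⁻¹ ^ i := by
      refine (pow_le_pow_left₀ (by positivity) hw i).trans ?_
      rw [mul_pow]
      have : (2 : ℝ) ^ i ≤ 2 ^ 3 := pow_le_pow_right₀ one_le_two hi
      gcongr
      linarith
    calc _ ≤ (F₀ + F₁ + S₀ + S₁ + S₂) * (8 * (√((t : ℝ) + 1))⁻¹ ^ i) * Real.exp y := by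
          gcongr
      _ = _ := by ring
  have e1 : ∀ n : ℤ, -(κ * |(n : ℝ) - speed b u v * t|) ≤
      -(κ' * |(n : ℝ) - speed b u v * t|) := by
    intro n
    have : κ' ≤ κ := by linarith
    gcongr
  have e2 : ∀ n₁ n₂ : ℤ,
      -(κ / 2 * (|(n₁ : ℝ) - speed b u v * t| + |(n₂ : ℝ) - speed b u v * t|)) ≤
      -(κ' * (|(n₁ : ℝ) - speed b u v * t| + |(n₂ : ℝ) - speed b u v * t|)) := by
    intro n₁ n₂
    gcongr
  exact ⟨
    fun n => (f₀ u v κ r t N hE n).trans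
      (fin 1 _ _ _ (by norm_num) hF₀.le (by linarith) (e1 n)),
    fun n => (f₁ u v κ r t N hE n).trans
      (fin 2 _ _ _ (by norm_num) hF₁.le (by linarith) (e1 n)),
    fun n₁ n₂ hn => (s₀ u v κ r t N hE n₁ n₂ (by simpa using hn)).trans
      (fin 2 _ _ _ (by norm_num) hS₀.le (by linarith) (e2 n₁ n₂)),
    fun n₁ n₂ hn => (s₁ u v κ r t N hE n₁ n₂ (by simpa using hn)).trans
      (fin 3 _ _ _ (by norm_num) hS₁.le (by linarith) (e2 n₁ n₂)),
    fun n₁ n₂ hn => (s₂ u v κ r t N hE n₁ n₂ (by push_cast; omega)).trans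
      (fin 3 _ _ _ (by norm_num) hS₂.le (by linarith) (e2 n₁ n₂))⟩

/-- The rate is twice the target because the scattering estimate loses a half. The extra `4 ε`
dominates `(u - 1)²` and `(1 - v)²`, and half of it dominates `(u - 1)(1 - v)`. It stays of order
`t^(-1/2)` because `t ε² ≤ T`. -/
theorem NearCritical.of_small (hb : b ∈ Ioo (0 : ℝ) 1) {c h α T δ κ₀ C ε : ℝ} {t : ℕ}
    (hh : 0 < h) (hα : 0 < α) (hT : 0 < T)
    (HC : ∀ u v r : ℝ, |u - 1| < δ → |v - 1| < δ → |r - 1| < δ → ContourBounds b c h u v r)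
    (hκb : κ₀ ≤ (1 - b) / 20) (hκδ : κ₀ ≤ δ / 7) (hC : 0 < C) (hαC : 4 * α ≤ κ₀ * C)
    (hε : 0 < ε) (hε₁ : √ε ≤ 1 / 32) (hεκ : √ε ≤ κ₀ / 8) (hu : 1 ≤ u)
    (hux : u - 1 ≤ 2 * √ε) (hv : v ≤ 1) (hvx : 1 - v ≤ √ε) (ht : 1 ≤ t)
    (htε : (t : ℝ) * ε ^ 2 ≤ T) :
    NearCritical b c h (2 * α / (2 + C)) (2 * α + 4 * √T) u v
      (2 * (α / (√((t : ℝ) + 1) + C)) + 4 * ε) t := by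
  have hsε : 0 < √ε := Real.sqrt_pos.2 hε
  have hsq : √ε ^ 2 = ε := Real.sq_sqrt hε.le
  have ht1 : (1 : ℝ) ≤ t := by exact_mod_cast ht
  have hst : 0 < √(t : ℝ) := by positivity
  have hst1 : 0 < √((t : ℝ) + 1) := by positivity
  have hκ0 : 0 < α / (√((t : ℝ) + 1) + C) := by positivity
  have h4ε : 4 * ε ≤ κ₀ / 2 := by
    have : √ε * √ε ≤ 1 / 32 * (κ₀ / 8) := mul_le_mul hε₁ hεκ hsε.le (by norm_num)
    rw [← sq, hsq] at this
    linarith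
  have h2κ : 2 * (α / (√((t : ℝ) + 1) + C)) ≤ κ₀ / 2 := by
    have h1 : α / (√((t : ℝ) + 1) + C) ≤ α / C := by
      gcongr
      linarith
    have h2 : α / C ≤ κ₀ / 4 := by
      rw [div_le_iff₀ hC]
      linarith
    linarith
  have hδ0 : 0 < δ := by linarith
  refine ⟨hb, hh, by positivity, ht, hu, by linarith, by linarith, hv, ?_, ?_, by linarith,
    ?_, ?_, ?_, fun x hx => ?_⟩
  · have h1 : √((t : ℝ) + 1) + C ≤ (2 + C) * √(t : ℝ) := by
      have h2 : √((t : ℝ) + 1) ≤ 2 * √(t : ℝ) := by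
        rw [Real.sqrt_le_left (by positivity), mul_pow, Real.sq_sqrt (by linarith)]
        linarith
      have h3 : 1 ≤ √(t : ℝ) := by rw [Real.one_le_sqrt]; exact ht1
      have h4 : C * 1 ≤ C * √(t : ℝ) := by gcongr
      linarith
    have h4 : 2 * α / (2 + C) * (√(t : ℝ))⁻¹ = 2 * (α / ((2 + C) * √(t : ℝ))) := by
      field_simp
    rw [h4]
    have h5 : α / ((2 + C) * √(t : ℝ)) ≤ α / (√((t : ℝ) + 1) + C) := by gcongr
    linarith
  · have h1 : α / (√((t : ℝ) + 1) + C) ≤ α * (√(t : ℝ))⁻¹ := by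
      rw [← div_eq_mul_inv]
      have : √(t : ℝ) ≤ √((t : ℝ) + 1) := Real.sqrt_le_sqrt (by linarith)
      gcongr
      linarith
    have h2 : ε ≤ √T * (√(t : ℝ))⁻¹ := by
      rw [← div_eq_mul_inv, ← Real.sqrt_div hT.le]
      refine Real.le_sqrt_of_sq_le ?_
      rw [le_div_iff₀ (by linarith)]
      linarith
    linarith
  · have : (u - 1) ^ 2 ≤ (2 * √ε) ^ 2 := pow_le_pow_left₀ (by linarith) hux 2
    rw [mul_pow, hsq] at this
    linarith
  · have : (1 - v) ^ 2 ≤ √ε ^ 2 := pow_le_pow_left₀ (by linarith) hvx 2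
    rw [hsq] at this
    linarith
  · have : (u - 1) * (1 - v) ≤ (2 * √ε) * √ε :=
      mul_le_mul hux hvx (by linarith) (by positivity)
    rw [mul_assoc, ← sq, hsq] at this
    linarith
  · refine HC _ _ _ ?_ ?_ ?_
    · rw [abs_of_nonneg (by linarith)]
      linarith
    · rw [abs_sub_comm, abs_of_nonneg (by linarith)]
      linarith
    · have := Real.abs_exp_sub_one_le (x := x) (by linarith [hb.1])
      linarith

theorem tau_rpow (ε x : ℝ) : tau ε ^ x = Real.exp (-√ε * x) := (Real.exp_mul _ _).symm

/-- The kernel bounds, uniformly over all parameters of the model. -/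
theorem exists_kernelBounds {ρ : ℝ} (hb : b ∈ Ioo (0 : ℝ) 1) (hρ : ρ ∈ Ioo (0 : ℝ) 1) {α : ℝ}
    (hα : 0 < α) : ∃ Cα > 0, α ≤ Cα ∧ ∀ T > 0, ∃ K > 0, ∀ (ε r : ℝ) (t : ℕ), 0 < ε →
      Encloses b (tau ε ^ (-ρ)) (tau ε ^ (1 - ρ)) r → (t : ℝ) ≤ ε ^ (-2 : ℤ) * T →
      KernelBounds b (tau ε ^ (-ρ)) (tau ε ^ (1 - ρ)) r (α / (√((t : ℝ) + 1) + Cα)) K t := by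
  obtain ⟨c, hc, h, hh, δ, hδ, HC⟩ := exists_contourBounds hb
  obtain ⟨hb0, hb1⟩ := id hb
  obtain ⟨hρ0, hρ1⟩ := hρ
  have hb' : 0 < 1 - b := by linarith
  have hρ' : 0 < 1 - ρ := by linarith
  set κ₀ := min ((1 - b) / 20) (δ / 7) with hκ₀
  have hκ₀0 : 0 < κ₀ := by positivity
  have hκ₀b : κ₀ ≤ (1 - b) / 20 := min_le_left _ _
  have hκ₀δ : κ₀ ≤ δ / 7 := min_le_right _ _
  set e₀ := min (1 / 32) (κ₀ / 8) with he₀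
  have he₀0 : 0 < e₀ := by positivity
  have he₀1 : e₀ ≤ 1 / 32 := min_le_left _ _
  have he₀κ : e₀ ≤ κ₀ / 8 := min_le_right _ _
  -- Once `√ε > e₀`, this gives `v ≤ exp (-γ) ^ 2`, the subcritical condition.
  set γ := (1 - ρ) * e₀ / 2 with hγ
  have hγ0 : 0 < γ := by positivity
  -- The three terms make the rate small enough for the near-critical contours, at most `γ` in the
  -- subcritical regime, and at most `1`. None involves `T`; only the constants chosen afterwards
  -- do.
  set Cα := 4 * α / κ₀ + α / γ + α with hCα
  have hCα0 : 0 < Cα := by positivity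
  have hC1 : α ≤ Cα := by
    have h1 : 0 < 4 * α / κ₀ := by positivity
    have h2 : 0 < α / γ := by positivity
    linarith
  have hC2 : 4 * α ≤ κ₀ * Cα := by
    have h1 : 4 * α / κ₀ ≤ Cα := by
      have h2 : 0 < α / γ := by positivity
      linarith
    rw [div_le_iff₀ hκ₀0] at h1
    linarith
  have hC3 : α ≤ γ * Cα := by
    have h1 : α / γ ≤ Cα := by
      have h2 : 0 < 4 * α / κ₀ := by positivity
      linarith
    rw [div_le_iff₀ hγ0] at h1
    linarith
  refine ⟨Cα, hCα0, hC1, fun T hT => ?_⟩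
  obtain ⟨K₁, hK₁, H₁⟩ := exists_kernelBounds_nearCritical hb (k := 2 * α / (2 + Cα))
    (K := 2 * α + 4 * √T) hc hh (by positivity) (by positivity)
  -- If `√ε > e₀`, then `t ε² ≤ T` gives `t ≤ T / e₀ ^ 4`; and for `t ≥ 1` it gives `ε ≤ √T`, whence
  -- `u ≤ exp (√√T)`.
  obtain ⟨K₂, hK₂, H₂⟩ := exists_kernelBounds_subcritical hb hγ0 (U := Real.exp (√√T))
    (Real.one_le_exp (Real.sqrt_nonneg _)) ⌈T / e₀ ^ 4⌉₊
  refine ⟨4 + K₁ + K₂, by positivity, ?_⟩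
  intro ε r t hε hE ht
  have hsε : 0 < √ε := Real.sqrt_pos.2 hε
  have hsq : √ε ^ 2 = ε := Real.sq_sqrt hε.le
  have ht1 : 1 ≤ √((t : ℝ) + 1) := by
    rw [Real.one_le_sqrt]
    linarith [(Nat.cast_nonneg t : (0 : ℝ) ≤ t)]
  have hden : Cα < √((t : ℝ) + 1) + Cα := by linarith
  have hκ0 : 0 < α / (√((t : ℝ) + 1) + Cα) := by positivity
  have hκC : α / (√((t : ℝ) + 1) + Cα) ≤ α / Cα := by gcongr
  have hκ1 : α / (√((t : ℝ) + 1) + Cα) ≤ 1 := hκC.trans ((div_le_one hCα0).2 hC1)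
  have hu : tau ε ^ (-ρ) = Real.exp (√ε * ρ) := by rw [tau_rpow]; ring_nf
  have hv : tau ε ^ (1 - ρ) = Real.exp (-(√ε * (1 - ρ))) := by rw [tau_rpow]; ring_nf
  have hu1 : 1 ≤ tau ε ^ (-ρ) := by rw [hu]; exact Real.one_le_exp (by positivity)
  have hv0 : 0 < tau ε ^ (1 - ρ) := by rw [hv]; exact Real.exp_pos _
  have hv1 : tau ε ^ (1 - ρ) ≤ 1 := by
    rw [hv, Real.exp_le_one_iff, neg_nonpos]
    positivity
  have htε : (t : ℝ) * ε ^ 2 ≤ T := by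
    rw [zpow_neg, inv_mul_eq_div, le_div_iff₀ (by positivity)] at ht
    exact_mod_cast ht
  rcases Nat.eq_zero_or_pos t with rfl | htpos
  · exact (kernelBounds_zero_time hE (by linarith) hv0 hκ0.le hκ1).mono (by linarith)
  have ht1' : (1 : ℝ) ≤ t := by exact_mod_cast htpos
  have hst : 0 < √(t : ℝ) := by positivity
  rcases le_or_gt (√ε) e₀ with hcase | hcase
  · refine (H₁ _ _ r (2 * (α / (√((t : ℝ) + 1) + Cα)) + 4 * ε) _ t ?_ hE
      (by linarith)).mono (by linarith)
    have hux : tau ε ^ (-ρ) - 1 ≤ 2 * √ε := by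
      have h1 : √ε * ρ ≤ √ε := mul_le_of_le_one_right hsε.le hρ1.le
      have h2 := Real.abs_exp_sub_one_le (x := √ε * ρ)
        (by rw [abs_of_nonneg (by positivity)]; linarith)
      rw [abs_of_nonneg (by positivity : 0 ≤ √ε * ρ), ← hu] at h2
      linarith [le_abs_self (tau ε ^ (-ρ) - 1)]
    have hvx : 1 - tau ε ^ (1 - ρ) ≤ √ε := by
      have h1 : √ε * (1 - ρ) ≤ √ε := mul_le_of_le_one_right hsε.le (by linarith)
      have h2 := Real.add_one_le_exp (-(√ε * (1 - ρ)))
      rw [hv]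
      linarith
    exact NearCritical.of_small hb hh hα hT HC hκ₀b hκ₀δ hCα0 hC2 hε (hcase.trans he₀1)
      (hcase.trans he₀κ) hu1 hux hv1 hvx htpos htε
  · refine (H₂ _ _ r _ t ⟨hb, ⟨Real.exp_pos _, Real.exp_lt_one_iff.2 (by linarith)⟩, hu1, ?_, hv0, ?_⟩
      hE ?_ hκ0.le hκ1 (hκC.trans ?_)).mono (by linarith)
    · rw [hu]
      refine Real.exp_le_exp.2 ?_
      have h1 : √ε * ρ ≤ √ε := mul_le_of_le_one_right hsε.le hρ1.le
      have h2 : ε ≤ √T := by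
        refine Real.le_sqrt_of_sq_le ?_
        nlinarith [sq_nonneg ε]
      exact h1.trans (Real.sqrt_le_sqrt h2)
    · rw [hv, ← Real.exp_nat_mul]
      refine Real.exp_le_exp.2 ?_
      have h1 : e₀ * (1 - ρ) ≤ √ε * (1 - ρ) := by gcongr
      rw [hγ]
      push_cast
      linarith
    · have h1 : e₀ ^ 4 ≤ ε ^ 2 := by
        calc e₀ ^ 4 ≤ √ε ^ 4 := by gcongr
          _ = (√ε ^ 2) ^ 2 := by ring
          _ = ε ^ 2 := by rw [hsq]
      have h2 : (t : ℝ) ≤ T / e₀ ^ 4 := by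
        rw [le_div_iff₀ (by positivity)]
        refine le_trans ?_ htε
        gcongr
      exact_mod_cast h2.trans (Nat.le_ceil _)
    · rw [div_le_iff₀ hCα0]
      exact hC3

end S6V

/-! ### Transfer of the kernel bounds to the semigroup. -/

theorem proposition5p1 (b₁ ρ : ℝ) (hb₁ : b₁ ∈ Set.Ioo (0 : ℝ) 1) (hρ : ρ ∈ Set.Ioo (0 : ℝ) 1) :
    ∀ α : ℝ, 0 < α → ∃ Cα : ℝ, 0 < Cα ∧ ∀ T : ℝ, 0 < T → ∃ CαT : ℝ, 0 < CαT ∧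
      ∀ ε : ℝ, 0 < ε → ∀ r : ℝ, S6V.EnclosesPoles b₁ ρ ε r →
      ∀ s t : ℕ, (s : ℝ) ≤ ε ^ (-2 : ℤ) * T → (t : ℝ) ≤ ε ^ (-2 : ℤ) * T →
      ∀ x₁ ∈ S6V.Xi b₁ ρ ε (t + s), ∀ x₂ ∈ S6V.Xi b₁ ρ ε (t + s),
      ∀ y₁ ∈ S6V.Xi b₁ ρ ε s, ∀ y₂ ∈ S6V.Xi b₁ ρ ε s,
      x₁ < x₂ → y₁ < y₂ →
        ‖S6V.semigroup b₁ ρ ε r (y₁, y₂) (x₁, x₂) t‖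
            ≤ CαT / ((t : ℝ) + 1) *
              Real.exp (-(α * (|x₁ - y₁| + |x₂ - y₂|)) / (√((t : ℝ) + 1) + Cα)) ∧
        (x₁ + 1 < x₂ →
          ‖fwdDiff 1 (fun u : ℝ => S6V.semigroup b₁ ρ ε r (y₁, y₂) (u, x₂) t) x₁‖
            ≤ CαT / ((t : ℝ) + 1) ^ (3 / 2 : ℝ) *
              Real.exp (-(α * (|x₁ - y₁| + |x₂ - y₂|)) / (√((t : ℝ) + 1) + Cα))) ∧
        ‖fwdDiff 1 (fun u : ℝ => S6V.semigroup b₁ ρ ε r (y₁, y₂) (x₁, u) t) x₂‖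
            ≤ CαT / ((t : ℝ) + 1) ^ (3 / 2 : ℝ) *
              Real.exp (-(α * (|x₁ - y₁| + |x₂ - y₂|)) / (√((t : ℝ) + 1) + Cα)) ∧
        (y₁ + 1 < y₂ →
          ‖fwdDiff 1 (fun u : ℝ => S6V.semigroup b₁ ρ ε r (u, y₂) (x₁, x₂) t) y₁‖
            ≤ CαT / ((t : ℝ) + 1) ^ (3 / 2 : ℝ) *
              Real.exp (-(α * (|x₁ - y₁| + |x₂ - y₂|)) / (√((t : ℝ) + 1) + Cα))) ∧
        ‖fwdDiff 1 (fun u : ℝ => S6V.semigroup b₁ ρ ε r (y₁, u) (x₁, x₂) t) y₂‖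
            ≤ CαT / ((t : ℝ) + 1) ^ (3 / 2 : ℝ) *
              Real.exp (-(α * (|x₁ - y₁| + |x₂ - y₂|)) / (√((t : ℝ) + 1) + Cα)) := by
  intro α hα
  obtain ⟨Cα, hCα, hαC, H⟩ := S6V.exists_kernelBounds hb₁ hρ hα
  refine ⟨Cα, hCα, fun T hT => ?_⟩
  obtain ⟨K, hK, H⟩ := H T hT
  refine ⟨3 * (K ^ 2 + K), by positivity, ?_⟩
  rintro ε hε r hr s t - ht x₁ ⟨X₁, hx₁⟩ x₂ ⟨X₂, hx₂⟩ y₁ ⟨Y₁, hy₁⟩ y₂ ⟨Y₂, hy₂⟩ hx hy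
  have hE := hr.encloses
  specialize H ε r t hε hE ht
  have ht0 : (0 : ℝ) < (t : ℝ) + 1 := by positivity
  have hκ : 0 ≤ α / (√((t : ℝ) + 1) + Cα) := by positivity
  have hκ1 : α / (√((t : ℝ) + 1) + Cα) ≤ 1 :=
    (div_le_one (by positivity)).2 (by linarith [Real.sqrt_nonneg ((t : ℝ) + 1)])
  push_cast at hx₁ hx₂
  have hX : X₁ < X₂ := by
    have : (X₁ : ℝ) < X₂ := by linarith
    exact_mod_cast this
  have hY : Y₁ < Y₂ := by
    have : (Y₁ : ℝ) < Y₂ := by linarith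
    exact_mod_cast this
  -- The moving lattice has exactly the speed of the symbol, so the drift-corrected integer
  -- displacement is `x - y` and `s` drops out.
  have hd : ∀ (X Y : ℤ) (x y : ℝ), x = X - ((t : ℝ) + s) * S6V.mu b₁ ρ ε →
      y = Y - s * S6V.mu b₁ ρ ε →
      ((X - Y : ℤ) : ℝ) - S6V.speed b₁ (S6V.tau ε ^ (-ρ)) (S6V.tau ε ^ (1 - ρ)) * t = x - y := by
    rintro X Y x y rfl rfl
    rw [← S6V.mu_eq]
    push_cast
    ring
  have hsucc : ∀ (X : ℤ) (x m : ℝ), x = X - m → x + 1 = ((X + 1 : ℤ) : ℝ) - m := by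
    rintro X x m rfl
    push_cast
    ring
  have hexp : Real.exp (-(α * (|x₁ - y₁| + |x₂ - y₂|)) / (√((t : ℝ) + 1) + Cα)) =
      Real.exp (-(α / (√((t : ℝ) + 1) + Cα) * (|x₁ - y₁| + |x₂ - y₂|))) := by
    congr 1
    ring
  have hw2 : 3 * (K ^ 2 + K) / ((t : ℝ) + 1) = 3 * (K ^ 2 + K) * (√((t : ℝ) + 1))⁻¹ ^ 2 := by
    rw [inv_pow, Real.sq_sqrt ht0.le, div_eq_mul_inv]
  have hw3 : 3 * (K ^ 2 + K) / ((t : ℝ) + 1) ^ (3 / 2 : ℝ) =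
      3 * (K ^ 2 + K) * (√((t : ℝ) + 1))⁻¹ ^ 3 := by
    have : √((t : ℝ) + 1) ^ 3 = ((t : ℝ) + 1) ^ (3 / 2 : ℝ) := by
      rw [Real.sqrt_eq_rpow, ← Real.rpow_natCast (((t : ℝ) + 1) ^ (1 / 2 : ℝ)) 3,
        ← Real.rpow_mul ht0.le]
      norm_num
    rw [inv_pow, this, div_eq_mul_inv]
  rw [hexp, hw2, hw3, ← hd X₁ Y₁ x₁ y₁ hx₁ hy₁, ← hd X₂ Y₂ x₂ y₂ hx₂ hy₂]
  have key := fun X₁ X₂ Y₁ Y₂ x₁ x₂ y₁ y₂ hx₁ hx₂ hy₁ hy₂ =>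
    S6V.semigroup_eq_pairKernel (X₁ := X₁) (X₂ := X₂) (Y₁ := Y₁) (Y₂ := Y₂) (x₁ := x₁) (x₂ := x₂)
      (y₁ := y₁) (y₂ := y₂) hr s t hx₁ hx₂ hy₁ hy₂
  simp only [fwdDiff]
  rw [key X₁ X₂ Y₁ Y₂ x₁ x₂ y₁ y₂ hx₁ hx₂ hy₁ hy₂,
    key (X₁ + 1) X₂ Y₁ Y₂ (x₁ + 1) x₂ y₁ y₂ (hsucc _ _ _ hx₁) hx₂ hy₁ hy₂,
    key X₁ (X₂ + 1) Y₁ Y₂ x₁ (x₂ + 1) y₁ y₂ hx₁ (hsucc _ _ _ hx₂) hy₁ hy₂,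
    key X₁ X₂ (Y₁ + 1) Y₂ x₁ x₂ (y₁ + 1) y₂ hx₁ hx₂ (hsucc _ _ _ hy₁) hy₂,
    key X₁ X₂ Y₁ (Y₂ + 1) x₁ x₂ y₁ (y₂ + 1) hx₁ hx₂ hy₁ (hsucc _ _ _ hy₂)]
  refine ⟨H.norm_pairKernel_le hK.le hκ hκ1 hX hY, fun h => ?_,
    H.norm_pairKernel_sub_right_two_le hE hK.le hκ hκ1 hX hY, fun h => ?_,
    H.norm_pairKernel_sub_left_two_le hE hK.le hκ hκ1 hX hY⟩
  · refine H.norm_pairKernel_sub_right_one_le hE hK.le hκ hκ1 ?_ hY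
    have : (X₁ : ℝ) + 1 < X₂ := by linarith
    exact_mod_cast this
  · refine H.norm_pairKernel_sub_left_one_le hE hK.le hκ hκ1 hX ?_
    have : (Y₁ : ℝ) + 1 < Y₂ := by linarith
    exact_mod_cast this
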